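/- **Setting.** Let $d\in\{2,3\}$, $k\ge 0$, and let $\Omega\subset\mathbb R^d$ be a bounded open set. A mesh $\mathcal T_h$ of $\Omega$ is a finite collection of pairwise disjoint nonempty open cells $K\subset\Omega$ with $K=\operatorname{int}\overline K$ and $\overline\Omega=\bigcup_K\overline K$, together with finitely many faces, pairwise nonoverlapping (intersections of zero surface measure), such that each $\partial K$ is the union of the faces contained in it. Each face is a compact piece of a surface, the closure of its relative interior, with relative boundary of zero surface measure. The interior faces $F\in\mathcal F_h^{\rm i}$ are planar, meet $\partial\Omega$ in a set of zero surface measure, and are oriented by a fixed unit normal $\mathbf n_F$; each is shared by two distinct cells, for which $\mathbf n_F$ and $-\mathbf n_F$, respectively, are the outward normals on $F$. The boundary faces are contained in $\partial\Omega$ and are pieces of $C^2$ hypersurfaces. For a cell $K$, $h_K$ is its diameter, $\mathbf n_K$ its unit outward normal, $\partial K^{\rm b}:=\partial K\cap\partial\Omega$, $\mathcal F_{\partial K^{\rm i}}$ is the set of interior faces contained in $\partial K$, and $\partial K^{\rm i}$ is their union. $K$ is a boundary cell if $\partial K^{\rm b}$ has positive surface measure, and an interior cell otherwise. The mesh is *shape-regular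 with parameter $\varrho>0$* if: * the interior cells admit a finite matching simplicial submesh: each interior cell is (up to closure) a union of $d$-simplices of the submesh, and each of its faces is a union of $(d-1)$-simplices of the submesh; every $d$-simplex $S\subset\overline K$ has diameter $h_S\ge\varrho h_K$ and contains a ball of radius $\varrho h_S$; * every planar face of a boundary cell $K$ contains a $(d-1)$-dimensional disc of radius $\varrho h_K$; * for every boundary cell $K$ and each of its boundary faces, $K$ can be decomposed into finitely many nonoverlapping subsets, each star-shaped with respect to an interior ball of radius $\varrho h_K$. Let $\varepsilon\ge0$, $\sigma_K:=\max\{1,\varepsilon h_K^{-2}\}$, and $$(\nabla v,\nabla w)_{K,\varepsilon}:=\varepsilon(\nabla^2v,\nabla^2w)_K+(\nabla v,\nabla w)_K,\qquad \|\nabla v\|_{K,\varepsilon}^2:=(\nabla v,\nabla v)_{K,\varepsilon}.$$ The local HHO space is $\hat V_K^k:=\mathbb P^{k+2}(K)\times\prod_{F\in\mathcal F_{\partial K^{\rm i}}}\mathbb P^{k+2}(F)\times\prod_{F\in\mathcal F_{\partial K^{\rm i}}}\mathbb P^{k}(F)$, with elements $\hat v_K=(v_K,v_{\partial K},\gamma_{\partial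 K})$. On $\partial K$, $\partial_n$ and $\partial_t$ are the normal (along $\mathbf n_K$) and tangential derivatives, and $\partial_{nn}$, $\partial_{nt}$ the normal-normal and normal-tangential second derivatives. The reconstruction $R_K^{\rm i}(\hat v_K)\in\mathbb P^{k+2}(K)$ is defined by $(R_K^{\rm i}(\hat v_K),1)_K=(v_K,1)_K$ and, for all $w\in\mathbb P^{k+2}(K)$ with $(w,1)_K=0$, $$\begin{aligned}(\nabla R_K^{\rm i}(\hat v_K),\nabla w)_{K,\varepsilon}={}&(v_K,\varepsilon\Delta^2w)_K-(v_K,\Delta w)_K+(v_{\partial K},\partial_nw)_{\partial K^{\rm i}}\\&-\varepsilon\big\{(v_{\partial K},\partial_n\Delta w)_{\partial K^{\rm i}}-(\gamma_{\partial K},\partial_{nn}w)_{\partial K^{\rm i}}-(\partial_tv_{\partial K},\partial_{nt}w)_{\partial K^{\rm i}}\big\}.\end{aligned}$$ With $\Pi^k_{\partial K^{\rm i}}$ the facewise $L^2$-orthogonal projection onto polynomials of degree at most $k$, and $\hat w_K=(w_K,w_{\partial K},\chi_{\partial K})$, set $$\begin{aligned}S^{\rm i}_{\partial K}(\hat v_K,\hat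 w_K):={}&\sigma_Kh_K^{-1}(v_{\partial K}-v_K,w_{\partial K}-w_K)_{\partial K^{\rm i}}+\sigma_Kh_K\big(\Pi^k_{\partial K^{\rm i}}(\gamma_{\partial K}-\partial_nv_K),\chi_{\partial K}-\partial_nw_K\big)_{\partial K^{\rm i}},\\ S^{\rm b}_{\partial K}(v_K,w_K):={}&\sigma_Kh_K^{-1}(v_K,w_K)_{\partial K^{\rm b}}+\varepsilon h_K^{-1}(\nabla v_K,\nabla w_K)_{\partial K^{\rm b}},\\ |\hat v_K|^2_{\hat V_K^k}:={}&\|\nabla v_K\|^2_{K,\varepsilon}+\sigma_Kh_K^{-1}\|v_{\partial K}-v_K\|^2_{\partial K^{\rm i}}+\sigma_Kh_K\|\gamma_{\partial K}-\partial_nv_K\|^2_{\partial K^{\rm i}}\\&+\sigma_Kh_K^{-1}\|v_K\|^2_{\partial K^{\rm b}}+\varepsilon h_K^{-1}\|\nabla v_K\|^2_{\partial K^{\rm b}}.\end{aligned}$$ The global HHO space $\hat V_h^k$ consists of $\hat v_h=((v_K)_{K\in\mathcal T_h},(v_F)_{F\in\mathcal F_h^{\rm i}},(\gamma_F)_{F\in\mathcal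 F_h^{\rm i}})$ with $v_K\in\mathbb P^{k+2}(K)$, $v_F\in\mathbb P^{k+2}(F)$, $\gamma_F\in\mathbb P^k(F)$; its local components $\hat v_K$ are given by $v_K$, $v_{\partial K}|_F=v_F$ and $\gamma_{\partial K}|_F=(\mathbf n_F\cdot\mathbf n_K)\gamma_F$. Finally, $$\hat a_h(\hat v_h,\hat w_h):=\sum_{K\in\mathcal T_h}\big\{(\nabla R_K^{\rm i}(\hat v_K),\nabla R_K^{\rm i}(\hat w_K))_{K,\varepsilon}+S^{\rm i}_{\partial K}(\hat v_K,\hat w_K)+S^{\rm b}_{\partial K}(v_K,w_K)\big\},\qquad \|\hat v_h\|^2_{\hat V_h^k}:=\sum_{K\in\mathcal T_h}|\hat v_K|^2_{\hat V_K^k}.$$ **Lemma (local stability and boundedness).** There is $\alpha>0$, depending only on $d$, $k$ and the shape-regularity parameter $\varrho$, such that for every $\Omega$, every mesh $\mathcal T_h$ of $\Omega$ that is shape-regular with parameter $\varrho$, and every $\varepsilon\ge0$: for every $K\in\mathcal T_h$ and every $\hat v_K\in\hat V_K^k$, the reconstruction $R_K^{\rm i}(\hat v_K)$ is uniquely defined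 and $$\alpha|\hat v_K|^2_{\hat V_K^k}\le\|\nabla R_K^{\rm i}(\hat v_K)\|^2_{K,\varepsilon}+S^{\rm i}_{\partial K}(\hat v_K,\hat v_K)+S^{\rm b}_{\partial K}(v_K,v_K)\le\alpha^{-1}|\hat v_K|^2_{\hat V_K^k};$$ moreover $\hat a_h(\hat v_h,\hat v_h)\ge\alpha\|\hat v_h\|^2_{\hat V_h^k}$ for all $\hat v_h\in\hat V_h^k$. -/

import Mathlib

open MeasureTheory Filter Topology

noncomputable section

namespace HHO

/-- `ℝ^d` with its Euclidean structure. -/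
abbrev Pt (d : ℕ) := EuclideanSpace ℝ (Fin d)

/-! ### Polynomials and their differential operators -/

/-- Polynomials in `d` variables of total degree at most `l`. Since cells are nonempty open sets,
this is also the space `ℙ^l(K)` for every cell `K`. The elements of `ℙ^l(F)`, for a planar face `F`,
are the restrictions to `F` of these polynomials. -/
abbrev Poly (d l : ℕ) : Submodule ℝ (MvPolynomial (Fin d) ℝ) :=
  MvPolynomial.restrictTotalDegree (Fin d) ℝ l

variable {d : ℕ}

/-- The value of a polynomial at a point. -/
def ev (p : MvPolynomial (Fin d) ℝ) (x : Pt d) : ℝ := MvPolynomial.eval (fun i => x i) p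

/-- The gradient `∇p`. -/
def grad (p : MvPolynomial (Fin d) ℝ) (x : Pt d) : Pt d :=
  WithLp.toLp 2 fun i => ev (MvPolynomial.pderiv i p) x

/-- The Hessian `∇²p`. -/
def hess (p : MvPolynomial (Fin d) ℝ) (x : Pt d) : Matrix (Fin d) (Fin d) ℝ :=
  Matrix.of fun i j => ev (MvPolynomial.pderiv i (MvPolynomial.pderiv j p)) x

/-- The Laplacian `Δp`, again a polynomial. -/
def lap (p : MvPolynomial (Fin d) ℝ) : MvPolynomial (Fin d) ℝ :=
  ∑ i, MvPolynomial.pderiv i (MvPolynomial.pderiv i p)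

/-- The normal derivative `∂ₙp = n ⬝ ∇p`. -/
def dn (n : Pt d) (p : MvPolynomial (Fin d) ℝ) (x : Pt d) : ℝ := inner ℝ (grad p x) n

/-- The tangential derivative `∂ₜp`, as a vector of `ℝ^d` orthogonal to the unit vector `n`. On a
planar face with normal `n` it depends only on the restriction of `p` to the face. -/
def dt (n : Pt d) (p : MvPolynomial (Fin d) ℝ) (x : Pt d) : Pt d := grad p x - dn n p x • n

/-- The vector `∇²p n`. -/
def hessMul (n : Pt d) (p : MvPolynomial (Fin d) ℝ) (x : Pt d) : Pt d :=
  WithLp.toLp 2 ((hess p x).mulVec fun i => n i)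

/-- The normal-normal second derivative `∂ₙₙp`. -/
def dnn (n : Pt d) (p : MvPolynomial (Fin d) ℝ) (x : Pt d) : ℝ := inner ℝ (hessMul n p x) n

/-- The normal-tangential second derivative `∂ₙₜp`, as a vector orthogonal to the unit vector `n`. -/
def dnt (n : Pt d) (p : MvPolynomial (Fin d) ℝ) (x : Pt d) : Pt d :=
  hessMul n p x - dnn n p x • n

/-- `(∇v, ∇w)_{K,ε} = ε (∇²v, ∇²w)_K + (∇v, ∇w)_K`. -/
def innerEps (ε : ℝ) (K : Set (Pt d)) (v w : MvPolynomial (Fin d) ℝ) : ℝ :=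
  ε * (∫ x in K, ∑ i, ∑ j, hess v x i j * hess w x i j) +
    ∫ x in K, inner ℝ (grad v x) (grad w x)

/-! ### Surfaces, faces and normals -/

/-- The `(d-1)`-dimensional surface measure. -/
def surf (d : ℕ) : Measure (Pt d) := Measure.euclideanHausdorffMeasure (d - 1)

/-- The hyperplane through `x₀` orthogonal to `n`. -/
def hyperplane (n x₀ : Pt d) : Set (Pt d) := {x | inner ℝ (x - x₀) n = 0}

/-- `S` is an embedded `C²` hypersurface: locally the zero set of a `C²` function with nonzero
differential. -/
def IsC2Hypersurface (S : Set (Pt d)) : Prop :=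
  ∀ x ∈ S, ∃ g : Pt d → ℝ, ContDiffAt ℝ 2 g x ∧ fderiv ℝ g x ≠ 0 ∧ ∀ᶠ y in 𝓝 x, (y ∈ S ↔ g y = 0)

/-- `F` is a closed piece of the hypersurface `S`: nonempty, compact, equal to the closure of its
relative interior, with a relative boundary of zero surface measure. -/
structure IsPatch (S F : Set (Pt d)) : Prop where
  nonempty : F.Nonempty
  isCompact : IsCompact F
  subset : F ⊆ S
  subset_closure : F ⊆ closure {x ∈ F | F ∈ 𝓝[S] x}
  null_boundary : surf d {x ∈ F | F ∉ 𝓝[S] x} = 0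

/-- `n` is the unit outward normal to `K` at the point `x` of its boundary. There is at most one
such vector. -/
def IsOutwardNormal (K : Set (Pt d)) (x n : Pt d) : Prop :=
  ‖n‖ = 1 ∧
  (∀ u : Pt d, inner ℝ u n < 0 → ∀ᶠ t : ℝ in 𝓝[>] 0, x + t • u ∈ K) ∧
  (∀ u : Pt d, 0 < inner ℝ u n → ∀ᶠ t : ℝ in 𝓝[>] 0, x + t • u ∉ K)

/-- `n` is the (constant) unit outward normal to `K` at almost every point of `F`. -/
def IsFaceNormal (K F : Set (Pt d)) (n : Pt d) : Prop :=
  ∀ᵐ x ∂((surf d).restrict F), IsOutwardNormal K x n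

/-- The unit outward normal `n_K` on a planar face `F` of `K`. -/
def faceNormal (K F : Set (Pt d)) : Pt d := Classical.epsilon (IsFaceNormal K F)

/-! ### Meshes -/

/-- A mesh of the set `Ω` by finitely many (open) cells, with planar interior faces and boundary
faces that are closed `C²` manifolds. -/
structure Mesh (d : ℕ) (Ω : Set (Pt d)) where
  /-- the mesh cells -/
  cells : Finset (Set (Pt d))
  /-- the interior faces -/
  intFaces : Finset (Set (Pt d))
  /-- the boundary faces -/
  bdryFaces : Finset (Set (Pt d))
  /-- the fixed unit normals `n_F` orienting the interior faces -/
  normal : Set (Pt d) → Pt d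
  cell_open : ∀ K ∈ cells, IsOpen K
  cell_nonempty : ∀ K ∈ cells, K.Nonempty
  /-- a cell lies on one side of its boundary (it has no slits) -/
  cell_regular : ∀ K ∈ cells, interior (closure K) = K
  cell_subset : ∀ K ∈ cells, K ⊆ Ω
  cells_disjoint : ∀ K ∈ cells, ∀ K' ∈ cells, K ≠ K' → Disjoint K K'
  cover : closure Ω = ⋃ K ∈ cells, closure K
  /-- an interior face is planar, with normal `n_F` -/
  intFace_planar : ∀ F ∈ intFaces, ‖normal F‖ = 1 ∧ ∃ x₀, IsPatch (hyperplane (normal F) x₀) F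
  /-- an interior face is shared by two distinct cells, one on each side -/
  intFace_shared : ∀ F ∈ intFaces, ∃ K ∈ cells, ∃ K' ∈ cells, K ≠ K' ∧
    F ⊆ frontier K ∧ F ⊆ frontier K' ∧ IsFaceNormal K F (normal F) ∧ IsFaceNormal K' F (-normal F)
  intFace_null : ∀ F ∈ intFaces, surf d (F ∩ frontier Ω) = 0
  /-- a boundary face is a closed `C²` manifold -/
  bdryFace_C2 : ∀ F ∈ bdryFaces, ∃ S, IsC2Hypersurface S ∧ IsPatch S F
  bdryFace_subset : ∀ F ∈ bdryFaces, F ⊆ frontier Ω ∧ ∃ K ∈ cells, F ⊆ frontier K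
  faces_nonoverlapping : ∀ F ∈ (intFaces : Set (Set (Pt d))) ∪ bdryFaces,
    ∀ F' ∈ (intFaces : Set (Set (Pt d))) ∪ bdryFaces, F ≠ F' → surf d (F ∩ F') = 0
  /-- the boundary of a cell is composed of mesh faces -/
  frontier_eq : ∀ K ∈ cells,
    frontier K = ⋃ F ∈ {F ∈ (intFaces : Set (Set (Pt d))) ∪ bdryFaces | F ⊆ frontier K}, F

namespace Mesh

variable {Ω : Set (Pt d)} (T : Mesh d Ω)

open Classical in
/-- The interior faces composing the boundary of `K`. -/
def intFacesOf (K : Set (Pt d)) : Finset (Set (Pt d)) := T.intFaces.filter (· ⊆ frontier K)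

open Classical in
/-- The boundary faces composing the boundary of `K`. -/
def bdryFacesOf (K : Set (Pt d)) : Finset (Set (Pt d)) := T.bdryFaces.filter (· ⊆ frontier K)

/-- `K` is a boundary cell: `∂K ∩ ∂Ω` has positive surface measure. -/
def IsBdryCell (_T : Mesh d Ω) (K : Set (Pt d)) : Prop := surf d (frontier K ∩ frontier Ω) ≠ 0

/-- Shape-regularity with parameter `ϱ`. -/
structure ShapeRegular (ϱ : ℝ) : Prop where
  /-- The interior cells admit a matching simplicial submesh: every interior cell is a union of
  `d`-simplices and every face of an interior cell is a union of `(d-1)`-simplices of the submesh.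
  The `d`-simplices are shape-regular, with a diameter comparable to that of the cell. -/
  interior : ∃ 𝒮 : Geometry.SimplicialComplex ℝ (Pt d), 𝒮.faces.Finite ∧
    ∀ K ∈ T.cells, ¬ T.IsBdryCell K →
      closure K = (⋃ s ∈ {s ∈ 𝒮.faces | s.card = d + 1 ∧
        convexHull ℝ (s : Set (Pt d)) ⊆ closure K}, convexHull ℝ (s : Set (Pt d))) ∧
      (∀ F ∈ T.intFacesOf K,
        F = ⋃ s ∈ {s ∈ 𝒮.faces | s.card = d ∧
          convexHull ℝ (s : Set (Pt d)) ⊆ F}, convexHull ℝ (s : Set (Pt d))) ∧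
      (∀ s ∈ 𝒮.faces, s.card = d + 1 → convexHull ℝ (s : Set (Pt d)) ⊆ closure K →
        ϱ * Metric.diam K ≤ Metric.diam (convexHull ℝ (s : Set (Pt d))) ∧
        ∃ x, Metric.closedBall x (ϱ * Metric.diam (convexHull ℝ (s : Set (Pt d)))) ⊆
          convexHull ℝ (s : Set (Pt d)))
  /-- The planar faces of a boundary cell `K` have a size comparable to that of `K`: they contain a
  `(d-1)`-dimensional disc of radius `ϱ h_K`. -/
  bdry_planar : ∀ K ∈ T.cells, T.IsBdryCell K → ∀ F ∈ T.intFacesOf K,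
    ∃ x, hyperplane (T.normal F) x ∩ Metric.closedBall x (ϱ * Metric.diam K) ⊆ F
  /-- For each boundary face, a boundary cell `K` can be decomposed into finitely many
  nonoverlapping subsets which are star-shaped with respect to an interior ball of radius
  `ϱ h_K`. -/
  bdry_starShaped : ∀ K ∈ T.cells, T.IsBdryCell K → ∀ F ∈ T.bdryFacesOf K,
    ∃ (m : ℕ) (P : Fin m → Set (Pt d)),
      (∀ i, IsOpen (P i) ∧ P i ⊆ K) ∧ Pairwise (fun i j => Disjoint (P i) (P j)) ∧
      closure K = (⋃ i, closure (P i)) ∧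
      ∀ i, ∃ x, Metric.ball x (ϱ * Metric.diam K) ⊆ P i ∧
        ∀ y ∈ Metric.ball x (ϱ * Metric.diam K), StarConvex ℝ y (P i)

/-! ### The local discretization -/

/-- The local space `ℙ^{k+2}(K) × ℙ^{k+2}(ℱ_{∂Kⁱ}) × ℙ^k(ℱ_{∂Kⁱ})`. -/
abbrev LocalSpace (K : Set (Pt d)) (k : ℕ) : Type :=
  Poly d (k + 2) × (T.intFacesOf K → Poly d (k + 2)) × (T.intFacesOf K → Poly d k)

variable {K : Set (Pt d)} {k : ℕ}

/-- The right-hand side of the reconstruction problem: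
`(v_K, εΔ²w)_K - (v_K, Δw)_K + (v_∂K, ∂ₙw)_{∂Kⁱ}
  - ε {(v_∂K, ∂ₙΔw)_{∂Kⁱ} - (γ_∂K, ∂ₙₙw)_{∂Kⁱ} - (∂ₜv_∂K, ∂ₙₜw)_{∂Kⁱ}}`. -/
def reconstructionRHS (ε : ℝ) (v : T.LocalSpace K k) (w : MvPolynomial (Fin d) ℝ) : ℝ :=
  (∫ x in K, ev v.1 x * (ε * ev (lap (lap w)) x)) - (∫ x in K, ev v.1 x * ev (lap w) x) +
    (∑ F : T.intFacesOf K, ∫ x in F, ev (v.2.1 F) x * dn (faceNormal K F) w x ∂(surf d)) -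
    ε * ((∑ F : T.intFacesOf K, ∫ x in F, ev (v.2.1 F) x * dn (faceNormal K F) (lap w) x ∂(surf d)) -
      (∑ F : T.intFacesOf K, ∫ x in F, ev (v.2.2 F) x * dnn (faceNormal K F) w x ∂(surf d)) -
      (∑ F : T.intFacesOf K, ∫ x in F,
        inner ℝ (dt (faceNormal K F) (v.2.1 F) x) (dnt (faceNormal K F) w x) ∂(surf d)))

/-- `r` solves the local reconstruction problem for `v`. -/
def IsReconstruction (ε : ℝ) (v : T.LocalSpace K k) (r : Poly d (k + 2)) : Prop :=
  (∀ w : Poly d (k + 2), (∫ x in K, ev w x) = 0 →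
    innerEps ε K r w = T.reconstructionRHS ε v w) ∧
  (∫ x in K, ev r x) = ∫ x in K, ev v.1 x

/-- The local reconstruction operator `R_Kⁱ`. -/
def reconstruction (ε : ℝ) (v : T.LocalSpace K k) : Poly d (k + 2) :=
  Classical.epsilon (T.IsReconstruction ε v)

end Mesh

/-- `p` is (a polynomial whose restriction to `F` is) the `L²(F)`-orthogonal projection of `g` onto
`ℙ^k(F)`. -/
def IsFaceProj (k : ℕ) (F : Set (Pt d)) (g : Pt d → ℝ) (p : Poly d k) : Prop :=
  ∀ q : Poly d k, ∫ x in F, ev p x * ev q x ∂(surf d) = ∫ x in F, g x * ev q x ∂(surf d)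

/-- The `L²(F)`-orthogonal projection `Π^k_F`. -/
def faceProj (k : ℕ) (F : Set (Pt d)) (g : Pt d → ℝ) : Poly d k :=
  Classical.epsilon (IsFaceProj k F g)

/-- `σ_K = max {1, ε h_K⁻²}`. -/
def sigma (ε : ℝ) (K : Set (Pt d)) : ℝ := max 1 (ε * (Metric.diam K)⁻¹ ^ 2)

namespace Mesh

variable {Ω : Set (Pt d)} (T : Mesh d Ω) {K : Set (Pt d)} {k : ℕ}

/-- The interior stabilization bilinear form `Sⁱ_∂K`. -/
def stabInt (ε : ℝ) (v w : T.LocalSpace K k) : ℝ :=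
  sigma ε K * (Metric.diam K)⁻¹ * (∑ F : T.intFacesOf K, ∫ x in F,
    (ev (v.2.1 F) x - ev v.1 x) * (ev (w.2.1 F) x - ev w.1 x) ∂(surf d)) +
  sigma ε K * Metric.diam K * (∑ F : T.intFacesOf K, ∫ x in F,
    ev (faceProj k F fun y => ev (v.2.2 F) y - dn (faceNormal K F) v.1 y) x *
      (ev (w.2.2 F) x - dn (faceNormal K F) w.1 x) ∂(surf d))

/-- The boundary stabilization bilinear form `Sᵇ_∂K`; here `∂Kᵇ = ∂K ∩ ∂Ω`. -/
def stabBdry (_T : Mesh d Ω) (ε : ℝ) (K : Set (Pt d)) (v w : MvPolynomial (Fin d) ℝ) : ℝ :=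
  sigma ε K * (Metric.diam K)⁻¹ * (∫ x in frontier K ∩ frontier Ω, ev v x * ev w x ∂(surf d)) +
  ε * (Metric.diam K)⁻¹ *
    (∫ x in frontier K ∩ frontier Ω, inner ℝ (grad v x) (grad w x) ∂(surf d))

/-- The local bilinear form `â_K`. -/
def localForm (ε : ℝ) (v w : T.LocalSpace K k) : ℝ :=
  innerEps ε K (T.reconstruction ε v) (T.reconstruction ε w) + T.stabInt ε v w +
    T.stabBdry ε K v.1 w.1

/-- The square `|v̂_K|²` of the local energy seminorm. -/
def localSeminormSq (ε : ℝ) (v : T.LocalSpace K k) : ℝ :=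
  innerEps ε K v.1 v.1 +
  sigma ε K * (Metric.diam K)⁻¹ * (∑ F : T.intFacesOf K, ∫ x in F,
    (ev (v.2.1 F) x - ev v.1 x) ^ 2 ∂(surf d)) +
  sigma ε K * Metric.diam K * (∑ F : T.intFacesOf K, ∫ x in F,
    (ev (v.2.2 F) x - dn (faceNormal K F) v.1 x) ^ 2 ∂(surf d)) +
  sigma ε K * (Metric.diam K)⁻¹ * (∫ x in frontier K ∩ frontier Ω, ev v.1 x ^ 2 ∂(surf d)) +
  ε * (Metric.diam K)⁻¹ * (∫ x in frontier K ∩ frontier Ω, ‖grad v.1 x‖ ^ 2 ∂(surf d))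

/-! ### The global discretization -/

variable (k) in
/-- The global space `ℙ^{k+2}(𝒯_h) × ℙ^{k+2}(ℱ_hⁱ) × ℙ^k(ℱ_hⁱ)`. -/
abbrev GlobalSpace : Type :=
  (T.cells → Poly d (k + 2)) × (T.intFaces → Poly d (k + 2)) × (T.intFaces → Poly d k)

theorem mem_intFaces (F : T.intFacesOf K) : F.1 ∈ T.intFaces := by
  classical
  exact Finset.mem_of_mem_filter F.1 F.2

/-- The local components of a global unknown: `v_∂K|_F = v_F` and
`γ_∂K|_F = (n_F ⬝ n_K) γ_F`. -/
def restrict (v : T.GlobalSpace k) (K : T.cells) : T.LocalSpace K.1 k :=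
  (v.1 K, fun F => v.2.1 ⟨F.1, T.mem_intFaces F⟩,
    fun F => (inner ℝ (T.normal F.1) (faceNormal K.1 F.1) : ℝ) • v.2.2 ⟨F.1, T.mem_intFaces F⟩)

/-- The global bilinear form `â_h`. -/
def globalForm (ε : ℝ) (v w : T.GlobalSpace k) : ℝ :=
  ∑ K : T.cells, T.localForm ε (T.restrict v K) (T.restrict w K)

/-- The square of the global norm, `∑_K |v̂_K|²`. -/
def globalNormSq (ε : ℝ) (v : T.GlobalSpace k) : ℝ :=
  ∑ K : T.cells, T.localSeminormSq ε (T.restrict v K)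

end Mesh

end HHO

end

/-! The reconstruction is consistent up to quantities that the stabilization controls. Integrating
by parts in its right-hand side gives `(∇v_K, ∇w)_{K,ε}` plus seven remainders. Four pair the jumps
`v_∂K - v_K` (two terms), `Π(γ_∂K - ∂ₙv_K)` and `∂ₜ(v_∂K - v_K)` with derivatives of `w` on the
interior faces. Three are errors of Green's formula on `∂K ∩ ∂Ω`, bounded there by `v_K` and `∇v_K`.
Discrete trace and inverse inequalities bound the square of the sum by `M S ‖∇w‖²_{K,ε}`, where `S`
is the stabilization (`sq_consistency_le`). The choice `w = R - v_K`, which has zero mean, gives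
`‖∇(R - v_K)‖²_{K,ε} ≤ M S` (`innerEps_sub_self_le`), so the energies of `R` and `v_K` are
comparable modulo `S`.

By Pythagoras, the only part of the seminorm absent from `‖∇v_K‖² + S` is `(1 - Π)(γ_∂K - ∂ₙv_K)`.
Because `γ_∂K` has degree `k`, this is `-(1 - Π)∂ₙv_K`, which is bounded by `‖∇v_K‖_{K,ε}`
(`sigma_mul_projErrorSq_le`). Both local bounds follow (`local_stability`), and the global one is
their sum over the cells.

The geometric difficulty is the curved boundary. No exact divergence theorem is used there; an upper
bound suffices. For every bounded open set with a boundary of finite surface measure, `|∫_K ∂ₑf| ≤ C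
∫_∂K |f|` (`exists_gauss_bound`). Indeed, the left side is the derivative of the integral of `f`
over translates of `K`; these differ from `K` inside the set swept by `∂K`, and sweeping `A` over a
length `t` produces a volume at most `C t` times the surface of `A`. Around almost every point of an
interior face the cell is a half-space, where integration by parts is exact. Cutting off near these
faces and applying the inequality to the rest leaves Green's formula with interior faces only, up to
an error carried by `∂K ∩ ∂Ω` (`abs_gauss_error_le`).

Uniformity in the mesh comes from three facts. A cell contains a ball of radius `ρ h` and lies in
the concentric ball of radius `h`, so finite dimensionality and scaling give pointwise bounds for
polynomials (`exists_sup_bounds`). A cell is a union of boundedly many pieces star-shaped with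
respect to balls of radius `ρ h`, and radial projection bounds its surface by `C h^m`, with `m = d -
1` (`exists_surf_frontier_le`). Each interior face contains a disc of radius `ρ h`, which gives the
inverse inequality on faces (`exists_face_inverse`). Since surfaces of faces are added up, never
counted, the number of faces plays no role. -/

noncomputable section

namespace HHO

/-! ### Semidefinite forms in finite dimension -/

section Forms

variable {V : Type*} [AddCommGroup V] [Module ℝ V] [FiniteDimensional ℝ V]

/-- A linear form that vanishes on the null vectors of a symmetric positive semidefinite bilinear
form is represented by it. -/
theorem exists_represents (B : V →ₗ[ℝ] V →ₗ[ℝ] ℝ) (hs : ∀ x y, B x y = B y x)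
    (l : V →ₗ[ℝ] ℝ) (hl : ∀ x, B x x = 0 → l x = 0) : ∃ u, ∀ x, B u x = l x := by
  -- Symmetry puts the range of `B` inside the annihilator of its kernel; both have dimension `dim V
  -- - dim ker B`, so they coincide.
  have hle : LinearMap.range B ≤ (LinearMap.ker B).dualAnnihilator := by
    rintro _ ⟨u, rfl⟩
    rw [Submodule.mem_dualAnnihilator]
    intro x hx
    rw [hs, LinearMap.mem_ker.1 hx]
    rfl
  have h1 := LinearMap.finrank_range_add_finrank_ker B
  have h2 := Subspace.finrank_add_finrank_dualAnnihilator_eq (LinearMap.ker B)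
  have heq := Submodule.eq_of_le_of_finrank_eq hle
    (Nat.add_right_cancel (h1.trans (h2.symm.trans (add_comm _ _))))
  have hmem : l ∈ LinearMap.range B := by
    rw [heq, Submodule.mem_dualAnnihilator]
    intro x hx
    exact hl x (by rw [LinearMap.mem_ker.1 hx]; rfl)
  obtain ⟨u, hu⟩ := hmem
  exact ⟨u, fun x => by rw [hu]⟩

/-- A pointwise bounded family of linear forms is uniformly bounded with respect to a positive
definite form. -/
theorem exists_uniform_bound {X : Type*} (B : V →ₗ[ℝ] V →ₗ[ℝ] ℝ) (hs : ∀ x y, B x y = B y x)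
    (hp : ∀ x, 0 ≤ B x x) (hd : ∀ x, B x x = 0 → x = 0) (T : X → V →ₗ[ℝ] ℝ)
    (hT : ∀ v, ∃ M, ∀ x, |T x v| ≤ M) : ∃ C, 0 ≤ C ∧ ∀ x v, (T x v) ^ 2 ≤ C * B v v := by
  classical
  let b := Module.finBasis ℝ V
  -- Coordinates are represented by vectors `u`, and Cauchy–Schwarz for `B` bounds them with the
  -- constant `B u u`.
  have hcoord : ∀ i, ∃ c, 0 ≤ c ∧ ∀ v, (b.coord i v) ^ 2 ≤ c * B v v := by
    intro i
    obtain ⟨u, hu⟩ := exists_represents B hs (b.coord i) (fun x hx => by rw [hd x hx, map_zero])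
    refine ⟨B u u, hp u, fun v => ?_⟩
    rw [← hu]
    exact LinearMap.BilinForm.apply_sq_le_of_symm B hp ⟨fun x y => by simpa using hs x y⟩ u v
  choose c hc0 hc using hcoord
  choose M hM using hT
  refine ⟨(∑ i, c i) * ∑ i, M (b i) ^ 2,
    mul_nonneg (Finset.sum_nonneg fun i _ => hc0 i) (Finset.sum_nonneg fun i _ => sq_nonneg _),
    fun x v => ?_⟩
  have h1 : T x v = ∑ i, b.coord i v * T x (b i) := by
    conv_lhs => rw [← b.sum_repr v]
    rw [map_sum]
    simp
  rw [h1]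
  calc (∑ i, b.coord i v * T x (b i)) ^ 2
      ≤ (∑ i, (b.coord i v) ^ 2) * ∑ i, (T x (b i)) ^ 2 := Finset.sum_mul_sq_le_sq_mul_sq _ _ _
    _ ≤ (∑ i, c i * B v v) * ∑ i, M (b i) ^ 2 := by
        refine mul_le_mul (Finset.sum_le_sum fun i _ => hc i v)
          (Finset.sum_le_sum fun i _ => ?_) (Finset.sum_nonneg fun i _ => sq_nonneg _)
          (Finset.sum_nonneg fun i _ => mul_nonneg (hc0 i) (hp v))
        exact sq_le_sq' (by linarith [(abs_le.1 (hM (b i) x)).1]) ((abs_le.1 (hM (b i) x)).2)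
    _ = _ := by rw [← Finset.sum_mul]; ring

end Forms

/-! ### Calculus of polynomials -/

variable {d : ℕ}

@[simp] theorem ev_add (p q : MvPolynomial (Fin d) ℝ) (x : Pt d) : ev (p + q) x = ev p x + ev q x :=
  map_add _ p q

@[simp] theorem ev_sub (p q : MvPolynomial (Fin d) ℝ) (x : Pt d) : ev (p - q) x = ev p x - ev q x :=
  map_sub _ p q

@[simp] theorem ev_mul (p q : MvPolynomial (Fin d) ℝ) (x : Pt d) : ev (p * q) x = ev p x * ev q x :=
  map_mul _ p q

@[simp] theorem ev_smul (c : ℝ) (p : MvPolynomial (Fin d) ℝ) (x : Pt d) :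
    ev (c • p) x = c * ev p x := by
  simp [ev, MvPolynomial.smul_eval]

@[simp] theorem ev_C (c : ℝ) (x : Pt d) : ev (MvPolynomial.C c) x = c := by simp [ev]

@[simp] theorem ev_zero (x : Pt d) : ev 0 x = 0 := by simp [ev]

theorem ev_sum {ι : Type*} (s : Finset ι) (p : ι → MvPolynomial (Fin d) ℝ) (x : Pt d) :
    ev (∑ i ∈ s, p i) x = ∑ i ∈ s, ev (p i) x :=
  map_sum _ p s

@[simp] theorem grad_apply (p : MvPolynomial (Fin d) ℝ) (x : Pt d) (i : Fin d) :
    grad p x i = ev (MvPolynomial.pderiv i p) x := rfl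

@[simp] theorem grad_add (p q : MvPolynomial (Fin d) ℝ) (x : Pt d) :
    grad (p + q) x = grad p x + grad q x := by
  ext i; simp

@[simp] theorem grad_sub (p q : MvPolynomial (Fin d) ℝ) (x : Pt d) :
    grad (p - q) x = grad p x - grad q x := by
  ext i; simp

@[simp] theorem grad_smul (c : ℝ) (p : MvPolynomial (Fin d) ℝ) (x : Pt d) :
    grad (c • p) x = c • grad p x := by
  ext i; simp

theorem hasFDerivAt_ev (p : MvPolynomial (Fin d) ℝ) (x : Pt d) :
    HasFDerivAt (ev p) (innerSL ℝ (grad p x)) x := by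
  induction p using MvPolynomial.induction_on with
  | C a =>
    have h : grad (MvPolynomial.C a) x = 0 := by ext i; simp
    rw [h, map_zero]
    have : ev (d := d) (MvPolynomial.C a) = fun _ => a := by funext y; simp
    rw [this]
    exact hasFDerivAt_const _ _
  | add p q hp hq =>
    rw [grad_add, map_add]
    exact (hp.add hq).congr_of_eventuallyEq (Eventually.of_forall fun y => by simp)
  | mul_X p i hp =>
    have h1 : HasFDerivAt (fun y : Pt d => y i) (EuclideanSpace.proj i : Pt d →L[ℝ] ℝ) x :=
      (EuclideanSpace.proj i : Pt d →L[ℝ] ℝ).hasFDerivAt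
    have h2 := hp.mul h1
    refine (h2.congr_of_eventuallyEq (Eventually.of_forall fun y => by
      simp [ev])).congr_fderiv ?_
    ext v
    simp only [innerSL_apply_apply, PiLp.inner_apply, grad_apply, add_apply,
      smul_apply, smul_eq_mul]
    simp [ev, MvPolynomial.pderiv_X, Finset.sum_add_distrib, mul_add,
      Finset.mul_sum, Pi.single_apply, apply_ite]
    ring_nf

theorem continuous_ev (p : MvPolynomial (Fin d) ℝ) : Continuous (ev p) :=
  continuous_iff_continuousAt.2 fun x => (hasFDerivAt_ev p x).continuousAt

theorem continuous_grad (p : MvPolynomial (Fin d) ℝ) : Continuous (grad p) :=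
  (PiLp.continuous_toLp 2 _).comp (continuous_pi fun _ => continuous_ev _)

theorem contDiff_ev (p : MvPolynomial (Fin d) ℝ) : ContDiff ℝ 1 (ev p) := by
  refine contDiff_one_iff_fderiv.2 ⟨fun x => (hasFDerivAt_ev p x).differentiableAt, ?_⟩
  have : fderiv ℝ (ev p) = fun x => innerSL ℝ (grad p x) :=
    funext fun x => (hasFDerivAt_ev p x).fderiv
  rw [this]
  exact (innerSL ℝ).continuous.comp (continuous_grad p)

theorem fderiv_ev_apply (p : MvPolynomial (Fin d) ℝ) (x v : Pt d) :
    fderiv ℝ (ev p) x v = inner ℝ (grad p x) v := by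
  rw [(hasFDerivAt_ev p x).fderiv, innerSL_apply_apply]

/-- A polynomial that vanishes on a nonempty open set is zero. -/
theorem eq_zero_of_ev_eq_zero {U : Set (Pt d)} (hU : IsOpen U) (hne : U.Nonempty)
    {p : MvPolynomial (Fin d) ℝ} (hp : ∀ x ∈ U, ev p x = 0) : p = 0 := by
  obtain ⟨x, hx⟩ := hne
  have hV : (fun y : Fin d → ℝ => (WithLp.toLp 2 y : Pt d)) ⁻¹' U ∈ 𝓝 (WithLp.ofLp x) :=
    (PiLp.continuous_toLp 2 _).continuousAt.preimage_mem_nhds (hU.mem_nhds hx)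
  obtain ⟨ε, hε, hsub⟩ := Metric.mem_nhds_iff.1 hV
  -- An open set contains a product of intervals, and a polynomial vanishing on a product of
  -- infinite sets is zero.
  refine MvPolynomial.funext_set (fun i => Metric.ball (x i) ε) (fun i => ?_) fun y hy => ?_
  · rw [Real.ball_eq_Ioo]
    exact Set.Ioo_infinite (by linarith)
  · rw [map_zero]
    have : y ∈ Metric.ball (WithLp.ofLp x) ε := by
      rw [ball_pi _ hε]; exact hy
    exact hp _ (hsub this)

/-- A monomial `s` of the derivative stems from the monomial `s + eᵢ` of `p`. The truncated
subtraction is harmless: for `l = 0` no such monomial exists. -/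
theorem pderiv_mem_poly {l : ℕ} {p : MvPolynomial (Fin d) ℝ} (hp : p ∈ Poly d l) (i : Fin d) :
    MvPolynomial.pderiv i p ∈ Poly d (l - 1) := by
  rw [MvPolynomial.mem_restrictTotalDegree] at hp ⊢
  rw [MvPolynomial.totalDegree, Finset.sup_le_iff]
  intro s hs
  have hc : MvPolynomial.coeff (s + Finsupp.single i 1) p ≠ 0 := by
    intro h
    rw [MvPolynomial.mem_support_iff, MvPolynomial.coeff_pderiv] at hs
    exact hs (by simp [h])
  have h1 := MvPolynomial.le_totalDegree (MvPolynomial.mem_support_iff.2 hc)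
  rw [Finsupp.sum_add_index' (by simp) (by simp)] at h1
  simp only [Finsupp.sum_single_index] at h1
  omega

theorem poly_mono {l l' : ℕ} (h : l ≤ l') : Poly d l ≤ Poly d l' := by
  intro p hp
  rw [MvPolynomial.mem_restrictTotalDegree] at hp ⊢
  exact hp.trans h

theorem C_mem_poly (l : ℕ) (c : ℝ) : MvPolynomial.C c ∈ Poly d l := by
  rw [MvPolynomial.mem_restrictTotalDegree]; simp

instance (l : ℕ) : FiniteDimensional ℝ (Poly d l) := by
  have hfin : {s : Fin d →₀ ℕ | (s.sum fun _ e => e) ≤ l}.Finite := by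
    refine (Set.finite_Iic (Finsupp.equivFunOnFinite.symm fun _ : Fin d => l)).subset ?_
    intro s hs i
    have hs' : (s.sum fun _ e => e) ≤ l := hs
    rw [Finsupp.sum_fintype _ _ (by simp)] at hs'
    exact (Finset.single_le_sum (f := fun i => s i) (fun _ _ => Nat.zero_le _)
      (Finset.mem_univ i)).trans hs'
  have : Finite {s : Fin d →₀ ℕ | (s.sum fun _ e => e) ≤ l} := hfin
  exact Module.Finite.of_basis (MvPolynomial.basisRestrictSupport ℝ
    {s : Fin d →₀ ℕ | (s.sum fun _ e => e) ≤ l})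

/-- Polynomials are stable under affine substitutions. -/
theorem exists_affine_substitution {m l : ℕ} {p : MvPolynomial (Fin d) ℝ} (hp : p ∈ Poly d l)
    (c : Pt d) (A : Pt m →ₗ[ℝ] Pt d) : ∃ q ∈ Poly m l, ∀ z, ev q z = ev p (c + A z) := by
  classical
  let f : Fin d → MvPolynomial (Fin m) ℝ := fun i =>
    MvPolynomial.C (c i) + ∑ j, MvPolynomial.C (A (EuclideanSpace.single j 1) i) * MvPolynomial.X j
  have hf : ∀ i, (f i).totalDegree ≤ 1 := by
    intro i
    refine (MvPolynomial.totalDegree_add _ _).trans (max_le (by simp) ?_)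
    refine MvPolynomial.totalDegree_finsetSum_le fun j _ => ?_
    refine (MvPolynomial.totalDegree_mul _ _).trans ?_
    simp [MvPolynomial.totalDegree_X]
  have hfe : ∀ i (z : Pt m), ev (f i) z = (c + A z) i := by
    intro i z
    have hz : z = ∑ j, z j • EuclideanSpace.single j (1 : ℝ) := by
      ext k; simp [Finset.sum_apply, Pi.single_apply]
    conv_rhs => rw [hz]
    simp only [f, ev, map_add, MvPolynomial.eval_C, map_sum, map_mul, MvPolynomial.eval_X, map_smul,
      PiLp.add_apply, WithLp.ofLp_sum, Finset.sum_apply, PiLp.smul_apply, smul_eq_mul]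
    congr 1
    exact Finset.sum_congr rfl fun j _ => mul_comm _ _
  refine ⟨MvPolynomial.bind₁ f p, ?_, fun z => ?_⟩
  · rw [MvPolynomial.mem_restrictTotalDegree] at hp ⊢
    conv_lhs => rw [MvPolynomial.as_sum p, map_sum]
    refine MvPolynomial.totalDegree_finsetSum_le fun s hs => ?_
    rw [MvPolynomial.bind₁_monomial]
    refine (MvPolynomial.totalDegree_mul _ _).trans ?_
    rw [MvPolynomial.totalDegree_C, zero_add]
    refine (MvPolynomial.totalDegree_finsetProd _ _).trans ?_
    refine le_trans (Finset.sum_le_sum fun i _ => ?_) ((MvPolynomial.le_totalDegree hs).trans hp)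
    exact (MvPolynomial.totalDegree_pow _ _).trans (by nlinarith [hf i])
  · have h1 : ev (MvPolynomial.bind₁ f p) z = MvPolynomial.eval (fun i => ev (f i) z) p := by
      simp only [ev]
      rw [MvPolynomial.eval, MvPolynomial.eval₂Hom_bind₁]
      rfl
    rw [h1]
    simp only [hfe]
    rfl

end HHO

namespace HHO

/-! ### Norm equivalences for polynomials -/

theorem integrableOn_of_continuous {d : ℕ} {μ : Measure (Pt d)} {s : Set (Pt d)}
    (hs : MeasurableSet s) (hb : Bornology.IsBounded s) (hμ : μ s ≠ ⊤) {E : Type*}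
    [NormedAddCommGroup E] {f : Pt d → E} (hf : Continuous f) : IntegrableOn f s μ := by
  obtain ⟨M, hM⟩ := (hb.isCompact_closure.image hf).isBounded.exists_norm_le
  refine Measure.integrableOn_of_bounded (M := M) hμ hf.aestronglyMeasurable ?_
  exact (ae_restrict_iff' hs).2 (Eventually.of_forall fun x hx =>
    hM _ ⟨x, subset_closure hx, rfl⟩)

/-- The `L²(μ)` inner product of polynomials. -/
def evForm {d : ℕ} (μ : Measure (Pt d)) (hμ : ∀ f : Pt d → ℝ, Continuous f → Integrable f μ)
    (l : ℕ) : Poly d l →ₗ[ℝ] Poly d l →ₗ[ℝ] ℝ :=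
  LinearMap.mk₂ ℝ (fun p q => ∫ x, ev p x * ev q x ∂μ)
    (fun p p' q => by
      simp only [Submodule.coe_add, ev_add, add_mul]
      exact integral_add (hμ _ ((continuous_ev _).mul (continuous_ev _)))
        (hμ _ ((continuous_ev _).mul (continuous_ev _))))
    (fun c p q => by
      simp only [Submodule.coe_smul, ev_smul, mul_assoc, integral_const_mul, smul_eq_mul])
    (fun p q q' => by
      simp only [Submodule.coe_add, ev_add, mul_add]
      exact integral_add (hμ _ ((continuous_ev _).mul (continuous_ev _)))
        (hμ _ ((continuous_ev _).mul (continuous_ev _))))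
    (fun c p q => by
      simp only [Submodule.coe_smul, ev_smul, mul_left_comm, integral_const_mul, smul_eq_mul])

theorem evForm_apply {d : ℕ} (μ : Measure (Pt d))
    (hμ : ∀ f : Pt d → ℝ, Continuous f → Integrable f μ) (l : ℕ) (p q : Poly d l) :
    evForm μ hμ l p q = ∫ x, ev p x * ev q x ∂μ := rfl

theorem eqOn_zero_of_setIntegral_eq_zero {d : ℕ} {U : Set (Pt d)} (hU : IsOpen U)
    (hb : Bornology.IsBounded U) {f : Pt d → ℝ} (hf : Continuous f) (h0 : ∀ x, 0 ≤ f x)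
    (h : ∫ x in U, f x = 0) : ∀ x ∈ U, f x = 0 := by
  have hi : IntegrableOn f U := integrableOn_of_continuous hU.measurableSet hb
    hb.measure_lt_top.ne hf
  have := (integral_eq_zero_iff_of_nonneg (fun x => h0 x) hi).1 h
  exact Measure.eqOn_open_of_ae_eq (g := fun _ => 0) this hU hf.continuousOn continuousOn_const

/-- Equivalence of norms in finite dimension. The `L²` form of the ball of radius `ρ` is definite on
polynomials, and the values and first derivatives at points of the unit ball form a pointwise
bounded family of linear forms, so `exists_uniform_bound` applies. -/
theorem exists_unit_ball_bound (m l : ℕ) {ρ : ℝ} (hρ : 0 < ρ) :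
    ∃ C, 0 ≤ C ∧ ∀ q ∈ Poly m l, ∀ y ∈ Metric.closedBall (0 : Pt m) 1,
      (ev q y) ^ 2 ≤ C * ∫ z in Metric.ball (0 : Pt m) ρ, (ev q z) ^ 2 ∧
      ‖grad q y‖ ^ 2 ≤ C * ∫ z in Metric.ball (0 : Pt m) ρ, (ev q z) ^ 2 := by
  have hμ : ∀ f : Pt m → ℝ, Continuous f →
      Integrable f (volume.restrict (Metric.ball (0 : Pt m) ρ)) := fun f hf =>
    integrableOn_of_continuous Metric.isOpen_ball.measurableSet Metric.isBounded_ball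
      Metric.isBounded_ball.measure_lt_top.ne hf
  -- The index `none` stands for the value, `some i` for the `i`-th partial derivative.
  let T : (Metric.closedBall (0 : Pt m) 1) × Option (Fin m) → Poly m l →ₗ[ℝ] ℝ := fun yi =>
    { toFun := fun q => yi.2.elim (ev q.1 yi.1.1) fun i => ev (MvPolynomial.pderiv i q.1) yi.1.1
      map_add' := fun p q => by rcases yi.2 with _ | i <;> simp
      map_smul' := fun c q => by rcases yi.2 with _ | i <;> simp }
  obtain ⟨C, hC0, hC⟩ := exists_uniform_bound (evForm _ hμ l)
    (fun x y => by simp only [evForm_apply, mul_comm])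
    (fun x => integral_nonneg fun z => mul_self_nonneg _)
    (fun q hq => by
      rw [evForm_apply] at hq
      have := eqOn_zero_of_setIntegral_eq_zero (f := fun x => ev q.1 x * ev q.1 x)
        Metric.isOpen_ball Metric.isBounded_ball
        ((continuous_ev _).mul (continuous_ev _)) (fun x => mul_self_nonneg _) hq
      exact Subtype.ext (eq_zero_of_ev_eq_zero Metric.isOpen_ball
        ⟨0, Metric.mem_ball_self hρ⟩ fun x hx => mul_self_eq_zero.1 (this x hx)))
    T (fun q => by
      have hb : ∀ p : MvPolynomial (Fin m) ℝ, ∃ M, ∀ y ∈ Metric.closedBall (0 : Pt m) 1,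
          |ev p y| ≤ M := fun p =>
        (isCompact_closedBall (0 : Pt m) 1).exists_bound_of_continuousOn
          (continuous_ev p).continuousOn
      choose M hM using hb
      refine ⟨max (M q) (∑ i, |M (MvPolynomial.pderiv i q)|), fun yi => ?_⟩
      rcases yi with ⟨y, _ | i⟩
      · exact (hM q y y.2).trans (le_max_left _ _)
      · refine ((hM (MvPolynomial.pderiv i q) y y.2).trans (le_abs_self _)).trans ?_
        exact (Finset.single_le_sum (f := fun i => |M (MvPolynomial.pderiv i q)|)
          (fun _ _ => abs_nonneg _) (Finset.mem_univ i)).trans (le_max_right _ _))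
  -- The factor `m + 1` covers both the value and the sum of the `m` squared partial derivatives.
  refine ⟨(m + 1) * C, by positivity, fun q hq y hy => ?_⟩
  have hB : evForm _ hμ l ⟨q, hq⟩ ⟨q, hq⟩ = ∫ z in Metric.ball (0 : Pt m) ρ, (ev q z) ^ 2 := by
    simp only [evForm_apply, sq]
  have hn : 0 ≤ ∫ z in Metric.ball (0 : Pt m) ρ, (ev q z) ^ 2 := integral_nonneg fun z => sq_nonneg _
  constructor
  · have := hC (⟨y, hy⟩, none) ⟨q, hq⟩
    rw [hB] at this
    refine this.trans (mul_le_mul_of_nonneg_right ?_ hn)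
    nlinarith [mul_nonneg (Nat.cast_nonneg (α := ℝ) m) hC0]
  · rw [EuclideanSpace.norm_sq_eq]
    calc ∑ i, ‖grad q y i‖ ^ 2
        ≤ ∑ i : Fin m, C * ∫ z in Metric.ball (0 : Pt m) ρ, (ev q z) ^ 2 := by
          refine Finset.sum_le_sum fun i _ => ?_
          have := hC (⟨y, hy⟩, some i) ⟨q, hq⟩
          rw [hB] at this
          rw [Real.norm_eq_abs, sq_abs]
          exact this
      _ = m * C * ∫ z in Metric.ball (0 : Pt m) ρ, (ev q z) ^ 2 := by simp; ring
      _ ≤ _ := mul_le_mul_of_nonneg_right (by nlinarith) hn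

/-- Discrete inverse inequalities on a ball of radius `ρ h` in a subspace, valid on the ball of
radius `h`. -/
theorem exists_ball_bound (m l : ℕ) {ρ : ℝ} (hρ : 0 < ρ) :
    ∃ C, 0 ≤ C ∧ ∀ (d : ℕ) (p : MvPolynomial (Fin d) ℝ), p ∈ Poly d l →
      ∀ (j : Pt m →ₗᵢ[ℝ] Pt d) (b : Pt d) (h : ℝ), 0 < h → ∀ y ∈ Metric.closedBall (0 : Pt m) h,
      (ev p (b + j y)) ^ 2 ≤
        C * (h⁻¹ ^ m * ∫ z in Metric.ball (0 : Pt m) (ρ * h), (ev p (b + j z)) ^ 2) ∧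
      ∀ v, (inner ℝ (grad p (b + j y)) (j v)) ^ 2 ≤
        C * ‖v‖ ^ 2 * (h⁻¹ ^ (m + 2) * ∫ z in Metric.ball (0 : Pt m) (ρ * h), (ev p (b + j z)) ^ 2) := by
  obtain ⟨C, hC0, hC⟩ := exists_unit_ball_bound m l hρ
  refine ⟨C, hC0, fun d p hp j b h hh y hy => ?_⟩
  -- `q` is `p` in the coordinates `z ↦ b + j (h z)`. Undoing the scaling costs `h⁻ᵐ` for the volume
  -- and `h⁻²` for a squared derivative.
  obtain ⟨q, hq, hqe⟩ := exists_affine_substitution hp b (h • j.toLinearMap)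
  have hqe' : ∀ z, ev q z = ev p (b + j (h • z)) := fun z => by simpa using hqe z
  have hint : ∫ z in Metric.ball (0 : Pt m) ρ, (ev q z) ^ 2 =
      h⁻¹ ^ m * ∫ z in Metric.ball (0 : Pt m) (ρ * h), (ev p (b + j z)) ^ 2 := by
    simp only [hqe']
    rw [Measure.setIntegral_comp_smul_of_pos volume
      (fun z => (ev p (b + j z)) ^ 2) (Metric.ball (0 : Pt m) ρ) hh]
    rw [_root_.smul_ball hh.ne']
    simp [abs_of_pos hh, mul_comm]
  have hy' : h⁻¹ • y ∈ Metric.closedBall (0 : Pt m) 1 := by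
    rw [mem_closedBall_zero_iff] at hy ⊢
    rw [norm_smul, norm_inv, Real.norm_eq_abs, abs_of_pos hh]
    rw [inv_mul_le_iff₀ hh]; simpa using hy
  have hyy : h • h⁻¹ • y = y := by rw [smul_smul, mul_inv_cancel₀ hh.ne', one_smul]
  obtain ⟨h1, h2⟩ := hC q hq _ hy'
  rw [hint] at h1 h2
  rw [hqe', hyy] at h1
  refine ⟨h1, fun v => ?_⟩
  have hgrad : inner ℝ (grad q (h⁻¹ • y)) v = h * inner ℝ (grad p (b + j y)) (j v) := by
    have e1 := hasFDerivAt_ev q (h⁻¹ • y)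
    let A : Pt m →L[ℝ] Pt d := h • j.toContinuousLinearMap
    have e2 : HasFDerivAt (fun z : Pt m => b + A z) A (h⁻¹ • y) := A.hasFDerivAt.const_add b
    have hA : b + A (h⁻¹ • y) = b + j y := by
      simp [A, hh.ne']
    have e3 := (hasFDerivAt_ev p (b + A (h⁻¹ • y))).comp (h⁻¹ • y) e2
    have e4 : ev q = ev p ∘ fun z : Pt m => b + A z := by
      funext z; simp [hqe', A]
    rw [← e4] at e3
    have := congrArg (fun L => L v) (e1.unique e3)
    rw [hA] at this
    simpa [A, inner_smul_right] using this
  have h3 : (inner ℝ (grad q (h⁻¹ • y)) v : ℝ) ^ 2 ≤ ‖grad q (h⁻¹ • y)‖ ^ 2 * ‖v‖ ^ 2 := by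
    rw [← mul_pow]
    exact sq_le_sq' (by linarith [(abs_le.1 (abs_real_inner_le_norm (grad q (h⁻¹ • y)) v)).1])
      ((abs_le.1 (abs_real_inner_le_norm (grad q (h⁻¹ • y)) v)).2)
  rw [hgrad] at h3
  have h4 : h ^ 2 * (inner ℝ (grad p (b + j y)) (j v)) ^ 2 ≤
      C * (h⁻¹ ^ m * ∫ z in Metric.ball (0 : Pt m) (ρ * h), (ev p (b + j z)) ^ 2) * ‖v‖ ^ 2 := by
    rw [← mul_pow]
    exact h3.trans (mul_le_mul_of_nonneg_right h2 (sq_nonneg _))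
  calc (inner ℝ (grad p (b + j y)) (j v)) ^ 2
      = h⁻¹ ^ 2 * (h ^ 2 * (inner ℝ (grad p (b + j y)) (j v)) ^ 2) := by
        field_simp
    _ ≤ h⁻¹ ^ 2 * (C * (h⁻¹ ^ m * ∫ z in Metric.ball (0 : Pt m) (ρ * h), (ev p (b + j z)) ^ 2) *
          ‖v‖ ^ 2) := by gcongr
    _ = _ := by ring

end HHO

namespace HHO

/-! ### Coordinates adapted to a hyperplane -/

theorem exists_basis_zero_eq {m : ℕ} {n : Pt (m + 1)} (hn : ‖n‖ = 1) :
    ∃ b : OrthonormalBasis (Fin (m + 1)) ℝ (Pt (m + 1)), b 0 = n := by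
  have h : Orthonormal ℝ (({0} : Set (Fin (m + 1))).domRestrict fun _ => n) := by
    constructor
    · intro _; exact hn
    · intro i j hij
      exact absurd (Subsingleton.elim i j) hij
  obtain ⟨b, hb⟩ := h.exists_orthonormalBasis_extension_of_card_eq (by simp)
  exact ⟨b, hb 0 rfl⟩

/-- The embedding of `ℝ^m` as the coordinate hyperplane `y₀ = 0`. -/
def consZero (m : ℕ) : Pt m →ₗᵢ[ℝ] Pt (m + 1) where
  toFun z := WithLp.toLp 2 (Fin.cons 0 z : Fin (m + 1) → ℝ)
  map_add' x y := by
    ext i; refine Fin.cases ?_ (fun i => ?_) i <;> simp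
  map_smul' c x := by
    ext i; refine Fin.cases ?_ (fun i => ?_) i <;> simp
  norm_map' z := by
    simp [EuclideanSpace.norm_eq, Fin.sum_univ_succ]

/-- The isometric embedding of `ℝ^m` as the hyperplane orthogonal to the first basis vector. -/
def planeMap {m : ℕ} (b : OrthonormalBasis (Fin (m + 1)) ℝ (Pt (m + 1))) : Pt m →ₗᵢ[ℝ] Pt (m + 1) :=
  b.repr.symm.toLinearIsometry.comp (consZero m)

variable {m : ℕ} (b : OrthonormalBasis (Fin (m + 1)) ℝ (Pt (m + 1)))

theorem planeMap_apply (z : Pt m) : planeMap b z = b.repr.symm (consZero m z) := rfl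

theorem inner_repr_symm (y : Pt (m + 1)) : inner ℝ (b.repr.symm y) (b 0) = y 0 := by
  rw [real_inner_comm, ← b.repr_apply_apply]; simp

theorem inner_planeMap (z : Pt m) : inner ℝ (planeMap b z) (b 0) = 0 := by
  rw [planeMap_apply, inner_repr_symm]; simp [consZero]

theorem exists_planeMap_eq {x : Pt (m + 1)} (hx : inner ℝ x (b 0) = 0) :
    ∃ z, planeMap b z = x := by
  refine ⟨WithLp.toLp 2 fun i => b.repr x i.succ, ?_⟩
  rw [planeMap_apply, LinearIsometryEquiv.symm_apply_eq]
  ext i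
  refine Fin.cases ?_ (fun i => ?_) i
  · rw [b.repr_apply_apply, real_inner_comm, hx]; simp [consZero]
  · simp [consZero]

theorem range_planeMap (x₀ : Pt (m + 1)) :
    Set.range (fun z => x₀ + planeMap b z) = hyperplane (b 0) x₀ := by
  ext x
  constructor
  · rintro ⟨z, rfl⟩
    simp [hyperplane, inner_planeMap]
  · intro hx
    obtain ⟨z, hz⟩ := exists_planeMap_eq b hx
    exact ⟨z, by simp [hz]⟩

theorem isometry_planeMap (x₀ : Pt (m + 1)) : Isometry fun z => x₀ + planeMap b z :=
  (IsometryEquiv.addLeft x₀).isometry.comp (planeMap b).isometry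

/-- Isometries preserve the normalized Hausdorff measure, which is Lebesgue measure on `ℝ^m`.
Surface integrals on planar faces thereby become volume integrals. -/
theorem surf_restrict_hyperplane (x₀ : Pt (m + 1)) :
    (surf (m + 1)).restrict (hyperplane (b 0) x₀) =
      (volume : Measure (Pt m)).map fun z => x₀ + planeMap b z := by
  rw [← range_planeMap, ← EuclideanSpace.euclideanHausdorffMeasure_eq_volume,
    (isometry_planeMap b x₀).map_euclideanHausdorffMeasure]
  rfl

theorem measurableEmbedding_planeMap (x₀ : Pt (m + 1)) :
    MeasurableEmbedding fun z => x₀ + planeMap b z :=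
  (isometry_planeMap b x₀).isClosedEmbedding.measurableEmbedding

theorem surf_eq_volume {x₀ : Pt (m + 1)} {F : Set (Pt (m + 1))} (hF : F ⊆ hyperplane (b 0) x₀) :
    surf (m + 1) F = volume ((fun z => x₀ + planeMap b z) ⁻¹' F) := by
  rw [← (measurableEmbedding_planeMap b x₀).map_apply, ← surf_restrict_hyperplane,
    Measure.restrict_eq_self _ hF]

theorem setIntegral_surf {x₀ : Pt (m + 1)} {F : Set (Pt (m + 1))} (hF : F ⊆ hyperplane (b 0) x₀)
    (f : Pt (m + 1) → ℝ) :
    ∫ x in F, f x ∂(surf (m + 1)) =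
      ∫ z in (fun z => x₀ + planeMap b z) ⁻¹' F, f (x₀ + planeMap b z) := by
  rw [← (measurableEmbedding_planeMap b x₀).setIntegral_map, ← surf_restrict_hyperplane,
    Measure.restrict_restrict_of_subset hF]

theorem isClosed_hyperplane (n x₀ : Pt (m + 1)) : IsClosed (hyperplane n x₀) :=
  isClosed_eq (by fun_prop) continuous_const

/-! ### Integration by parts on a half-space -/

/-- The volume-preserving chart `y ↦ x₀ + ∑ yᵢ bᵢ`. -/
def chart (x₀ : Pt (m + 1)) (y : Fin (m + 1) → ℝ) : Pt (m + 1) :=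
  x₀ + b.repr.symm (WithLp.toLp 2 y)

theorem measurePreserving_chart (x₀ : Pt (m + 1)) :
    MeasurePreserving (chart b x₀) volume volume :=
  (measurePreserving_add_left volume x₀).comp
    (b.measurePreserving_repr_symm.comp (PiLp.volume_preserving_toLp (Fin (m + 1))))

theorem measurableEmbedding_chart (x₀ : Pt (m + 1)) : MeasurableEmbedding (chart b x₀) := by
  let e : (Fin (m + 1) → ℝ) ≃ₜ Pt (m + 1) :=
    (PiLp.homeomorph 2 fun _ : Fin (m + 1) => ℝ).symm.trans
    (b.repr.symm.toHomeomorph.trans (Homeomorph.addLeft x₀))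
  exact e.measurableEmbedding

theorem norm_chart_sub (x₀ : Pt (m + 1)) (y : Fin (m + 1) → ℝ) (i : Fin (m + 1)) :
    |y i| ≤ ‖chart b x₀ y - x₀‖ := by
  rw [chart, add_sub_cancel_left, LinearIsometryEquiv.norm_map]
  exact PiLp.norm_apply_le (WithLp.toLp 2 y : Pt (m + 1)) i

theorem chart_insertNth (x₀ : Pt (m + 1)) (z : Fin m → ℝ) :
    chart b x₀ (Fin.insertNth 0 0 z) = x₀ + planeMap b (WithLp.toLp 2 z) := by
  rw [chart, planeMap_apply]
  congr 2
  ext i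
  refine Fin.cases ?_ (fun i => ?_) i <;> simp [consZero]

/-- The divergence theorem on a large box in coordinates adapted to `b 0`. One side of the box lies
in the hyperplane; on all the others `f` vanishes. -/
theorem integral_fderiv_halfSpace {f : Pt (m + 1) → ℝ} (hf : ContDiff ℝ 1 f)
    (hc : HasCompactSupport f) (x₀ e : Pt (m + 1)) :
    ∫ x in {x | inner ℝ (x - x₀) (b 0) < 0}, fderiv ℝ f x e =
      inner ℝ e (b 0) * ∫ x in hyperplane (b 0) x₀, f x ∂(surf (m + 1)) := by
  obtain ⟨R, hR0, hR, hR'⟩ : ∃ R, 0 < R ∧ (∀ x, R ≤ ‖x - x₀‖ → f x = 0) ∧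
      (∀ x, R ≤ ‖x - x₀‖ → fderiv ℝ f x = 0) := by
    obtain ⟨r, hr⟩ := hc.isBounded.subset_closedBall x₀
    have hout : ∀ x, max r 0 + 1 ≤ ‖x - x₀‖ → x ∉ tsupport f := by
      intro x hx hx'
      have := hr hx'
      rw [mem_closedBall_iff_norm] at this
      linarith [le_max_left r 0]
    refine ⟨max r 0 + 1, by positivity, fun x hx => image_eq_zero_of_notMem_tsupport (hout x hx),
      fun x hx => ?_⟩
    exact image_eq_zero_of_notMem_tsupport fun h => hout x hx (tsupport_fderiv_subset ℝ h)
  set e' : Fin (m + 1) → ℝ := fun i => b.repr e i with he'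
  let a : Fin (m + 1) → ℝ := fun _ => -R
  -- The box is `[-R, 0]` in the normal coordinate and `[-R, R]` in the tangential ones.
  let c : Fin (m + 1) → ℝ := Fin.insertNth 0 0 fun _ => R
  have hc0 : c 0 = 0 := rfl
  have hcs : ∀ i : Fin m, c i.succ = R := fun i => by simp [c]
  have hac : ∀ i, a i < c i := by
    intro i
    refine Fin.cases ?_ (fun i => ?_) i
    · rw [hc0]; simp [a, hR0]
    · rw [hcs]; simp only [a]; linarith
  let L : (Fin (m + 1) → ℝ) →L[ℝ] Pt (m + 1) :=
    (b.repr.symm.toContinuousLinearEquiv.toContinuousLinearMap).comp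
      (PiLp.continuousLinearEquiv 2 ℝ fun _ : Fin (m + 1) => ℝ).symm.toContinuousLinearMap
  have hchart : ∀ y, HasFDerivAt (chart b x₀) L y := fun y => (L.hasFDerivAt (x := y)).const_add x₀
  have hfd : ∀ y, HasFDerivAt (fun y => f (chart b x₀ y)) ((fderiv ℝ f (chart b x₀ y)).comp L) y :=
    fun y => ((hf.differentiable one_ne_zero _).hasFDerivAt).comp y (hchart y)
  have hccont : Continuous (chart b x₀) :=
    continuous_iff_continuousAt.2 fun y => (hchart y).continuousAt
  have hcont : Continuous fun y => fderiv ℝ f (chart b x₀ y) :=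
    (hf.continuous_fderiv one_ne_zero).comp hccont
  have hLe : ∑ i, e' i • L (Pi.single i 1) = e := by
    refine Eq.trans ?_ (b.sum_repr e)
    refine Finset.sum_congr rfl fun i _ => ?_
    have : L (Pi.single i 1) = b i := by
      rw [← b.repr_symm_single]; rfl
    rw [this]
  have hdivsum : ∀ y, ∑ i, (e' i • (fderiv ℝ f (chart b x₀ y)).comp L) (Pi.single i 1) =
      fderiv ℝ f (chart b x₀ y) e := by
    intro y
    conv_rhs => rw [← hLe, map_sum]
    exact Finset.sum_congr rfl fun i _ => by simp
  -- The vector field is `f` times the constant vector `e`, written in the basis `b`; its divergence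
  -- is `∂ₑf`.
  have hdiv := integral_divergence_of_hasFDerivAt_off_countable' a c (fun i => (hac i).le)
    (fun i y => e' i * f (chart b x₀ y))
    (fun i y => e' i • (fderiv ℝ f (chart b x₀ y)).comp L) ∅ Set.countable_empty
    (fun i => (continuous_const.mul (hf.continuous.comp hccont)).continuousOn)
    (fun y _ i => (hfd y).const_mul (e' i))
    (by
      simp only [hdivsum]
      exact (hcont.clm_apply continuous_const).continuousOn.integrableOn_compact isCompact_Icc)
  simp only [hdivsum] at hdiv
  have hlhs : ∫ x in {x | inner ℝ (x - x₀) (b 0) < 0}, fderiv ℝ f x e =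
      ∫ y in Set.Icc a c, fderiv ℝ f (chart b x₀ y) e := by
    rw [← (measurePreserving_chart b x₀).setIntegral_preimage_emb (measurableEmbedding_chart b x₀)]
    refine Eq.trans ?_ (setIntegral_congr_set
      (Measure.univ_pi_Ico_ae_eq_Icc (μ := fun _ : Fin (m + 1) => (volume : Measure ℝ))))
    have hpre : chart b x₀ ⁻¹' {x | inner ℝ (x - x₀) (b 0) < 0} = {y | y 0 < 0} := by
      ext y
      simp [chart, inner_repr_symm]
    rw [hpre]
    refine setIntegral_eq_of_subset_of_forall_sdiff_eq_zero
      (measurableSet_lt (measurable_pi_apply 0) measurable_const) ?_ ?_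
    · intro y hy
      have := (hy 0 (Set.mem_univ _)).2
      rwa [hc0] at this
    · rintro y ⟨hy, hy'⟩
      rw [Set.mem_univ_pi] at hy'
      push Not at hy'
      obtain ⟨i, hi⟩ := hy'
      rw [hR' _ ?_]; · rfl
      refine le_trans ?_ (norm_chart_sub b x₀ y i)
      by_contra! hlt
      rw [abs_lt] at hlt
      refine hi ⟨hlt.1.le, ?_⟩
      revert hlt hi
      refine Fin.cases (fun _ _ => hy) (fun i _ hlt => ?_) i
      rw [hcs]; exact hlt.2
  rw [hlhs, hdiv, Fin.sum_univ_succ, Finset.sum_eq_zero, add_zero]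
  · have hback : ∀ z : Fin m → ℝ, f (chart b x₀ (Fin.insertNth 0 (a 0) z)) = 0 := fun z =>
      hR _ (le_trans (by simp [a, abs_of_pos hR0]) (norm_chart_sub b x₀ _ 0))
    simp only [hback, mul_zero, integral_zero, sub_zero, hc0, chart_insertNth, integral_const_mul]
    rw [setIntegral_surf b subset_rfl]
    have hpre : (fun z => x₀ + planeMap b z) ⁻¹' hyperplane (b 0) x₀ = Set.univ := by
      ext z; simp [hyperplane, inner_planeMap]
    rw [hpre, setIntegral_univ]
    have he0 : e' 0 = inner ℝ e (b 0) := by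
      simp only [he']; rw [b.repr_apply_apply, real_inner_comm]
    rw [he0]
    congr 1
    rw [← (PiLp.volume_preserving_toLp (Fin m)).integral_comp
      (PiLp.homeomorph 2 fun _ : Fin m => ℝ).symm.measurableEmbedding]
    refine setIntegral_eq_integral_of_forall_compl_eq_zero fun z hz => ?_
    rw [← chart_insertNth]
    apply hR
    rw [Set.mem_Icc, not_and_or, Pi.le_def, Pi.le_def] at hz
    push Not at hz
    rcases hz with ⟨i, hi⟩ | ⟨i, hi⟩
    · refine le_trans ?_ (norm_chart_sub b x₀ _ i.succ)
      simp only [a, Function.comp] at hi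
      simp
      rw [abs_of_neg (by linarith)]; linarith
    · refine le_trans ?_ (norm_chart_sub b x₀ _ i.succ)
      simp only [Function.comp, Fin.zero_succAbove, hcs] at hi
      simp
      exact hi.le.trans (le_abs_self _)
  · intro i _
    have h1 : ∀ z : Fin m → ℝ, f (chart b x₀ (Fin.insertNth i.succ (c i.succ) z)) = 0 := fun z =>
      hR _ (le_trans (by simp [hcs, abs_of_pos hR0]) (norm_chart_sub b x₀ _ i.succ))
    have h2 : ∀ z : Fin m → ℝ, f (chart b x₀ (Fin.insertNth i.succ (a i.succ) z)) = 0 := fun z =>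
      hR _ (le_trans (by simp [a, abs_of_pos hR0]) (norm_chart_sub b x₀ _ i.succ))
    simp only [h1, h2, mul_zero, integral_zero, sub_zero]

end HHO

namespace HHO

open scoped ENNReal

/-! ### A Gauss inequality for open sets with a boundary of finite surface measure -/

/-- The set swept by `A` when it is translated by multiples of `e` of size at most `t`. -/
def sweep {d : ℕ} (A : Set (Pt d)) (e : Pt d) (t : ℝ) : Set (Pt d) :=
  {x | ∃ y ∈ A, ∃ s : ℝ, |s| ≤ t ∧ x = y + s • e}

/-- The swept set is a tube of length `2t` and radius `δ`. Balls of radius `2δ` with centres spaced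
by `δ • e` cover it; since `δ ≤ t`, at most `3t/δ` of them are needed. -/
theorem volume_sweep_le_of_subset_closedBall {m : ℕ} {A : Set (Pt (m + 1))} {y e : Pt (m + 1)}
    {t δ : ℝ} (he : ‖e‖ ≤ 1) (hδ : 0 < δ) (ht : δ ≤ t) (hA : A ⊆ Metric.closedBall y δ) :
    volume (sweep A e t) ≤ ENNReal.ofReal (3 * 2 ^ (m + 1) * (t * δ ^ m)) *
      volume (Metric.closedBall (0 : Pt (m + 1)) 1) := by
  have ht0 : 0 < t := hδ.trans_le ht
  set N := ⌊2 * t / δ⌋₊ + 1 with hN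
  have hsub : sweep A e t ⊆ ⋃ i ∈ Finset.range N,
      Metric.closedBall (y + (-t + i * δ) • e) (2 * δ) := by
    rintro x ⟨y', hy', s, hs, rfl⟩
    rw [abs_le] at hs
    have h0 : 0 ≤ (s + t) / δ := div_nonneg (by linarith) hδ.le
    simp only [Set.mem_iUnion, Finset.mem_range, exists_prop]
    refine ⟨⌊(s + t) / δ⌋₊, ?_, ?_⟩
    · rw [hN, Nat.lt_succ_iff]
      exact Nat.floor_le_floor (div_le_div_of_nonneg_right (by linarith) hδ.le)
    · have h1 := Nat.floor_le h0
      have h2 := Nat.lt_floor_add_one ((s + t) / δ)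
      rw [le_div_iff₀ hδ] at h1
      rw [div_lt_iff₀ hδ] at h2
      have h3 := hA hy'
      rw [mem_closedBall_iff_norm] at h3 ⊢
      have : y' + s • e - (y + (-t + ⌊(s + t) / δ⌋₊ * δ) • e) =
          (y' - y) + (s + t - ⌊(s + t) / δ⌋₊ * δ) • e := by module
      rw [this]
      refine (norm_add_le _ _).trans ?_
      rw [norm_smul, Real.norm_eq_abs]
      have h4 : |s + t - ⌊(s + t) / δ⌋₊ * δ| ≤ δ := by rw [abs_le]; constructor <;> nlinarith
      nlinarith [norm_nonneg e, abs_nonneg (s + t - ⌊(s + t) / δ⌋₊ * δ)]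
  have hNle : (N : ℝ) ≤ 3 * t / δ := by
    have h1 : (⌊2 * t / δ⌋₊ : ℝ) ≤ 2 * t / δ := Nat.floor_le (by positivity)
    have h2 : 1 ≤ t / δ := (one_le_div hδ).2 ht
    rw [hN]; push_cast
    calc (⌊2 * t / δ⌋₊ : ℝ) + 1 ≤ 2 * t / δ + t / δ := by linarith
      _ = 3 * t / δ := by ring
  calc volume (sweep A e t)
      ≤ ∑ i ∈ Finset.range N, volume (Metric.closedBall (y + (-t + i * δ) • e) (2 * δ)) :=
        (measure_mono hsub).trans (measure_biUnion_finset_le _ _)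
    _ = N * (ENNReal.ofReal ((2 * δ) ^ (m + 1)) *
          volume (Metric.closedBall (0 : Pt (m + 1)) 1)) := by
        have : ∀ x : Pt (m + 1), volume (Metric.closedBall x (2 * δ)) =
            ENNReal.ofReal ((2 * δ) ^ (m + 1)) * volume (Metric.closedBall (0 : Pt (m + 1)) 1) := by
          intro x
          rw [Measure.addHaar_closedBall' _ _ (by positivity)]
          simp
        simp [this]
    _ ≤ _ := by
        rw [← mul_assoc, ← ENNReal.ofReal_natCast, ← ENNReal.ofReal_mul (by positivity)]
        refine mul_le_mul_left (ENNReal.ofReal_le_ofReal ?_) _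
        calc (N : ℝ) * (2 * δ) ^ (m + 1) ≤ 3 * t / δ * (2 * δ) ^ (m + 1) := by gcongr
          _ = 3 * 2 ^ (m + 1) * (t * δ ^ m) := by field_simp; ring

/-- The radius is taken to be the diameter. If the diameter is zero, the radius tends to zero
instead, and `1 ≤ m` makes the bound vanish in the limit. -/
theorem volume_sweep_le_of_ediam_le {m : ℕ} (hm : 1 ≤ m) {A : Set (Pt (m + 1))} {e : Pt (m + 1)}
    {t : ℝ} (he : ‖e‖ ≤ 1) (ht : 0 < t) (hA : A.Nonempty)
    (hd : Metric.ediam A ≤ ENNReal.ofReal t) :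
    volume (sweep A e t) ≤ ENNReal.ofReal (3 * 2 ^ (m + 1) * t) *
      volume (Metric.closedBall (0 : Pt (m + 1)) 1) * Metric.ediam A ^ (m : ℝ) := by
  obtain ⟨y, hy⟩ := hA
  have hfin : Metric.ediam A ≠ ⊤ := (hd.trans_lt ENNReal.ofReal_lt_top).ne
  have hdt : (Metric.ediam A).toReal ≤ t := ENNReal.toReal_le_of_le_ofReal ht.le hd
  have hsub : A ⊆ Metric.closedBall y (Metric.ediam A).toReal := fun x hx => by
    rw [Metric.mem_closedBall, dist_edist]
    exact ENNReal.toReal_mono hfin (Metric.edist_le_ediam_of_mem hx hy)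
  rcases (ENNReal.toReal_nonneg (a := Metric.ediam A)).eq_or_lt with h0 | hpos
  · have hlim : Tendsto (fun δ : ℝ => ENNReal.ofReal (3 * 2 ^ (m + 1) * (t * δ ^ m)) *
        volume (Metric.closedBall (0 : Pt (m + 1)) 1)) (𝓝[>] 0) (𝓝 0) := by
      have h1 : Tendsto (fun δ : ℝ => 3 * 2 ^ (m + 1) * (t * δ ^ m)) (𝓝[>] 0) (𝓝 0) := by
        have : ContinuousAt (fun δ : ℝ => 3 * 2 ^ (m + 1) * (t * δ ^ m)) 0 := by fun_prop
        have h2 := this.tendsto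
        simp only [zero_pow (by omega : m ≠ 0), mul_zero] at h2
        exact h2.mono_left nhdsWithin_le_nhds
      have h2 := ENNReal.Tendsto.mul_const (b := volume (Metric.closedBall (0 : Pt (m + 1)) 1))
        (ENNReal.tendsto_ofReal h1)
        (Or.inr Metric.isBounded_closedBall.measure_lt_top.ne)
      simpa using h2
    have hle : volume (sweep A e t) ≤ 0 := by
      refine ge_of_tendsto hlim ?_
      filter_upwards [Ioc_mem_nhdsGT ht] with δ hδ
      exact volume_sweep_le_of_subset_closedBall he hδ.1 hδ.2
        (hsub.trans (Metric.closedBall_subset_closedBall (by rw [← h0]; exact hδ.1.le)))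
    exact hle.trans zero_le
  · refine (volume_sweep_le_of_subset_closedBall he hpos hdt hsub).trans (le_of_eq ?_)
    rw [← mul_assoc, ENNReal.ofReal_mul (by positivity), ENNReal.ofReal_pow hpos.le,
      ENNReal.ofReal_toReal hfin, ENNReal.rpow_natCast]
    ring

/-- A cover of `A` yields a cover of its sweep, so the sum of the `m`-th powers of the diameters
bounds the swept volume; the infimum of such sums is dominated by the Hausdorff measure, of which
`surf` is a multiple. -/
theorem exists_volume_sweep_le {m : ℕ} (hm : 1 ≤ m) : ∃ C : ℝ≥0∞, C ≠ ⊤ ∧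
    ∀ (A : Set (Pt (m + 1))) (e : Pt (m + 1)) (t : ℝ), ‖e‖ ≤ 1 → 0 < t →
      volume (sweep A e t) ≤ ENNReal.ofReal t * (C * surf (m + 1) A) := by
  set V := volume (Metric.closedBall (0 : Pt (m + 1)) 1) with hV
  have hVtop : V ≠ ⊤ := Metric.isBounded_closedBall.measure_lt_top.ne
  have hV0 : V ≠ 0 := (Metric.measure_closedBall_pos volume 0 one_pos).ne'
  set c : ℝ≥0∞ := ((Measure.addHaarScalarFactor (volume : Measure (EuclideanSpace ℝ (Fin m)))
    (Measure.hausdorffMeasure m) : NNReal) : ℝ≥0∞) with hc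
  have hc0 : c ≠ 0 := by
    rw [hc]; exact_mod_cast Measure.addHaarScalarFactor_volume_hausdorffMeasure_ne_zero m
  have hctop : c ≠ ⊤ := ENNReal.coe_ne_top
  have hsurf : ∀ A, surf (m + 1) A = c * Measure.hausdorffMeasure (m : ℝ) A := fun A => rfl
  refine ⟨ENNReal.ofReal (3 * 2 ^ (m + 1)) * V * c⁻¹,
    ENNReal.mul_ne_top (ENNReal.mul_ne_top ENNReal.ofReal_ne_top hVtop)
      (ENNReal.inv_ne_top.2 hc0), fun A e t he ht => ?_⟩
  set D := ENNReal.ofReal (3 * 2 ^ (m + 1) * t) * V with hD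
  have hD0 : D ≠ 0 := mul_ne_zero (by simpa using by positivity) hV0
  have hDtop : D ≠ ⊤ := ENNReal.mul_ne_top ENNReal.ofReal_ne_top hVtop
  have key : volume (sweep A e t) / D ≤ Measure.hausdorffMeasure (m : ℝ) A := by
    rw [Measure.hausdorffMeasure_apply]
    -- Only the scale `t` is kept in the supremum over scales: the bound on one swept piece requires
    -- a diameter of at most `t`.
    refine le_iSup₂_of_le (ENNReal.ofReal t) (by simpa using ht) ?_
    refine le_iInf fun S => le_iInf fun hS => le_iInf fun hSd => ?_
    rw [ENNReal.div_le_iff hD0 hDtop, mul_comm, ← ENNReal.tsum_mul_left]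
    have hsub : sweep A e t ⊆ ⋃ n, sweep (S n) e t := by
      rintro x ⟨y, hy, s, hs, rfl⟩
      obtain ⟨n, hn⟩ := Set.mem_iUnion.1 (hS hy)
      exact Set.mem_iUnion.2 ⟨n, y, hn, s, hs, rfl⟩
    refine ((measure_mono hsub).trans (measure_iUnion_le _)).trans (ENNReal.tsum_le_tsum fun n => ?_)
    rcases (S n).eq_empty_or_nonempty with hn | hn
    · simp [hn, sweep]
    · rw [ciSup_pos hn]
      exact volume_sweep_le_of_ediam_le hm he ht hn (hSd n)
  rw [ENNReal.div_le_iff hD0 hDtop] at key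
  refine key.trans (le_of_eq ?_)
  rw [hsurf, hD, ENNReal.ofReal_mul (by positivity)]
  calc _ = ENNReal.ofReal t * (ENNReal.ofReal (3 * 2 ^ (m + 1)) * V * 1 *
        Measure.hausdorffMeasure (m : ℝ) A) := by ring
    _ = _ := by rw [← ENNReal.inv_mul_cancel hc0 hctop]; ring

theorem inter_frontier_nonempty {X : Type*} [TopologicalSpace X] {S K : Set X}
    (hS : IsPreconnected S) (h : (S ∩ K).Nonempty) (h' : (S ∩ Kᶜ).Nonempty) :
    (S ∩ frontier K).Nonempty := by
  by_contra hne
  have hno : ∀ x ∈ S, x ∉ frontier K := fun x hx hx' => hne ⟨x, hx, hx'⟩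
  have h1 : ∀ x ∈ S, x ∈ K → x ∈ interior K := fun x hx hxK => by
    by_contra hi; exact hno x hx ⟨subset_closure hxK, hi⟩
  have h2 : ∀ x ∈ S, x ∉ K → x ∈ interior Kᶜ := fun x hx hxK => by
    rw [interior_compl]
    intro hc; exact hno x hx ⟨hc, fun hi => hxK (interior_subset hi)⟩
  obtain ⟨x, hx⟩ := h
  obtain ⟨y, hy⟩ := h'
  obtain ⟨z, _, hz1, hz2⟩ := hS _ _ isOpen_interior isOpen_interior
    (fun z hz => (em (z ∈ K)).imp (h1 z hz) (h2 z hz)) ⟨x, hx.1, h1 x hx.1 hx.2⟩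
    ⟨y, hy.1, h2 y hy.1 hy.2⟩
  exact interior_subset hz2 (interior_subset hz1)

/-- The segment from `x` to `x - t • e` joins `K` to its complement, hence it meets the frontier. -/
theorem mem_sweep_frontier {d : ℕ} {K : Set (Pt d)} {x e : Pt d} {t : ℝ} (ht : 0 ≤ t)
    (h : (x ∈ K ∧ x - t • e ∉ K) ∨ (x ∉ K ∧ x - t • e ∈ K)) : x ∈ sweep (frontier K) e t := by
  have hpre : IsPreconnected ((fun s : ℝ => x - s • e) '' Set.Icc 0 t) :=
    isPreconnected_Icc.image _ (by fun_prop)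
  have h0 : x ∈ (fun s : ℝ => x - s • e) '' Set.Icc 0 t := ⟨0, ⟨le_rfl, ht⟩, by simp⟩
  have h1 : x - t • e ∈ (fun s : ℝ => x - s • e) '' Set.Icc 0 t := ⟨t, ⟨ht, le_rfl⟩, rfl⟩
  have : (((fun s : ℝ => x - s • e) '' Set.Icc 0 t) ∩ frontier K).Nonempty := by
    refine inter_frontier_nonempty hpre ?_ ?_
    · rcases h with h | h
      exacts [⟨_, h0, h.1⟩, ⟨_, h1, h.2⟩]
    · rcases h with h | h
      exacts [⟨_, h1, h.2⟩, ⟨_, h0, h.1⟩]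
  obtain ⟨_, ⟨s, hs, rfl⟩, hy⟩ := this
  exact ⟨_, hy, s, abs_le.2 ⟨by linarith [hs.1], hs.2⟩, by simp⟩

/-- The sweep bound with a weight. `A` is cut into the layers `iδ ≤ |f| < (i + 1)δ`. For small `t`,
`|f|` stays below `(i + 2)δ` on the swept layer, at most `2δ` above its values on the layer itself.
-/
theorem lintegral_sweep_le {m : ℕ} {C : ℝ≥0∞}
    (hC : ∀ (A : Set (Pt (m + 1))) (e : Pt (m + 1)) (t : ℝ), ‖e‖ ≤ 1 → 0 < t →
      volume (sweep A e t) ≤ ENNReal.ofReal t * (C * surf (m + 1) A))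
    {A : Set (Pt (m + 1))} (hA : MeasurableSet A) {f : Pt (m + 1) → ℝ} (hf : Continuous f)
    (hu : UniformContinuous f) {δ : ℝ} (hδ : 0 < δ) {e : Pt (m + 1)} (he : ‖e‖ ≤ 1) :
    ∀ᶠ t : ℝ in 𝓝[>] 0, ∫⁻ x in sweep A e t, ‖f x‖ₑ ≤
      ENNReal.ofReal t * (C * ∫⁻ x in A, (‖f x‖ₑ + ENNReal.ofReal (2 * δ)) ∂(surf (m + 1))) := by
  obtain ⟨η, hη, hfη⟩ := Metric.uniformContinuous_iff.1 hu δ hδ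
  filter_upwards [Ioo_mem_nhdsGT hη] with t ht
  let P : ℕ → Set (Pt (m + 1)) := fun i => A ∩ (fun x => ⌊|f x| / δ⌋₊) ⁻¹' {i}
  have hmeas : ∀ i, MeasurableSet (P i) := fun i =>
    hA.inter ((Nat.measurable_floor.comp ((hf.abs.measurable).div_const δ))
      (measurableSet_singleton i))
  have hdisj : Pairwise (Function.onFun Disjoint P) := by
    intro i j hij
    refine Set.disjoint_left.2 fun x hx hx' => hij ?_
    rw [← hx.2, ← hx'.2]
  have hunion : A = ⋃ i, P i := by
    ext x
    simp [P]
  have hsweep : sweep A e t ⊆ ⋃ i, sweep (P i) e t := by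
    rintro x ⟨y, hy, s, hs, rfl⟩
    exact Set.mem_iUnion.2 ⟨_, y, ⟨hy, rfl⟩, s, hs, rfl⟩
  have hPi : ∀ i, ∫⁻ x in sweep (P i) e t, ‖f x‖ₑ ≤
      ENNReal.ofReal t * (C * ∫⁻ x in P i, (‖f x‖ₑ + ENNReal.ofReal (2 * δ)) ∂(surf (m + 1))) := by
    intro i
    have hval : ∀ x ∈ P i, i * δ ≤ |f x| ∧ |f x| < (i + 1) * δ := by
      rintro x ⟨_, hx⟩
      have h0 : 0 ≤ |f x| / δ := by positivity
      have h1 := Nat.floor_le h0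
      have h2 := Nat.lt_floor_add_one (|f x| / δ)
      have hx' : ⌊|f x| / δ⌋₊ = i := hx
      rw [hx'] at h1 h2
      exact ⟨(le_div_iff₀ hδ).1 h1, (div_lt_iff₀ hδ).1 h2⟩
    have hub : ∀ x ∈ sweep (P i) e t, ‖f x‖ₑ ≤ ENNReal.ofReal ((i + 2) * δ) := by
      rintro x ⟨y, hy, s, hs, rfl⟩
      rw [Real.enorm_eq_ofReal_abs]
      refine ENNReal.ofReal_le_ofReal ?_
      have hd : dist (y + s • e) y < η := by
        rw [dist_eq_norm, add_sub_cancel_left, norm_smul, Real.norm_eq_abs]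
        nlinarith [norm_nonneg e, abs_nonneg s, ht.2]
      have h3 := hfη hd
      rw [Real.dist_eq] at h3
      have h4 := (hval y hy).2
      have h5 := abs_sub_abs_le_abs_sub (f (y + s • e)) (f y)
      nlinarith
    -- A sweep need not be measurable; measurability of this sublevel set suffices to transfer the
    -- pointwise bound to the restricted measure.
    have hmeas' : MeasurableSet {x : Pt (m + 1) | ‖f x‖ₑ ≤ ENNReal.ofReal ((i + 2) * δ)} :=
      measurableSet_le hf.measurable.enorm measurable_const
    calc ∫⁻ x in sweep (P i) e t, ‖f x‖ₑ
        ≤ ∫⁻ x in sweep (P i) e t, ENNReal.ofReal ((i + 2) * δ) :=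
          lintegral_mono_ae ((ae_restrict_iff hmeas').2 (Eventually.of_forall hub))
      _ = ENNReal.ofReal ((i + 2) * δ) * volume (sweep (P i) e t) := by simp
      _ ≤ ENNReal.ofReal ((i + 2) * δ) * (ENNReal.ofReal t * (C * surf (m + 1) (P i))) := by
          gcongr; exact hC _ _ _ he ht.1
      _ = ENNReal.ofReal t * (C * ∫⁻ x in P i, ENNReal.ofReal ((i + 2) * δ) ∂(surf (m + 1))) := by
          simp; ring
      _ ≤ _ := by
          refine mul_le_mul_right (mul_le_mul_right ?_ _) _
          refine setLIntegral_mono (hf.measurable.enorm.add_const _) fun x hx => ?_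
          rw [Real.enorm_eq_ofReal_abs, ← ENNReal.ofReal_add (abs_nonneg _) (by positivity)]
          refine ENNReal.ofReal_le_ofReal ?_
          linarith [(hval x hx).1]
  calc ∫⁻ x in sweep A e t, ‖f x‖ₑ ≤ ∑' i, ∫⁻ x in sweep (P i) e t, ‖f x‖ₑ :=
        (lintegral_mono_set hsweep).trans (lintegral_iUnion_le _ _)
    _ ≤ ∑' i, ENNReal.ofReal t *
          (C * ∫⁻ x in P i, (‖f x‖ₑ + ENNReal.ofReal (2 * δ)) ∂(surf (m + 1))) :=
        ENNReal.tsum_le_tsum hPi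
    _ = _ := by
        rw [ENNReal.tsum_mul_left, ENNReal.tsum_mul_left, ← lintegral_iUnion hmeas hdisj, ← hunion]

end HHO

/-! ### The Gauss inequality, by differentiating along translations -/

namespace HHO

open scoped ENNReal

/-- Differentiation under the integral sign: the integral to be estimated is a rate of change along
translations. -/
theorem hasDerivAt_setIntegral_translate {d : ℕ} {K : Set (Pt d)}
    (hb : Bornology.IsBounded K) {f : Pt d → ℝ} (hf : ContDiff ℝ 1 f) (hc : HasCompactSupport f)
    (e : Pt d) :
    HasDerivAt (fun t : ℝ => ∫ x in K, f (x + t • e)) (∫ x in K, fderiv ℝ f x e) 0 := by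
  have hcont : Continuous fun x => fderiv ℝ f x e :=
    (hf.continuous_fderiv one_ne_zero).clm_apply continuous_const
  have hsupp : HasCompactSupport fun x => fderiv ℝ f x e := by
    refine (hc.fderiv (𝕜 := ℝ)).mono fun x hx hx' => hx ?_
    simp [hx']
  obtain ⟨M, hM⟩ := hsupp.exists_bound_of_continuous hcont
  have : IsFiniteMeasure (volume.restrict K) := ⟨by simpa using hb.measure_lt_top⟩
  have h0 := (hasDerivAt_integral_of_dominated_loc_of_deriv_le (μ := volume.restrict K)
    (F := fun (t : ℝ) x => f (x + t • e)) (F' := fun (t : ℝ) x => fderiv ℝ f (x + t • e) e)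
    (x₀ := 0) (bound := fun _ => M) (s := Set.univ) univ_mem
    (Eventually.of_forall fun t =>
      (hf.continuous.comp (continuous_id.add continuous_const)).aestronglyMeasurable)
    (by simpa using (hf.continuous.integrable_of_hasCompactSupport hc).restrict)
    (by simpa using hcont.aestronglyMeasurable)
    (Eventually.of_forall fun x t _ => hM _) (integrable_const M)
    (Eventually.of_forall fun x t _ => by
      have h1 : HasDerivAt (fun t : ℝ => x + t • e) e t := by
        simpa using ((hasDerivAt_id t).smul_const e).const_add x
      exact ((hf.differentiable one_ne_zero _).hasFDerivAt).comp_hasDerivAt t h1)).2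
  simpa using h0

/-- Translating `f` amounts to translating the domain, and the symmetric difference of the two
domains is swept by the frontier. -/
theorem enorm_sub_translate_le {d : ℕ} {K : Set (Pt d)} (hK : MeasurableSet K) {f : Pt d → ℝ}
    (hf : Integrable f) (e : Pt d) {t : ℝ} (ht : 0 ≤ t) :
    ‖(∫ x in K, f (x + t • e)) - ∫ x in K, f x‖ₑ ≤ ∫⁻ x in sweep (frontier K) e t, ‖f x‖ₑ := by
  have hpre : MeasurableSet ((fun x => x - t • e) ⁻¹' K) :=
    hK.preimage (measurable_id.sub_const _)
  have h1 : ∫ x in K, f (x + t • e) = ∫ x in (fun x => x - t • e) ⁻¹' K, f x := by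
    have := (measurePreserving_add_right volume (t • e)).setIntegral_preimage_emb
      (MeasurableEquiv.addRight (t • e)).measurableEmbedding f ((fun x => x - t • e) ⁻¹' K)
    rw [← this]
    congr 2
    ext x; simp
  rw [h1, ← integral_indicator hK, ← integral_indicator hpre, ← integral_sub
    (hf.indicator hpre) (hf.indicator hK)]
  refine (enorm_integral_le_lintegral_enorm _).trans
    (le_trans (lintegral_mono fun x => ?_) (lintegral_indicator_le _ _))
  by_cases hx : x ∈ K <;> by_cases hx' : x - t • e ∈ K
  · simp [Set.indicator, hx, hx']
  · rw [Set.indicator_of_mem (mem_sweep_frontier ht (Or.inl ⟨hx, hx'⟩))]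
    simp [Set.indicator, hx, hx']
  · rw [Set.indicator_of_mem (mem_sweep_frontier ht (Or.inr ⟨hx, hx'⟩))]
    simp [Set.indicator, hx, hx']
  · simp [Set.indicator, hx, hx']

/-- The integral of a derivative over a bounded open set is controlled by the integral of the
function over the boundary. -/
theorem exists_gauss_bound {m : ℕ} (hm : 1 ≤ m) : ∃ C : ℝ, 0 ≤ C ∧
    ∀ K : Set (Pt (m + 1)), IsOpen K → Bornology.IsBounded K → surf (m + 1) (frontier K) ≠ ⊤ →
    ∀ f : Pt (m + 1) → ℝ, ContDiff ℝ 1 f → HasCompactSupport f → ∀ e : Pt (m + 1), ‖e‖ ≤ 1 →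
      |∫ x in K, fderiv ℝ f x e| ≤ C * ∫ x in frontier K, |f x| ∂(surf (m + 1)) := by
  obtain ⟨C, hCtop, hC⟩ := exists_volume_sweep_le hm
  refine ⟨C.toReal, ENNReal.toReal_nonneg, fun K hK hb hS f hf hc e he => ?_⟩
  have hfi : Integrable f := hf.continuous.integrable_of_hasCompactSupport hc
  have hAb : Bornology.IsBounded (frontier K) := hb.closure.subset frontier_subset_closure
  have hAm : MeasurableSet (frontier K) := isClosed_frontier.measurableSet
  have hint : IntegrableOn (fun x => |f x|) (frontier K) (surf (m + 1)) :=
    integrableOn_of_continuous hAm hAb hS hf.continuous.abs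
  set A := ∫ x in frontier K, |f x| ∂(surf (m + 1)) with hA
  have hA0 : 0 ≤ A := integral_nonneg fun _ => abs_nonneg _
  set s := (surf (m + 1) (frontier K)).toReal with hs
  -- The difference quotients are bounded for a fixed slack `δ` as `t → 0`. The slack is removed
  -- afterwards, which uses that the frontier has finite surface measure.
  have hbound : ∀ δ > 0, |∫ x in K, fderiv ℝ f x e| ≤ C.toReal * (A + 2 * δ * s) := by
    intro δ hδ
    have hlin : ∫⁻ x in frontier K, (‖f x‖ₑ + ENNReal.ofReal (2 * δ)) ∂(surf (m + 1)) =
        ENNReal.ofReal (A + 2 * δ * s) := by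
      rw [lintegral_add_right _ measurable_const, lintegral_const, Measure.restrict_apply_univ,
        ENNReal.ofReal_add hA0 (by positivity), hA,
        ofReal_integral_eq_lintegral_ofReal hint (Eventually.of_forall fun _ => abs_nonneg _),
        ENNReal.ofReal_mul (p := 2 * δ) (by positivity), hs, ENNReal.ofReal_toReal hS]
      simp only [Real.enorm_eq_ofReal_abs]
    have hev := lintegral_sweep_le hC hAm hf.continuous (hc.uniformContinuous_of_continuous
      hf.continuous) hδ he
    have hder := (hasDerivAt_setIntegral_translate hb hf hc e).tendsto_slope_zero_right
    refine le_of_tendsto hder.abs ?_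
    filter_upwards [hev, self_mem_nhdsWithin] with t ht ht0
    have ht0' : (0 : ℝ) < t := ht0
    rw [hlin] at ht
    have h2 := (enorm_sub_translate_le hK.measurableSet hfi e ht0'.le).trans ht
    rw [← ENNReal.ofReal_toReal hCtop, ← ENNReal.ofReal_mul ENNReal.toReal_nonneg,
      ← ENNReal.ofReal_mul ht0'.le, Real.enorm_eq_ofReal_abs, ENNReal.ofReal_le_ofReal_iff
      (by positivity)] at h2
    simp only [zero_add, zero_smul, add_zero, smul_eq_mul, abs_mul, abs_inv, abs_of_pos ht0']
    rw [inv_mul_le_iff₀ ht0']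
    exact h2
  have hlim : Tendsto (fun δ : ℝ => C.toReal * (A + 2 * δ * s)) (𝓝[>] 0) (𝓝 (C.toReal * A)) := by
    have : ContinuousAt (fun δ : ℝ => C.toReal * (A + 2 * δ * s)) 0 := by fun_prop
    have h2 := this.tendsto
    simp only [mul_zero, zero_mul, add_zero] at h2
    exact h2.mono_left nhdsWithin_le_nhds
  exact ge_of_tendsto hlim (eventually_mem_nhdsWithin.mono fun δ hδ => hbound δ hδ)

end HHO

namespace HHO

open scoped ENNReal NNReal

/-! ### The boundary of a star-shaped set -/

/-- The hypothesis makes `f` injective on `A` with an `L`-Lipschitz inverse, and `A` is the image of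
`f '' A` under this inverse. -/
theorem hausdorffMeasure_le_of_dist_le {X Y : Type*} [MetricSpace X] [MeasurableSpace X]
    [BorelSpace X] [MetricSpace Y] [MeasurableSpace Y] [BorelSpace Y] {f : X → Y} {A : Set X}
    {L : ℝ≥0} (hf : ∀ x ∈ A, ∀ y ∈ A, dist x y ≤ L * dist (f x) (f y)) {s : ℝ} (hs : 0 ≤ s) :
    Measure.hausdorffMeasure s A ≤ (L : ℝ≥0∞) ^ s * Measure.hausdorffMeasure s (f '' A) := by
  rcases A.eq_empty_or_nonempty with rfl | ⟨a, ha⟩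
  · simp
  have : Nonempty X := ⟨a⟩
  have hinj : Set.InjOn f A := fun x hx y hy hxy => by
    have := hf x hx y hy
    rw [hxy, dist_self, mul_zero] at this
    exact dist_le_zero.1 this
  have hlip : LipschitzOnWith L (Function.invFunOn f A) (f '' A) := by
    refine LipschitzOnWith.of_dist_le_mul ?_
    rintro _ ⟨x, hx, rfl⟩ _ ⟨y, hy, rfl⟩
    rw [hinj.leftInvOn_invFunOn hx, hinj.leftInvOn_invFunOn hy]
    exact hf x hx y hy
  have himg : A = Function.invFunOn f A '' (f '' A) := by
    rw [Set.image_image]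
    exact (Set.EqOn.image_eq_self fun x hx => hinj.leftInvOn_invFunOn hx).symm
  conv_lhs => rw [himg]
  exact hlip.hausdorffMeasure_image_le hs

theorem norm_normalize_sub_le {E : Type*} [NormedAddCommGroup E] [NormedSpace ℝ E] {x y : E}
    (hx : 1 ≤ ‖x‖) (hy : 1 ≤ ‖y‖) : ‖‖x‖⁻¹ • x - ‖y‖⁻¹ • y‖ ≤ 2 * ‖x - y‖ := by
  have hx0 : 0 < ‖x‖ := by linarith
  have hy0 : 0 < ‖y‖ := by linarith
  have h1 : ‖x‖⁻¹ • x - ‖y‖⁻¹ • y = ‖x‖⁻¹ • ((x - y) + (‖y‖⁻¹ * (‖y‖ - ‖x‖)) • y) := by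
    have : ‖x‖⁻¹ * (‖y‖⁻¹ * (‖y‖ - ‖x‖)) = ‖x‖⁻¹ - ‖y‖⁻¹ := by field_simp
    rw [smul_add, smul_smul, this]; module
  have h2 : ‖(‖y‖⁻¹ * (‖y‖ - ‖x‖)) • y‖ ≤ ‖x - y‖ := by
    rw [norm_smul, norm_mul, norm_inv, norm_norm, Real.norm_eq_abs]
    calc ‖y‖⁻¹ * |‖y‖ - ‖x‖| * ‖y‖ = |‖y‖ - ‖x‖| := by field_simp
      _ ≤ ‖y - x‖ := abs_norm_sub_norm_le _ _
      _ = ‖x - y‖ := norm_sub_rev _ _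
  rw [h1, norm_smul, norm_inv, norm_norm]
  calc ‖x‖⁻¹ * ‖(x - y) + (‖y‖⁻¹ * (‖y‖ - ‖x‖)) • y‖ ≤ 1 * (‖x - y‖ + ‖x - y‖) := by
        refine mul_le_mul (inv_le_one_of_one_le₀ hx) ((norm_add_le _ _).trans ?_)
          (norm_nonneg _) zero_le_one
        linarith
    _ = _ := by ring

/-- The sphere is covered by the normalizations of the `2(m + 1)` faces of the cube `[-1, 1]^(m+1)`;
normalization is Lipschitz outside the unit ball. -/
theorem hausdorffMeasure_sphere_ne_top (m : ℕ) :
    Measure.hausdorffMeasure (m : ℝ) (Metric.sphere (0 : Pt (m + 1)) 1) ≠ ⊤ := by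
  let g : Fin (m + 1) → ℝ → (Fin m → ℝ) → Pt (m + 1) := fun i s z =>
    WithLp.toLp 2 (Fin.insertNth i s z : Fin (m + 1) → ℝ)
  let N : Pt (m + 1) → Pt (m + 1) := fun x => ‖x‖⁻¹ • x
  have hglip : ∀ i s, LipschitzWith _ (g i s) := fun i s =>
    (PiLp.lipschitzWith_toLp 2 (fun _ : Fin (m + 1) => ℝ)).comp
      (LipschitzWith.of_dist_le_mul (K := 1) fun z z' => by
        rw [Fin.dist_insertNth_insertNth, dist_self, NNReal.coe_one, one_mul]
        exact max_le dist_nonneg le_rfl)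
  have hgn : ∀ i s z, |s| = 1 → 1 ≤ ‖g i s z‖ := fun i s z hs => by
    have := PiLp.norm_apply_le (g i s z) i
    simpa [g, hs] using this
  have hNlip : LipschitzOnWith 2 N {x | 1 ≤ ‖x‖} :=
    LipschitzOnWith.of_dist_le_mul fun x hx y hy => by
      rw [dist_eq_norm, dist_eq_norm]
      exact norm_normalize_sub_le hx hy
  have hfin : ∀ i s, |s| = 1 → Measure.hausdorffMeasure (m : ℝ)
      ((N ∘ g i s) '' Set.Icc (fun _ => -1) (fun _ => 1)) < ⊤ := by
    intro i s hs
    have hl := hNlip.comp ((hglip i s).lipschitzOnWith (s := Set.Icc (fun _ => -1) (fun _ => 1)))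
      (fun z _ => hgn i s z hs)
    refine (hl.hausdorffMeasure_image_le (Nat.cast_nonneg m)).trans_lt ?_
    refine ENNReal.mul_lt_top (ENNReal.rpow_lt_top_of_nonneg (Nat.cast_nonneg m) ENNReal.coe_ne_top) ?_
    have hvol : (Measure.hausdorffMeasure (m : ℝ) : Measure (Fin m → ℝ)) = volume := by
      simpa using hausdorffMeasure_pi_real (ι := Fin m)
    rw [hvol]
    exact isCompact_Icc.measure_lt_top
  have hsub : Metric.sphere (0 : Pt (m + 1)) 1 ⊆ ⋃ i : Fin (m + 1),
      (((N ∘ g i 1) '' Set.Icc (fun _ => -1) (fun _ => 1)) ∪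
        ((N ∘ g i (-1)) '' Set.Icc (fun _ => -1) (fun _ => 1))) := by
    intro x hx
    rw [mem_sphere_zero_iff_norm] at hx
    -- A coordinate of maximal modulus and its sign select the face of the cube; dividing the other
    -- coordinates by that modulus gives the point on it.
    obtain ⟨i, -, hi⟩ := Finset.exists_max_image Finset.univ (fun i => |x i|)
      Finset.univ_nonempty
    have hM : 0 < |x i| := by
      rw [abs_pos]
      intro h0
      have : x = 0 := by
        ext j
        have := hi j (Finset.mem_univ j)
        rw [h0, abs_zero] at this
        simpa using this
      rw [this, norm_zero] at hx
      exact zero_ne_one hx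
    refine Set.mem_iUnion.2 ⟨i, ?_⟩
    let z : Fin m → ℝ := fun j => |x i|⁻¹ * x (i.succAbove j)
    have hz : z ∈ Set.Icc (fun _ => -1 : Fin m → ℝ) (fun _ => 1) := by
      have : ∀ j, |z j| ≤ 1 := fun j => by
        simp only [z, abs_mul, abs_inv, abs_abs]
        rw [inv_mul_le_iff₀ hM, mul_one]
        exact hi _ (Finset.mem_univ _)
      exact ⟨fun j => (abs_le.1 (this j)).1, fun j => (abs_le.1 (this j)).2⟩
    have key : ∀ s, x i = |x i| * s → (N ∘ g i s) z = x := by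
      intro s hs
      have hg : g i s z = |x i|⁻¹ • x := by
        ext j
        refine Fin.succAboveCases i ?_ (fun j => ?_) j
        · simp only [g, Fin.insertNth_apply_same, PiLp.smul_apply, smul_eq_mul]
          conv_rhs => rw [hs]
          rw [abs_mul, abs_abs]
          have hs1 : |s| = 1 := by
            have := congrArg abs hs
            rw [abs_mul, abs_abs] at this
            exact (mul_right_cancel₀ hM.ne' (by linarith : |s| * |x i| = 1 * |x i|))
          rw [hs1]; field_simp
        · simp [g, z]
      simp only [Function.comp, hg, N, norm_smul, hx, mul_one, norm_inv, Real.norm_eq_abs, abs_abs,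
        inv_inv, smul_smul]
      rw [mul_inv_cancel₀ hM.ne', one_smul]
    rcases abs_choice (x i) with h | h
    · exact Or.inl ⟨z, hz, key 1 (by rw [mul_one, h])⟩
    · exact Or.inr ⟨z, hz, key (-1) (by rw [h]; ring)⟩
  refine ((measure_mono hsub).trans_lt ?_).ne
  refine (measure_iUnion_le _).trans_lt ?_
  rw [tsum_fintype]
  refine ENNReal.sum_lt_top.2 fun i _ => (measure_union_le _ _).trans_lt ?_
  exact ENNReal.add_lt_top.2 ⟨hfin i 1 (by simp), hfin i (-1) (by simp)⟩

theorem surf_sphere_ne_top (m : ℕ) : surf (m + 1) (Metric.sphere (0 : Pt (m + 1)) 1) ≠ ⊤ :=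
  ENNReal.mul_ne_top ENNReal.coe_ne_top (hausdorffMeasure_sphere_ne_top m)

/-- `P` contains the open cone over the ball with apex `x + v`, even if the apex is only in the
closure: the apex is replaced by a nearby point `u` of `P`, and the strict inequality lets the point
`b` of the ball absorb the error. -/
theorem mem_of_starConvex_ball {E : Type*} [NormedAddCommGroup E] [NormedSpace ℝ E] {P : Set E}
    {x : E} {r : ℝ} (hP : ∀ b ∈ Metric.ball x r, StarConvex ℝ b P) {v w : E}
    (hv : x + v ∈ closure P) {t : ℝ} (ht0 : 0 < t) (ht1 : t ≤ 1)
    (hw : ‖w - (1 - t) • v‖ < t * r) : x + w ∈ P := by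
  obtain ⟨u, hu, hd⟩ := Metric.mem_closure_iff.1 hv (t * r - ‖w - (1 - t) • v‖) (by linarith)
  rw [dist_eq_norm] at hd
  set b := x + t⁻¹ • (w - (1 - t) • v + (1 - t) • (x + v - u)) with hb
  have hbm : b ∈ Metric.ball x r := by
    rw [mem_ball_iff_norm, hb, add_sub_cancel_left, norm_smul, norm_inv, Real.norm_eq_abs,
      abs_of_pos ht0, inv_mul_lt_iff₀ ht0]
    refine (norm_add_le _ _).trans_lt ?_
    rw [norm_smul, Real.norm_eq_abs, abs_of_nonneg (by linarith : 0 ≤ 1 - t)]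
    nlinarith [norm_nonneg (x + v - u)]
  have := hP b hbm hu ht0.le (by linarith : 0 ≤ 1 - t) (by ring)
  have heq : t • b + (1 - t) • u = x + w := by
    rw [hb, smul_add, smul_smul, mul_inv_cancel₀ ht0.ne', one_smul]; module
  rwa [heq] at this

/-- The radial function of a star-shaped set is Lipschitz: a point `x + v'` much closer to `x` than
`x + v`, in almost the same direction, would lie in the cone over the ball with apex `x + v`, hence
in `P`. -/
theorem norm_sub_norm_le_of_starConvex {E : Type*} [NormedAddCommGroup E] [NormedSpace ℝ E]
    {P : Set E} {x : E} {r h : ℝ} (hr : 0 < r) (hP : ∀ b ∈ Metric.ball x r, StarConvex ℝ b P)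
    {v v' : E} (hv : x + v ∈ closure P) (hv' : x + v' ∉ P) (hvh : ‖v‖ ≤ h) (hvh' : ‖v'‖ ≤ h)
    (h0 : v ≠ 0) (h0' : v' ≠ 0) :
    ‖v‖ - ‖v'‖ ≤ h ^ 2 / r * ‖‖v‖⁻¹ • v - ‖v'‖⁻¹ • v'‖ := by
  have hn : 0 < ‖v‖ := norm_pos_iff.2 h0
  have hn' : 0 < ‖v'‖ := norm_pos_iff.2 h0'
  rcases le_or_gt ‖v‖ ‖v'‖ with hle | hlt
  · have : 0 ≤ h ^ 2 / r * ‖‖v‖⁻¹ • v - ‖v'‖⁻¹ • v'‖ := by positivity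
    linarith
  set θ := ‖‖v‖⁻¹ • v - ‖v'‖⁻¹ • v'‖ with hθ
  -- Chosen so that `(1 - t) • v` has the length of `v'`; the distance to `v'` is then `‖v'‖` times
  -- the distance of the directions.
  set t := 1 - ‖v'‖ / ‖v‖ with ht
  have ht0 : 0 < t := by rw [ht, sub_pos, div_lt_one hn]; exact hlt
  have ht1 : t ≤ 1 := by rw [ht]; linarith [div_nonneg hn'.le hn.le]
  have hge : t * r ≤ ‖v'‖ * θ := by
    by_contra! hc
    refine hv' (mem_of_starConvex_ball hP hv ht0 ht1 ?_)
    have : v' - (1 - t) • v = -(‖v'‖ • (‖v‖⁻¹ • v - ‖v'‖⁻¹ • v')) := by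
      rw [smul_sub, smul_smul, smul_smul, mul_inv_cancel₀ hn'.ne', ht]
      have : 1 - (1 - ‖v'‖ / ‖v‖) = ‖v'‖ * ‖v‖⁻¹ := by ring
      rw [this]; module
    rw [this, norm_neg, norm_smul, norm_norm]
    exact hc
  have h1 : (‖v‖ - ‖v'‖) * r = ‖v‖ * (t * r) := by rw [ht]; field_simp
  have h2 : (‖v‖ - ‖v'‖) * r ≤ h ^ 2 * θ := by
    rw [h1]
    have hh : 0 ≤ h := hn.le.trans hvh
    calc ‖v‖ * (t * r) ≤ ‖v‖ * (‖v'‖ * θ) := by gcongr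
      _ = (‖v‖ * ‖v'‖) * θ := by ring
      _ ≤ (h * h) * θ := by gcongr
      _ = _ := by ring
  rw [div_mul_eq_mul_div, le_div_iff₀ hr]
  exact h2

/-- Radial projection from `x` maps the frontier into the unit sphere. Its inverse has the Lipschitz
constant `h²/r + h`: the first term accounts for the change of radius, the second for the change of
direction. -/
theorem surf_frontier_le_of_starConvex {m : ℕ} {P : Set (Pt (m + 1))} {x : Pt (m + 1)} {r h : ℝ}
    (hr : 0 < r) (hPo : IsOpen P) (hxP : x ∈ P)
    (hP : ∀ b ∈ Metric.ball x r, StarConvex ℝ b P) (hh : P ⊆ Metric.closedBall x h) :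
    surf (m + 1) (frontier P) ≤ ENNReal.ofReal ((h ^ 2 / r + h) ^ m) *
      surf (m + 1) (Metric.sphere 0 1) := by
  have hh0 : 0 ≤ h := by
    have := hh hxP
    rwa [Metric.mem_closedBall, dist_self] at this
  have hcl : closure P ⊆ Metric.closedBall x h := closure_minimal hh Metric.isClosed_closedBall
  have hmem : ∀ y ∈ frontier P, x + (y - x) ∈ closure P ∧ x + (y - x) ∉ P ∧ ‖y - x‖ ≤ h ∧
      y - x ≠ 0 := by
    intro y hy
    rw [hPo.frontier_eq] at hy
    refine ⟨by simpa using hy.1, by simpa using hy.2, mem_closedBall_iff_norm.1 (hcl hy.1), ?_⟩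
    intro h0
    exact hy.2 (by rwa [sub_eq_zero.1 h0])
  have hL : 0 ≤ h ^ 2 / r + h := by positivity
  have hdist : ∀ y ∈ frontier P, ∀ y' ∈ frontier P, dist y y' ≤
      (h ^ 2 / r + h).toNNReal * dist (‖y - x‖⁻¹ • (y - x)) (‖y' - x‖⁻¹ • (y' - x)) := by
    intro y hy y' hy'
    obtain ⟨h1, h2, h3, h4⟩ := hmem y hy
    obtain ⟨h1', h2', h3', h4'⟩ := hmem y' hy'
    set v := y - x with hv
    set v' := y' - x with hv'
    have ha := norm_sub_norm_le_of_starConvex hr hP h1 h2' h3 h3' h4 h4'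
    have hb := norm_sub_norm_le_of_starConvex hr hP h1' h2 h3' h3 h4' h4
    rw [norm_sub_rev (‖v'‖⁻¹ • v')] at hb
    rw [dist_eq_norm, dist_eq_norm, Real.coe_toNNReal _ hL]
    set θ := ‖‖v‖⁻¹ • v - ‖v'‖⁻¹ • v'‖ with hθ
    have hn : 0 < ‖v‖ := norm_pos_iff.2 h4
    have hn' : 0 < ‖v'‖ := norm_pos_iff.2 h4'
    have heq : y - y' = (‖v‖ - ‖v'‖) • (‖v‖⁻¹ • v) + ‖v'‖ • (‖v‖⁻¹ • v - ‖v'‖⁻¹ • v') := by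
      have : y - y' = v - v' := by rw [hv, hv']; abel
      have e1 : ‖v‖ • ‖v‖⁻¹ • v = v := by rw [smul_smul, mul_inv_cancel₀ hn.ne', one_smul]
      have e2 : ‖v'‖ • ‖v'‖⁻¹ • v' = v' := by rw [smul_smul, mul_inv_cancel₀ hn'.ne', one_smul]
      have e3 : ∀ (a b : ℝ) (u w : Pt (m + 1)), (a - b) • u + b • (u - w) = a • u - b • w :=
        fun a b u w => by module
      rw [this, e3, e1, e2]
    rw [heq]
    refine (norm_add_le _ _).trans ?_
    rw [norm_smul, norm_smul, norm_smul, norm_inv, norm_norm, norm_norm, inv_mul_cancel₀ hn.ne',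
      mul_one, Real.norm_eq_abs, add_mul]
    refine add_le_add (abs_le.2 ⟨by linarith, ha⟩) (mul_le_mul_of_nonneg_right h3' (norm_nonneg _))
  have hH := hausdorffMeasure_le_of_dist_le (f := fun y => ‖y - x‖⁻¹ • (y - x))
    hdist (Nat.cast_nonneg (α := ℝ) m)
  have hsph : (fun y => ‖y - x‖⁻¹ • (y - x)) '' frontier P ⊆ Metric.sphere 0 1 := by
    rintro _ ⟨y, hy, rfl⟩
    rw [mem_sphere_zero_iff_norm, norm_smul, norm_inv, norm_norm]
    exact inv_mul_cancel₀ (norm_ne_zero_iff.2 (hmem y hy).2.2.2)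
  have hL' : ((h ^ 2 / r + h).toNNReal : ℝ≥0∞) ^ (m : ℝ) =
      ENNReal.ofReal ((h ^ 2 / r + h) ^ m) := by
    rw [ENNReal.rpow_natCast, ENNReal.ofReal_pow hL]
    rfl
  rw [hL'] at hH
  have hsurf : ∀ A, surf (m + 1) A = ((Measure.addHaarScalarFactor
    (volume : Measure (EuclideanSpace ℝ (Fin m))) (Measure.hausdorffMeasure m) : NNReal) : ℝ≥0∞) *
      Measure.hausdorffMeasure (m : ℝ) A := fun A => rfl
  rw [hsurf, hsurf, mul_left_comm]
  exact mul_le_mul_right (hH.trans (mul_le_mul_right (measure_mono hsph) _)) _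

/-- `K` can be decomposed into finitely many nonoverlapping open sets, each star-shaped with respect
to a ball of radius `r`. -/
def IsStarDecomposable {d : ℕ} (K : Set (Pt d)) (r : ℝ) : Prop :=
  ∃ (N : ℕ) (P : Fin N → Set (Pt d)),
    (∀ i, IsOpen (P i) ∧ P i ⊆ K) ∧ Pairwise (fun i j => Disjoint (P i) (P j)) ∧
    closure K = (⋃ i, closure (P i)) ∧
    ∀ i, ∃ x, Metric.ball x r ⊆ P i ∧ ∀ y ∈ Metric.ball x r, StarConvex ℝ y (P i)

theorem IsStarDecomposable.exists_ball {d : ℕ} {K : Set (Pt d)} {r : ℝ}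
    (h : IsStarDecomposable K r) (hne : K.Nonempty) : ∃ x, Metric.ball x r ⊆ K := by
  obtain ⟨N, P, h1, -, h3, h4⟩ := h
  obtain ⟨y, hy⟩ := hne
  obtain ⟨i, -⟩ := Set.mem_iUnion.1 (h3 ▸ subset_closure hy)
  obtain ⟨x, hx, -⟩ := h4 i
  exact ⟨x, hx.trans (h1 i).2⟩

/-- The frontier of `K` is contained in the union of the frontiers of its star-shaped pieces, each
of surface at most a constant times `h^m`, and the number of pieces is bounded. -/
theorem exists_surf_frontier_le (m : ℕ) {ρ : ℝ} (hρ : 0 < ρ) : ∃ C : ℝ, 0 ≤ C ∧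
    ∀ (K : Set (Pt (m + 1))) (h : ℝ), IsOpen K → 0 < h → (∀ x ∈ K, K ⊆ Metric.closedBall x h) →
      IsStarDecomposable K (ρ * h) → surf (m + 1) (frontier K) ≤ ENNReal.ofReal (C * h ^ m) := by
  set S := (surf (m + 1) (Metric.sphere (0 : Pt (m + 1)) 1)).toReal with hS
  refine ⟨ρ⁻¹ ^ (m + 1) * ((ρ⁻¹ + 1) ^ m * S), by positivity, fun K h hK hh hKh hdec => ?_⟩
  obtain ⟨N, P, h1, h2, h3, h4⟩ := hdec
  choose x hx hst using h4
  have hxP : ∀ i, x i ∈ P i := fun i => hx i (Metric.mem_ball_self (by positivity))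
  have hfr : frontier K ⊆ ⋃ i, frontier (P i) := by
    intro y hy
    rw [hK.frontier_eq] at hy
    obtain ⟨i, hi⟩ := Set.mem_iUnion.1 (h3 ▸ hy.1)
    refine Set.mem_iUnion.2 ⟨i, ?_⟩
    rw [(h1 i).1.frontier_eq]
    exact ⟨hi, fun hyP => hy.2 ((h1 i).2 hyP)⟩
  -- The pieces contain disjoint balls of radius `ρ h`, all within a ball of radius `h`; comparing
  -- volumes gives `N ρ^(m+1) ≤ 1`.
  have hN : (N : ℝ) ≤ ρ⁻¹ ^ (m + 1) := by
    rcases Nat.eq_zero_or_pos N with rfl | hN0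
    · simp; positivity
    set V := volume (Metric.ball (0 : Pt (m + 1)) 1) with hV
    have hV0 : V ≠ 0 := (Metric.measure_ball_pos volume 0 one_pos).ne'
    have hVt : V ≠ ⊤ := Metric.isBounded_ball.measure_lt_top.ne
    have hle : (N : ℝ≥0∞) * (ENNReal.ofReal ((ρ * h) ^ (m + 1)) * V) ≤
        ENNReal.ofReal (h ^ (m + 1)) * V := by
      calc (N : ℝ≥0∞) * (ENNReal.ofReal ((ρ * h) ^ (m + 1)) * V)
          = ∑ i : Fin N, volume (Metric.ball (x i) (ρ * h)) := by
            have : ∀ y : Pt (m + 1), volume (Metric.ball y (ρ * h)) =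
                ENNReal.ofReal ((ρ * h) ^ (m + 1)) * V := fun y => by
              rw [Measure.addHaar_ball _ _ (by positivity)]; simp [hV]
            simp [this]
        _ ≤ ∑ i : Fin N, volume (P i) := Finset.sum_le_sum fun i _ => measure_mono (hx i)
        _ = volume (⋃ i, P i) := by
            rw [measure_iUnion h2 (fun i => (h1 i).1.measurableSet), tsum_fintype]
        _ ≤ volume (Metric.closedBall (x ⟨0, hN0⟩) h) :=
            measure_mono ((Set.iUnion_subset fun i => (h1 i).2).trans
              (hKh _ ((h1 _).2 (hxP _))))
        _ = _ := by rw [Measure.addHaar_closedBall _ _ hh.le]; simp [hV]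
    rw [← mul_assoc, ENNReal.mul_le_mul_iff_left hV0 hVt, ← ENNReal.ofReal_natCast,
      ← ENNReal.ofReal_mul (by positivity), ENNReal.ofReal_le_ofReal_iff (by positivity),
      mul_pow, ← mul_assoc] at hle
    have := le_of_mul_le_mul_right (by linarith : N * ρ ^ (m + 1) * h ^ (m + 1) ≤ 1 * h ^ (m + 1))
      (by positivity)
    rw [inv_pow]
    exact (le_inv_comm₀ (by positivity) (by positivity)).1
      ((le_inv_comm₀ (by positivity) (by positivity)).1 ((le_div_iff₀ (by positivity)).2 this |>.trans_eq
        (one_div _)))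
  have hPi : ∀ i, surf (m + 1) (frontier (P i)) ≤
      ENNReal.ofReal (((ρ⁻¹ + 1) ^ m * S) * h ^ m) := by
    intro i
    refine (surf_frontier_le_of_starConvex (by positivity) (h1 i).1 (hxP i) (hst i)
      ((h1 i).2.trans (hKh _ ((h1 i).2 (hxP i))))).trans (le_of_eq ?_)
    rw [← ENNReal.ofReal_toReal (surf_sphere_ne_top m), ← ENNReal.ofReal_mul (by positivity)]
    congr 1
    have : h ^ 2 / (ρ * h) + h = (ρ⁻¹ + 1) * h := by field_simp
    rw [this, mul_pow]; ring
  calc surf (m + 1) (frontier K) ≤ ∑ i : Fin N, surf (m + 1) (frontier (P i)) := by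
        refine (measure_mono hfr).trans ((measure_iUnion_le _).trans_eq (tsum_fintype _))
    _ ≤ ∑ i : Fin N, ENNReal.ofReal (((ρ⁻¹ + 1) ^ m * S) * h ^ m) :=
        Finset.sum_le_sum fun i _ => hPi i
    _ = ENNReal.ofReal (N * (((ρ⁻¹ + 1) ^ m * S) * h ^ m)) := by
        rw [ENNReal.ofReal_mul (Nat.cast_nonneg _)]; simp
    _ ≤ _ := by
        refine ENNReal.ofReal_le_ofReal ?_
        have : 0 ≤ ((ρ⁻¹ + 1) ^ m * S) * h ^ m := by positivity
        nlinarith [mul_le_mul_of_nonneg_right hN this]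

end HHO

namespace HHO

/-! ### Simplices -/

/-- A nonempty interior forces an affine span of dimension `m + 1`, which takes `m + 2` points. This
separates the interiors of distinct top-dimensional simplices. -/
theorem interior_convexHull_eq_empty {m : ℕ} {s : Finset (Pt (m + 1))} (hs : s.card ≤ m + 1) :
    interior (convexHull ℝ (s : Set (Pt (m + 1)))) = ∅ := by
  by_contra hne
  rw [← ne_eq, ← Set.nonempty_iff_ne_empty,
    interior_convexHull_nonempty_iff_affineSpan_eq_top] at hne
  have hspan : vectorSpan ℝ (s : Set (Pt (m + 1))) = ⊤ := by
    rw [← direction_affineSpan, hne, AffineSubspace.direction_top]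
  rcases s.eq_empty_or_nonempty with rfl | hsne
  · rw [Finset.coe_empty, vectorSpan_empty] at hspan
    exact bot_ne_top hspan
  obtain ⟨k, hk⟩ := Nat.exists_eq_succ_of_ne_zero hsne.card_pos.ne'
  have := finrank_vectorSpan_image_finset_le ℝ (id : Pt (m + 1) → Pt (m + 1)) s hk
  rw [Finset.image_id, hspan, finrank_top, finrank_euclideanSpace_fin] at this
  omega

/-- The point is the centroid of `s`. If it lies in another simplex `t`, it lies in the hull of `s ∩
t`; a vertex of `s` missing from `t` would then be an affine combination of the other vertices. This
serves to find the `d`-simplex behind a given facet. -/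
theorem subset_of_convexHull_inter_subset {E : Type*} [AddCommGroup E] [Module ℝ E]
    {𝒮 : Geometry.SimplicialComplex ℝ E} {s : Finset E} (hs : s ∈ 𝒮.faces) :
    ∃ c ∈ convexHull ℝ (s : Set E), ∀ t ∈ 𝒮.faces, c ∈ convexHull ℝ (t : Set E) → s ⊆ t := by
  classical
  have hsne := 𝒮.nonempty_of_mem_faces hs
  have hcard : (s.card : ℝ) ≠ 0 := by exact_mod_cast hsne.card_pos.ne'
  refine ⟨∑ v ∈ s, (s.card : ℝ)⁻¹ • v, ?_, fun t ht hc v hv => ?_⟩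
  · exact (convex_convexHull ℝ _).sum_mem (fun _ _ => by positivity)
      (by rw [Finset.sum_const, nsmul_eq_mul, mul_inv_cancel₀ hcard])
      (fun v hv => subset_convexHull ℝ _ hv)
  by_contra hvt
  have hc' : ∑ v ∈ s, (s.card : ℝ)⁻¹ • v ∈ convexHull ℝ (s : Set E) :=
    (convex_convexHull ℝ _).sum_mem (fun _ _ => by positivity)
      (by rw [Finset.sum_const, nsmul_eq_mul, mul_inv_cancel₀ hcard])
      (fun v hv => subset_convexHull ℝ _ hv)
  have h1 := 𝒮.inter_subset_convexHull hs ht ⟨hc', hc⟩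
  have hsub : (s ∩ t : Set E) ⊆ (s.erase v : Set E) := by
    rintro x ⟨hx, hxt⟩
    rw [Finset.coe_erase]
    exact ⟨hx, fun h => hvt (by rw [← h]; exact hxt)⟩
  have h2 := convexHull_mono hsub h1
  have hne : (s.erase v).Nonempty := by
    rw [← Finset.coe_nonempty]
    exact convexHull_nonempty_iff.1 ⟨_, h2⟩
  have hcard' : ((s.erase v).card : ℝ) ≠ 0 := by exact_mod_cast hne.card_pos.ne'
  have h3 : ∑ w ∈ s.erase v, ((s.erase v).card : ℝ)⁻¹ • w ∈ convexHull ℝ (s.erase v : Set E) :=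
    (convex_convexHull ℝ _).sum_mem (fun _ _ => by positivity)
      (by rw [Finset.sum_const, nsmul_eq_mul, mul_inv_cancel₀ hcard'])
      (fun v hv => subset_convexHull ℝ _ hv)
  -- The line from the centroid of `s.erase v` through that of `s` reaches `v` at the parameter
  -- `s.card`.
  have hv' : v ∈ affineSpan ℝ (s.erase v : Set E) := by
    have := AffineMap.lineMap_mem (s.card : ℝ) (convexHull_subset_affineSpan _ h3)
      (convexHull_subset_affineSpan _ h2)
    have heq : AffineMap.lineMap (∑ w ∈ s.erase v, ((s.erase v).card : ℝ)⁻¹ • w)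
        (∑ v ∈ s, (s.card : ℝ)⁻¹ • v) (s.card : ℝ) = v := by
      rw [← Finset.smul_sum, ← Finset.smul_sum, AffineMap.lineMap_apply_module, smul_smul, smul_smul,
        mul_inv_cancel₀ hcard, one_smul, ← Finset.add_sum_erase s _ hv]
      have : (s.card : ℝ) = (s.erase v).card + 1 := by
        exact_mod_cast (Finset.card_erase_add_one hv).symm
      rw [this, show (1 - (((s.erase v).card : ℝ) + 1)) * ((s.erase v).card : ℝ)⁻¹ = -1 by
        field_simp; ring]
      module
    rwa [heq] at this
  have hind := (𝒮.indep hs).notMem_affineSpan_sdiff (⟨v, hv⟩ : s) Set.univ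
  apply hind
  convert hv' using 2
  ext x
  simp only [Set.mem_image, Set.mem_sdiff, Set.mem_univ, true_and, Set.mem_singleton_iff,
    Finset.coe_erase]
  constructor
  · rintro ⟨y, hy, rfl⟩
    exact ⟨y.2, fun h => hy (Subtype.ext h)⟩
  · rintro ⟨hx, hxv⟩
    exact ⟨⟨x, hx⟩, fun h => hxv (congrArg Subtype.val h), rfl⟩

/-- A facet of a simplex that contains a ball contains a disc of the same radius. -/
theorem exists_disc_subset_facet {E : Type*} [NormedAddCommGroup E] [InnerProductSpace ℝ E]
    {s : Set E} (hs : s.Nonempty) {a n x₀ y : E} {r : ℝ} (hn : ‖n‖ = 1) (hr : 0 < r)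
    (hsub : ∀ x ∈ s, inner ℝ (x - x₀) n = 0)
    (hball : Metric.closedBall y r ⊆ convexHull ℝ (insert a s)) :
    ∃ z ∈ convexHull ℝ s, ∀ w, inner ℝ (w - z) n = 0 → ‖w - z‖ ≤ r → w ∈ convexHull ℝ s := by
  have hconv : ∀ x ∈ convexHull ℝ s, inner ℝ (x - x₀) n = 0 := by
    have : Convex ℝ {x : E | inner ℝ (x - x₀) n = 0} := by
      intro u hu v hv p q _ _ hpq
      simp only [Set.mem_ofPred_eq] at hu hv ⊢
      have : p • u + q • v - x₀ = p • (u - x₀) + q • (v - x₀) := by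
        rw [smul_sub, smul_sub]
        nth_rewrite 1 [← one_smul ℝ x₀]
        rw [← hpq]; module
      rw [this, inner_add_left, inner_smul_left, inner_smul_left, hu, hv]; simp
    exact fun x hx => convexHull_min hsub this hx
  have hrep : ∀ x ∈ Metric.closedBall y r, ∃ t : ℝ, 0 ≤ t ∧ t ≤ 1 ∧ ∃ z ∈ convexHull ℝ s,
      x = t • a + (1 - t) • z := by
    intro x hx
    have := hball hx
    rw [convexHull_insert hs, convexJoin_singleton_left] at this
    simp only [Set.mem_iUnion] at this
    obtain ⟨z, hz, p, q, hp, hq, hpq, rfl⟩ := this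
    exact ⟨p, hp, by linarith, z, hz, by rw [← hpq]; congr 2; ring⟩
  have hheight : ∀ (t : ℝ) (z : E), inner ℝ (z - x₀) n = 0 →
      inner ℝ (t • a + (1 - t) • z - x₀) n = t * inner ℝ (a - x₀) n := by
    intro t z hz
    have : t • a + (1 - t) • z - x₀ = t • (a - x₀) + (1 - t) • (z - x₀) := by module
    rw [this, inner_add_left, inner_smul_left, inner_smul_left, hz]; simp
  obtain ⟨t, ht0, ht1, z, hz, hy⟩ := hrep y (Metric.mem_closedBall_self hr.le)
  have hnn : inner ℝ n n = (1 : ℝ) := by rw [real_inner_self_eq_norm_sq, hn]; norm_num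
  have hyh : inner ℝ (y - x₀) n = t * inner ℝ (a - x₀) n := by
    rw [hy]; exact hheight t z (hconv z hz)
  -- Points of the simplex have heights between `0` and that of the apex `a`. Moving from `y` by `r`
  -- along `n` and `-n` stays inside, so `y` is not at the height of the apex and that height is
  -- nonzero.
  have hlt : t < 1 ∧ (inner ℝ (a - x₀) n : ℝ) ≠ 0 := by
    obtain ⟨t₁, h10, h11, z₁, hz₁, hy₁⟩ := hrep (y + r • n)
      (by rw [mem_closedBall_iff_norm, add_sub_cancel_left, norm_smul, hn]; simp [abs_of_pos hr])
    obtain ⟨t₂, h20, h21, z₂, hz₂, hy₂⟩ := hrep (y + (-r) • n)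
      (by rw [mem_closedBall_iff_norm, add_sub_cancel_left, norm_smul, hn]; simp [abs_of_pos hr])
    have e1 := hheight t₁ z₁ (hconv z₁ hz₁)
    have e2 := hheight t₂ z₂ (hconv z₂ hz₂)
    rw [← hy₁, add_sub_right_comm, inner_add_left, inner_smul_left, hnn, hyh] at e1
    rw [← hy₂, add_sub_right_comm, inner_add_left, inner_smul_left, hnn, hyh] at e2
    simp only [conj_trivial, mul_one] at e1 e2
    set A : ℝ := inner ℝ (a - x₀) n
    constructor
    · by_contra! hge
      have ht : t = 1 := le_antisymm ht1 hge
      rw [ht] at e1 e2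
      rcases le_total 0 A with hA | hA
      · nlinarith
      · nlinarith
    · intro h0
      rw [h0] at e1
      linarith
  have h1t : 0 < 1 - t := by linarith [hlt.1]
  refine ⟨z, hz, fun w hw hwr => ?_⟩
  have hwh : inner ℝ (w - x₀) n = 0 := by
    have : w - x₀ = (w - z) + (z - x₀) := by abel
    rw [this, inner_add_left, hw, hconv z hz, add_zero]
  -- The segment from `a` to `w` is followed up to the height of `y`, which contracts distances by
  -- `1 - t` and so stays in the ball. Equal heights force equal parameters, hence `w = z'`.
  obtain ⟨t', -, -, z', hz', hq⟩ := hrep (t • a + (1 - t) • w) (by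
    rw [mem_closedBall_iff_norm, hy]
    have : t • a + (1 - t) • w - (t • a + (1 - t) • z) = (1 - t) • (w - z) := by module
    rw [this, norm_smul, Real.norm_eq_abs, abs_of_pos h1t]
    nlinarith [norm_nonneg (w - z)])
  have e1 := hheight t w hwh
  rw [hq, hheight t' z' (hconv z' hz')] at e1
  have htt : t' = t := mul_right_cancel₀ hlt.2 e1
  rw [htt] at hq
  have := add_left_cancel hq
  rw [smul_right_injective E h1t.ne' this]
  exact hz'

theorem IsStarDecomposable.mono {d : ℕ} {K : Set (Pt d)} {r r' : ℝ} (h : IsStarDecomposable K r)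
    (hr : r' ≤ r) : IsStarDecomposable K r' := by
  obtain ⟨N, P, h1, h2, h3, h4⟩ := h
  refine ⟨N, P, h1, h2, h3, fun i => ?_⟩
  obtain ⟨x, hx, hst⟩ := h4 i
  have := Metric.ball_subset_ball (x := x) hr
  exact ⟨x, this.trans hx, fun y hy => hst y (this hy)⟩

/-- The pieces are the interiors of the simplices, which are convex and hence star-shaped with
respect to each of their points. Regularity of `K` places them inside `K` and not merely inside its
closure. -/
theorem isStarDecomposable_of_simplices {m : ℕ} {K : Set (Pt (m + 1))} {r : ℝ} (hr : 0 < r)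
    (hreg : interior (closure K) = K)
    {𝒮 : Geometry.SimplicialComplex ℝ (Pt (m + 1))} (hfin : 𝒮.faces.Finite)
    (hK : closure K = (⋃ s ∈ {s ∈ 𝒮.faces | s.card = m + 1 + 1 ∧
        convexHull ℝ (s : Set (Pt (m + 1))) ⊆ closure K}, convexHull ℝ (s : Set (Pt (m + 1)))))
    (hball : ∀ s ∈ 𝒮.faces, s.card = m + 1 + 1 → convexHull ℝ (s : Set (Pt (m + 1))) ⊆ closure K →
      ∃ x, Metric.closedBall x r ⊆ convexHull ℝ (s : Set (Pt (m + 1)))) :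
    IsStarDecomposable K r := by
  classical
  set I := {s ∈ 𝒮.faces | s.card = m + 1 + 1 ∧
        convexHull ℝ (s : Set (Pt (m + 1))) ⊆ closure K} with hI
  have hIfin : Finite I := hfin.subset fun s hs => hs.1
  obtain ⟨N, ⟨e⟩⟩ := Finite.exists_equiv_fin I
  have hint : ∀ s ∈ I, ∃ x, Metric.ball x r ⊆ interior (convexHull ℝ (s : Set (Pt (m + 1)))) := by
    intro s hs
    obtain ⟨x, hx⟩ := hball s hs.1 hs.2.1 hs.2.2
    exact ⟨x, interior_maximal (Metric.ball_subset_closedBall.trans hx) Metric.isOpen_ball⟩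
  have hcl : ∀ s ∈ I, closure (interior (convexHull ℝ (s : Set (Pt (m + 1))))) =
      convexHull ℝ (s : Set (Pt (m + 1))) := by
    intro s hs
    obtain ⟨x, hx⟩ := hint s hs
    rw [(convex_convexHull ℝ _).closure_interior_eq_closure_of_nonempty_interior
      ⟨x, hx (Metric.mem_ball_self hr)⟩]
    exact (s.finite_toSet.isCompact_convexHull (𝕜 := ℝ)).isClosed.closure_eq
  refine ⟨N, fun i => interior (convexHull ℝ ((e.symm i).1 : Set (Pt (m + 1)))),
    fun i => ⟨isOpen_interior, ?_⟩, fun i j hij => ?_, ?_, fun i => ?_⟩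
  · rw [← hreg]
    exact interior_mono (e.symm i).2.2.2
  · have hne : (e.symm i).1 ≠ (e.symm j).1 := fun h => hij (e.symm.injective (Subtype.ext h))
    set s := (e.symm i).1
    set t := (e.symm j).1
    have hs : s ∈ I := (e.symm i).2
    have ht : t ∈ I := (e.symm j).2
    change Disjoint (interior (convexHull ℝ (s : Set (Pt (m + 1)))))
      (interior (convexHull ℝ (t : Set (Pt (m + 1)))))
    rw [Set.disjoint_iff_inter_eq_empty, ← interior_inter, Set.eq_empty_iff_forall_notMem]
    intro x hx
    have h1 := interior_mono (𝒮.inter_subset_convexHull hs.1 ht.1) hx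
    rw [← Finset.coe_inter, interior_convexHull_eq_empty] at h1
    · exact h1
    · by_contra! hc
      have h2 : s ∩ t = s := Finset.eq_of_subset_of_card_le Finset.inter_subset_left
        (by rw [hs.2.1]; omega)
      have h3 : s ∩ t = t := Finset.eq_of_subset_of_card_le Finset.inter_subset_right
        (by rw [ht.2.1]; omega)
      exact hne (h2.symm.trans h3)
  · conv_lhs => rw [hK]
    rw [Set.biUnion_eq_iUnion]
    rw [← e.symm.surjective.iUnion_comp]
    exact Set.iUnion_congr fun i => (hcl _ (e.symm i).2).symm
  · obtain ⟨x, hx⟩ := hint _ (e.symm i).2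
    exact ⟨x, hx, fun y hy => (convex_convexHull ℝ _).interior.starConvex (hx hy)⟩

end HHO

namespace HHO

/-! ### Cells near their planar faces -/

/-- For distinct unit vectors, the direction `n' - n` enters `K` according to `n` and leaves it
according to `n'`. -/
theorem IsOutwardNormal.unique {d : ℕ} {K : Set (Pt d)} {x n n' : Pt d}
    (h : IsOutwardNormal K x n) (h' : IsOutwardNormal K x n') : n = n' := by
  by_contra hne
  have hlt : (inner ℝ n n' : ℝ) < 1 := by
    have h1 : 0 < ‖n - n'‖ ^ 2 := by
      have := norm_pos_iff.2 (sub_ne_zero.2 hne); positivity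
    rw [norm_sub_sq_real, h.1, h'.1] at h1
    linarith
  have hnn : ∀ w : Pt d, ‖w‖ = 1 → (inner ℝ w w : ℝ) = 1 := fun w hw => by
    rw [real_inner_self_eq_norm_sq, hw]; norm_num
  have e1 := h.2.1 (n' - n) (by
    rw [inner_sub_left, hnn n h.1, real_inner_comm]; linarith)
  have e2 := h'.2.2 (n' - n) (by rw [inner_sub_left, hnn n' h'.1]; linarith)
  obtain ⟨t, ht1, ht2⟩ := (e1.and e2).exists
  exact ht2 ht1

theorem subset_or_disjoint_of_disjoint_frontier {X : Type*} [TopologicalSpace X] {S K : Set X}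
    (hS : IsPreconnected S) (h : ∀ x ∈ S, x ∉ frontier K) {p : X} (hp : p ∈ S) :
    (p ∈ K → S ⊆ K) ∧ (p ∉ K → ∀ x ∈ S, x ∉ K) := by
  constructor
  · intro hpK x hx
    by_contra hxK
    obtain ⟨y, hy, hy'⟩ := inter_frontier_nonempty hS ⟨p, hp, hpK⟩ ⟨x, hx, hxK⟩
    exact h y hy hy'
  · intro hpK x hx hxK
    obtain ⟨y, hy, hy'⟩ := inter_frontier_nonempty hS ⟨x, hx, hxK⟩ ⟨p, hp, hpK⟩
    exact h y hy hy'

/-- Near a point of its boundary where the boundary lies in a hyperplane and an outward normal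
exists, an open set is a half-space. -/
theorem inter_ball_eq_halfSpace {d : ℕ} {K : Set (Pt d)} (hK : IsOpen K) {x x₀ n : Pt d} {δ : ℝ}
    (hδ : 0 < δ) (hx : x ∈ hyperplane n x₀)
    (hfr : ∀ y ∈ Metric.ball x δ, y ∈ frontier K → y ∈ hyperplane n x₀)
    (hn : IsOutwardNormal K x n) {y : Pt d} (hy : y ∈ Metric.ball x δ) :
    y ∈ K ↔ inner ℝ (y - x₀) n < 0 := by
  have hnn : (inner ℝ n n : ℝ) = 1 := by rw [real_inner_self_eq_norm_sq, hn.1]; norm_num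
  have hx' : inner ℝ (x - x₀) n = 0 := hx
  have hlin : ∀ t : ℝ, (inner ℝ (x + t • n - x₀) n : ℝ) = t := by
    intro t
    rw [add_sub_right_comm, inner_add_left, hx', inner_smul_left, hnn]; simp
  have hin : ∀ᶠ t : ℝ in 𝓝[>] 0, ∀ s : ℝ, |s| = 1 → x + (t * s) • n ∈ Metric.ball x δ := by
    filter_upwards [Ioo_mem_nhdsGT hδ] with t ht s hs
    rw [mem_ball_iff_norm, add_sub_cancel_left, norm_smul, hn.1, mul_one, norm_mul,
      Real.norm_eq_abs, Real.norm_eq_abs, hs, mul_one, abs_of_pos ht.1]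
    exact ht.2
  -- The half-balls, outer for `s = 1` and inner for `s = -1`, are connected and avoid the frontier.
  -- Each is in or out of `K` as a whole, and the outward normal decides which.
  have hhalf : ∀ s : ℝ, IsPreconnected {y | y ∈ Metric.ball x δ ∧ 0 < s * inner ℝ (y - x₀) n} := by
    intro s
    refine Convex.isPreconnected ?_
    have : {y : Pt d | 0 < s * inner ℝ (y - x₀) n} =
        {y : Pt d | s * inner ℝ x₀ n < (s • innerSL ℝ n).toLinearMap y} := by
      ext y
      simp only [Set.mem_ofPred_eq, inner_sub_left]
      simp only [ContinuousLinearMap.coe_coe, smul_apply, innerSL_apply_apply, smul_eq_mul,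
        real_inner_comm n y]
      constructor <;> intro h <;> linarith
    have hc : Convex ℝ {y : Pt d | 0 < s * inner ℝ (y - x₀) n} := by
      rw [this]
      exact convex_halfSpace_gt (LinearMap.isLinear _) _
    exact (convex_ball x δ).inter hc
  have hnf : ∀ s : ℝ, ∀ y ∈ {y | y ∈ Metric.ball x δ ∧ 0 < s * inner ℝ (y - x₀) n},
      y ∉ frontier K := by
    intro s y hy hyf
    have : inner ℝ (y - x₀) n = 0 := hfr y hy.1 hyf
    have h2 := hy.2
    rw [this, mul_zero] at h2
    exact lt_irrefl _ h2
  have hup : ∀ y ∈ Metric.ball x δ, 0 < inner ℝ (y - x₀) n → y ∉ K := by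
    intro y hy hyn
    obtain ⟨t, ht1, ht2, ht3⟩ := (hin.and ((hn.2.2 n (by rw [hnn]; norm_num)).and
      eventually_mem_nhdsWithin)).exists
    have ht3' : (0 : ℝ) < t := ht3
    have hp : x + t • n ∈ {y | y ∈ Metric.ball x δ ∧ 0 < (1 : ℝ) * inner ℝ (y - x₀) n} :=
      ⟨by simpa using ht1 1 (by simp), by rw [hlin, one_mul]; exact ht3'⟩
    exact (subset_or_disjoint_of_disjoint_frontier (hhalf 1) (hnf 1) hp).2 ht2 y
      ⟨hy, by rwa [one_mul]⟩
  have hdown : ∀ y ∈ Metric.ball x δ, inner ℝ (y - x₀) n < 0 → y ∈ K := by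
    intro y hy hyn
    obtain ⟨t, ht1, ht2, ht3⟩ := (hin.and ((hn.2.1 (-n) (by
      rw [inner_neg_left, hnn]; norm_num)).and eventually_mem_nhdsWithin)).exists
    have ht3' : (0 : ℝ) < t := ht3
    have hp : x + t • -n ∈ {y | y ∈ Metric.ball x δ ∧ 0 < (-1 : ℝ) * inner ℝ (y - x₀) n} := by
      refine ⟨by simpa using ht1 (-1) (by simp), ?_⟩
      rw [smul_neg, ← neg_smul, hlin]; linarith
    exact (subset_or_disjoint_of_disjoint_frontier (hhalf (-1)) (hnf (-1)) hp).1 ht2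
      ⟨hy, by linarith⟩
  refine ⟨fun hyK => ?_, hdown y hy⟩
  by_contra! hge
  -- A point of `K` on the hyperplane is impossible: as `K` is open, it would drag points of the
  -- outer half-ball into `K`.
  rcases hge.eq_or_lt with h0 | hpos
  · have hopen : ∀ᶠ t : ℝ in 𝓝 0, y + t • n ∈ K ∩ Metric.ball x δ := by
      have hc : ContinuousAt (fun t : ℝ => y + t • n) 0 := by fun_prop
      exact hc.eventually_mem ((hK.inter Metric.isOpen_ball).mem_nhds (by simpa using ⟨hyK, hy⟩))
    obtain ⟨t, ht1, ht2⟩ := ((hopen.filter_mono nhdsWithin_le_nhds).and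
      (eventually_mem_nhdsWithin (a := (0 : ℝ)) (s := Set.Ioi 0))).exists
    refine hup _ ht1.2 ?_ ht1.1
    rw [add_sub_right_comm, inner_add_left, ← h0, inner_smul_left, hnn]
    simpa using ht2
  · exact hup y hy hpos hyK

theorem mem_closure_of_mem_hyperplane {d : ℕ} {K : Set (Pt d)} {x₀ n : Pt d} (hn : ‖n‖ = 1)
    {U : Set (Pt d)} (hU : IsOpen U) (h : ∀ y ∈ U, y ∈ K ↔ inner ℝ (y - x₀) n < 0) {y : Pt d}
    (hy : y ∈ U) (hyn : y ∈ hyperplane n x₀) : y ∈ closure K := by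
  have hnn : (inner ℝ n n : ℝ) = 1 := by rw [real_inner_self_eq_norm_sq, hn]; norm_num
  have hyn' : inner ℝ (y - x₀) n = 0 := hyn
  have hc : ContinuousAt (fun t : ℝ => y + t • n) 0 := by fun_prop
  have htend : Tendsto (fun t : ℝ => y + t • n) (𝓝[<] 0) (𝓝 y) := by
    have := hc.tendsto
    rw [zero_smul, add_zero] at this
    exact this.mono_left nhdsWithin_le_nhds
  refine mem_closure_of_tendsto htend ?_
  filter_upwards [htend.eventually_mem (hU.mem_nhds hy), self_mem_nhdsWithin] with t ht ht0
  rw [h _ ht, add_sub_right_comm, inner_add_left, hyn', inner_smul_left, hnn]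
  simpa using ht0

theorem hyperplane_neg {d : ℕ} (n x₀ : Pt d) : hyperplane (-n) x₀ = hyperplane n x₀ := by
  ext x; simp [hyperplane]

theorem hyperplane_eq_of_mem {d : ℕ} {n x₀ x₁ : Pt d} (h : x₁ ∈ hyperplane n x₀) :
    hyperplane n x₁ = hyperplane n x₀ := by
  ext x
  have h' : inner ℝ (x₁ - x₀) n = 0 := h
  have : inner ℝ (x - x₀) n = (inner ℝ (x - x₁) n : ℝ) := by
    rw [← sub_add_sub_cancel x x₁ x₀, inner_add_left, h', add_zero]
  simp only [hyperplane, Set.mem_ofPred_eq, this]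

theorem surf_pos_of_inter_ball_subset {m : ℕ} {n x : Pt (m + 1)} (hn : ‖n‖ = 1) {δ : ℝ}
    (hδ : 0 < δ) {F : Set (Pt (m + 1))} (hF : hyperplane n x ∩ Metric.ball x δ ⊆ F) :
    surf (m + 1) F ≠ 0 := by
  obtain ⟨b, rfl⟩ := exists_basis_zero_eq hn
  have h1 : surf (m + 1) (hyperplane (b 0) x ∩ Metric.ball x δ) ≠ 0 := by
    rw [surf_eq_volume b Set.inter_subset_left]
    have : (fun z => x + planeMap b z) ⁻¹' (hyperplane (b 0) x ∩ Metric.ball x δ) =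
        Metric.ball 0 δ := by
      ext z
      simp [hyperplane, inner_planeMap]
    rw [this]
    exact (Metric.measure_ball_pos volume 0 hδ).ne'
  exact fun h0 => h1 (measure_mono_null hF h0)

/-! ### Faces and normals in a mesh -/

namespace Mesh

variable {m : ℕ} {Ω : Set (Pt (m + 1))} (T : Mesh (m + 1) Ω)

theorem mem_intFacesOf {K F : Set (Pt (m + 1))} :
    F ∈ T.intFacesOf K ↔ F ∈ T.intFaces ∧ F ⊆ frontier K := by
  simp [Mesh.intFacesOf]

theorem mem_bdryFacesOf {K F : Set (Pt (m + 1))} :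
    F ∈ T.bdryFacesOf K ↔ F ∈ T.bdryFaces ∧ F ⊆ frontier K := by
  simp [Mesh.bdryFacesOf]

theorem isCompact_of_mem_intFaces {F : Set (Pt (m + 1))} (hF : F ∈ T.intFaces) : IsCompact F := by
  obtain ⟨_, x₀, h⟩ := T.intFace_planar F hF
  exact h.isCompact

theorem isCompact_of_mem_bdryFaces {F : Set (Pt (m + 1))} (hF : F ∈ T.bdryFaces) :
    IsCompact F := by
  obtain ⟨_, _, h⟩ := T.bdryFace_C2 F hF
  exact h.isCompact

/-- A nonempty relative interior contains a disc. Positivity lets statements that hold almost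
everywhere on a face be used at an actual point. -/
theorem surf_intFace_ne_zero {F : Set (Pt (m + 1))} (hF : F ∈ T.intFaces) :
    surf (m + 1) F ≠ 0 := by
  obtain ⟨hn, x₀, h⟩ := T.intFace_planar F hF
  obtain ⟨y, hy⟩ := h.nonempty
  obtain ⟨x, hx⟩ := closure_nonempty_iff.1 ⟨y, h.subset_closure hy⟩
  obtain ⟨δ, hδ, hsub⟩ := Metric.mem_nhdsWithin_iff.1 hx.2
  refine surf_pos_of_inter_ball_subset hn hδ (x := x) ?_
  rw [hyperplane_eq_of_mem (h.subset hx.1), Set.inter_comm]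
  exact hsub

/-- Almost every point of an interior face has a neighbourhood in which the boundary of any cell is
contained in that face. -/
theorem ae_exists_ball {F : Set (Pt (m + 1))} (hF : F ∈ T.intFaces) :
    ∀ᵐ x ∂((surf (m + 1)).restrict F), x ∈ F ∧ ∃ δ > 0, ∀ K ∈ T.cells, ∀ y ∈ Metric.ball x δ,
      y ∈ frontier K → y ∈ F := by
  set A : Set (Set (Pt (m + 1))) := (T.intFaces : Set (Set (Pt (m + 1)))) ∪ T.bdryFaces with hA
  have hAfin : A.Finite := T.intFaces.finite_toSet.union T.bdryFaces.finite_toSet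
  have hAc : ∀ F' ∈ A, IsClosed F' := by
    rintro F' (h | h)
    exacts [(T.isCompact_of_mem_intFaces h).isClosed, (T.isCompact_of_mem_bdryFaces h).isClosed]
  set B : Set (Set (Pt (m + 1))) := {F' ∈ A | F' ≠ F} with hB
  have hBfin : B.Finite := hAfin.subset fun F' h => h.1
  have hae : ∀ᵐ x ∂((surf (m + 1)).restrict F), ∀ F' ∈ B, x ∉ F' := by
    rw [ae_ball_iff hBfin.countable]
    intro F' hF'
    rw [ae_restrict_iff' (T.isCompact_of_mem_intFaces hF).measurableSet, ae_iff]
    refine measure_mono_null ?_ (T.faces_nonoverlapping F (Or.inl hF) F' hF'.1 (Ne.symm hF'.2))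
    intro x hx
    simp only [Set.mem_ofPred_eq] at hx
    push Not at hx
    exact hx
  filter_upwards [hae, ae_restrict_mem (T.isCompact_of_mem_intFaces hF).measurableSet] with x hx hxF
  refine ⟨hxF, ?_⟩
  have hcl : IsClosed (⋃ F' ∈ B, F') := hBfin.isClosed_biUnion fun F' h => hAc F' h.1
  have hxn : x ∈ (⋃ F' ∈ B, F')ᶜ := by
    simp only [Set.mem_compl_iff, Set.mem_iUnion, not_exists]
    exact fun F' h => hx F' h
  obtain ⟨δ, hδ, hsub⟩ := Metric.isOpen_iff.1 hcl.isOpen_compl x hxn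
  refine ⟨δ, hδ, fun K hK y hy hyf => ?_⟩
  rw [T.frontier_eq K hK] at hyf
  simp only [Set.mem_iUnion] at hyf
  obtain ⟨F', hF', hyF'⟩ := hyf
  by_contra hyF
  refine hsub hy (Set.mem_biUnion (x := F') ⟨hF'.1, ?_⟩ hyF')
  rintro rfl
  exact hyF hyF'

theorem exists_mem_of_ae {F : Set (Pt (m + 1))} (hF : F ∈ T.intFaces) {p : Pt (m + 1) → Prop}
    (hp : ∀ᵐ x ∂((surf (m + 1)).restrict F), p x) : ∃ x, p x := by
  have : NeZero ((surf (m + 1)).restrict F) := ⟨by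
    rw [Ne, Measure.restrict_eq_zero]; exact T.surf_intFace_ne_zero hF⟩
  exact hp.exists

/-- Only the two cells sharing `F` have it on their frontier. Near a typical point of `F` these two
fill both half-balls, so a third cell would be confined to the hyperplane, which is impossible for
an open set. Hence the chosen `faceNormal` is meaningful. -/
theorem exists_isFaceNormal {K F : Set (Pt (m + 1))} (hK : K ∈ T.cells)
    (hF : F ∈ T.intFacesOf K) : IsFaceNormal K F (T.normal F) ∨ IsFaceNormal K F (-T.normal F) := by
  obtain ⟨hFi, hFK⟩ := T.mem_intFacesOf.1 hF
  obtain ⟨K₁, hK₁, K₂, hK₂, -, -, -, hn₁, hn₂⟩ := T.intFace_shared F hFi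
  by_cases h1 : K = K₁
  · exact Or.inl (h1 ▸ hn₁)
  by_cases h2 : K = K₂
  · exact Or.inr (h2 ▸ hn₂)
  exfalso
  obtain ⟨hn, x₀, hp⟩ := T.intFace_planar F hFi
  obtain ⟨x, ⟨hxF, δ, hδ, hball⟩, hx1, hx2⟩ :=
    T.exists_mem_of_ae hFi ((T.ae_exists_ball hFi).and (hn₁.and hn₂))
  have hcl : x ∈ closure K := frontier_subset_closure (hFK hxF)
  obtain ⟨y, hyb, hyK⟩ := mem_closure_iff.1 hcl _ Metric.isOpen_ball (Metric.mem_ball_self hδ)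
  have key : ∀ z ∈ Metric.ball x δ, z ∈ K → inner ℝ (z - x₀) (T.normal F) = 0 := by
    intro z hz hzK
    have e1 := inter_ball_eq_halfSpace (T.cell_open _ hK₁) hδ (hp.subset hxF)
      (fun y hy hyf => hp.subset (hball K₁ hK₁ y hy hyf)) hx1 hz
    have e2 := inter_ball_eq_halfSpace (T.cell_open _ hK₂) hδ
      (by rw [hyperplane_neg]; exact hp.subset hxF)
      (fun y hy hyf => by rw [hyperplane_neg]; exact hp.subset (hball K₂ hK₂ y hy hyf)) hx2 hz
    have d1 : z ∉ K₁ := Set.disjoint_left.1 (T.cells_disjoint K hK K₁ hK₁ h1) hzK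
    have d2 : z ∉ K₂ := Set.disjoint_left.1 (T.cells_disjoint K hK K₂ hK₂ h2) hzK
    rw [e1] at d1
    rw [e2, inner_neg_right] at d2
    linarith
  have hnn : (inner ℝ (T.normal F) (T.normal F) : ℝ) = 1 := by
    rw [real_inner_self_eq_norm_sq, hn]; norm_num
  have hopen : ∀ᶠ t : ℝ in 𝓝 0, y + t • T.normal F ∈ K ∩ Metric.ball x δ := by
    have hc : ContinuousAt (fun t : ℝ => y + t • T.normal F) 0 := by fun_prop
    exact hc.eventually_mem (((T.cell_open K hK).inter Metric.isOpen_ball).mem_nhds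
      (by simpa using ⟨hyK, hyb⟩))
  obtain ⟨t, ht1, ht2⟩ := ((hopen.filter_mono nhdsWithin_le_nhds).and
    (eventually_mem_nhdsWithin (a := (0 : ℝ)) (s := Set.Ioi 0))).exists
  have e := key _ ht1.2 ht1.1
  rw [add_sub_right_comm, inner_add_left, key y hyb hyK, inner_smul_left, hnn] at e
  simp only [conj_trivial, mul_one, zero_add] at e
  exact (ne_of_gt ht2) e

theorem isFaceNormal_faceNormal {K F : Set (Pt (m + 1))} (hK : K ∈ T.cells)
    (hF : F ∈ T.intFacesOf K) : IsFaceNormal K F (faceNormal K F) :=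
  Classical.epsilon_spec ((T.exists_isFaceNormal hK hF).elim (fun h => ⟨_, h⟩) fun h => ⟨_, h⟩)

theorem faceNormal_eq {K F : Set (Pt (m + 1))} (hK : K ∈ T.cells) (hF : F ∈ T.intFacesOf K) :
    faceNormal K F = T.normal F ∨ faceNormal K F = -T.normal F := by
  have hFi := (T.mem_intFacesOf.1 hF).1
  have h := T.isFaceNormal_faceNormal hK hF
  rcases T.exists_isFaceNormal hK hF with h' | h'
  · obtain ⟨x, hx, hx'⟩ := T.exists_mem_of_ae hFi (h.and h')
    exact Or.inl (hx.unique hx')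
  · obtain ⟨x, hx, hx'⟩ := T.exists_mem_of_ae hFi (h.and h')
    exact Or.inr (hx.unique hx')

theorem norm_faceNormal {K F : Set (Pt (m + 1))} (hK : K ∈ T.cells) (hF : F ∈ T.intFacesOf K) :
    ‖faceNormal K F‖ = 1 := by
  have hn := (T.intFace_planar F (T.mem_intFacesOf.1 hF).1).1
  rcases T.faceNormal_eq hK hF with h | h <;> simp [h, hn]

theorem hyperplane_faceNormal {K F : Set (Pt (m + 1))} (hK : K ∈ T.cells)
    (hF : F ∈ T.intFacesOf K) (x : Pt (m + 1)) :
    hyperplane (faceNormal K F) x = hyperplane (T.normal F) x := by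
  rcases T.faceNormal_eq hK hF with h | h <;> simp [h, hyperplane_neg]

theorem isBounded_cell (hΩ : Bornology.IsBounded Ω) {K : Set (Pt (m + 1))} (hK : K ∈ T.cells) :
    Bornology.IsBounded K :=
  hΩ.subset (T.cell_subset K hK)

theorem diam_cell_pos (hΩ : Bornology.IsBounded Ω) {K : Set (Pt (m + 1))} (hK : K ∈ T.cells) :
    0 < Metric.diam K := by
  obtain ⟨x, hx⟩ := T.cell_nonempty K hK
  obtain ⟨y, hy, hne⟩ : ∃ y ∈ K, y ≠ x := by
    have := (T.cell_open K hK).mem_nhds hx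
    exact ((infinite_of_mem_nhds x this).nontrivial).exists_ne x
  exact (dist_pos.2 hne).trans_le (Metric.dist_le_diam_of_mem (T.isBounded_cell hΩ hK) hy hx)

theorem subset_closedBall_diam (hΩ : Bornology.IsBounded Ω) {K : Set (Pt (m + 1))}
    (hK : K ∈ T.cells) : ∀ x ∈ K, K ⊆ Metric.closedBall x (Metric.diam K) := fun _ hx _ hy =>
  Metric.dist_le_diam_of_mem (T.isBounded_cell hΩ hK) hy hx

/-- The consequences of shape-regularity that are used in the analysis of the method. -/
theorem ShapeRegular.isStarDecomposable_and_disc {T : Mesh (m + 1) Ω} {ϱ : ℝ} (hϱ : 0 < ϱ)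
    (hT : T.ShapeRegular ϱ) (hΩ : Bornology.IsBounded Ω) {K : Set (Pt (m + 1))} (hK : K ∈ T.cells) :
    IsStarDecomposable K (min ϱ (ϱ * ϱ) * Metric.diam K) ∧ ∀ F ∈ T.intFacesOf K,
      ∃ x, hyperplane (faceNormal K F) x ∩
        Metric.closedBall x (min ϱ (ϱ * ϱ) * Metric.diam K) ⊆ F := by
  have hd := T.diam_cell_pos hΩ hK
  by_cases hb : T.IsBdryCell K
  · have hle : min ϱ (ϱ * ϱ) * Metric.diam K ≤ ϱ * Metric.diam K :=
      mul_le_mul_of_nonneg_right (min_le_left _ _) hd.le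
    constructor
    -- The star-shaped decomposition is postulated per boundary face, so one is needed. Without any,
    -- `∂K ∩ ∂Ω` would lie in the null sets where interior faces meet `∂Ω`.
    · obtain ⟨F, hF⟩ : ∃ F, F ∈ T.bdryFacesOf K := by
        by_contra! hno
        refine hb (measure_mono_null (t := ⋃ F ∈ T.intFaces, (F ∩ frontier Ω)) ?_ ?_)
        · rintro x ⟨hxK, hxΩ⟩
          rw [T.frontier_eq K hK] at hxK
          simp only [Set.mem_iUnion] at hxK ⊢
          obtain ⟨F, ⟨hF | hF, hFK⟩, hxF⟩ := hxK
          · exact ⟨F, hF, hxF, hxΩ⟩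
          · exact absurd (T.mem_bdryFacesOf.2 ⟨hF, hFK⟩) (hno F)
        · exact (measure_biUnion_null_iff T.intFaces.countable_toSet).2 fun F hF =>
            T.intFace_null F hF
      exact IsStarDecomposable.mono (hT.bdry_starShaped K hK hb F hF) hle
    · intro F hF
      obtain ⟨x, hx⟩ := hT.bdry_planar K hK hb F hF
      refine ⟨x, ?_⟩
      rw [T.hyperplane_faceNormal hK hF]
      exact (Set.inter_subset_inter_right _ (Metric.closedBall_subset_closedBall hle)).trans hx
  · obtain ⟨𝒮, hfin, h𝒮⟩ := hT.interior
    obtain ⟨h1, h2, h3⟩ := h𝒮 K hK hb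
    have hball : ∀ s ∈ 𝒮.faces, s.card = m + 1 + 1 →
        convexHull ℝ (s : Set (Pt (m + 1))) ⊆ closure K →
        ∃ x, Metric.closedBall x (min ϱ (ϱ * ϱ) * Metric.diam K) ⊆
          convexHull ℝ (s : Set (Pt (m + 1))) := by
      intro s hs hc hsub
      obtain ⟨h4, x, h5⟩ := h3 s hs hc hsub
      refine ⟨x, (Metric.closedBall_subset_closedBall ?_).trans h5⟩
      -- A simplex contains a ball of radius `ϱ h_S` and `h_S ≥ ϱ h_K`, whence the square of `ϱ`.
      calc min ϱ (ϱ * ϱ) * Metric.diam K ≤ (ϱ * ϱ) * Metric.diam K :=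
            mul_le_mul_of_nonneg_right (min_le_right _ _) hd.le
        _ = ϱ * (ϱ * Metric.diam K) := by ring
        _ ≤ _ := by gcongr
    have hr : 0 < min ϱ (ϱ * ϱ) * Metric.diam K := by positivity
    refine ⟨isStarDecomposable_of_simplices hr (T.cell_regular K hK) hfin h1 hball, ?_⟩
    intro F hF
    obtain ⟨hFi, hFK⟩ := T.mem_intFacesOf.1 hF
    obtain ⟨hn, x₀, hp⟩ := T.intFace_planar F hFi
    obtain ⟨y, hy⟩ := hp.nonempty
    have hy' := hy
    rw [h2 F hF] at hy'
    simp only [Set.mem_iUnion] at hy'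
    obtain ⟨s, ⟨hs, hsc, hsF⟩, -⟩ := hy'
    -- The centroid `c` of a `(d-1)`-simplex of the face lies in some `d`-simplex of the cell, which
    -- therefore has this simplex as a facet and passes its ball on to it as a disc.
    obtain ⟨c, hc, hct⟩ := subset_of_convexHull_inter_subset hs
    have hcK : c ∈ closure K := frontier_subset_closure (hFK (hsF hc))
    rw [h1] at hcK
    simp only [Set.mem_iUnion] at hcK
    obtain ⟨S, ⟨hS, hSc, hSK⟩, hcS⟩ := hcK
    have hsS := hct S hS hcS
    obtain ⟨a, -, rfl⟩ := Finset.exists_eq_insert_iff.2 ⟨hsS, by rw [hsc, hSc]⟩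
    obtain ⟨y, hyb⟩ := hball _ hS hSc hSK
    rw [Finset.coe_insert] at hyb
    obtain ⟨z, hz, hzd⟩ := exists_disc_subset_facet (n := T.normal F) (x₀ := x₀)
      (Finset.coe_nonempty.2 (𝒮.nonempty_of_mem_faces hs)) hn hr
      (fun x hx => hp.subset (hsF (subset_convexHull ℝ _ hx))) hyb
    refine ⟨z, ?_⟩
    rw [T.hyperplane_faceNormal hK hF]
    rintro w ⟨hw, hwb⟩
    exact hsF (hzd w hw (mem_closedBall_iff_norm.1 hwb))

end Mesh

end HHO

namespace HHO

/-! ### The Gauss formula on a cell, up to the boundary of the domain -/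

namespace Mesh

variable {m : ℕ} {Ω : Set (Pt (m + 1))} (T : Mesh (m + 1) Ω)

/-- Around almost every point of an interior face, the cell is a half-space. -/
theorem exists_open_halfSpace {K F : Set (Pt (m + 1))} (hK : K ∈ T.cells)
    (hF : F ∈ T.intFacesOf K) : ∃ (x₀ : Pt (m + 1)) (U : Set (Pt (m + 1))), IsOpen U ∧
      F ⊆ hyperplane (faceNormal K F) x₀ ∧
      (∀ y ∈ U, y ∈ K ↔ inner ℝ (y - x₀) (faceNormal K F) < 0) ∧
      (∀ y ∈ U, y ∈ frontier K ↔ y ∈ F) ∧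
      (∀ y ∈ U, y ∈ hyperplane (faceNormal K F) x₀ → y ∈ F) ∧
      ∀ᵐ y ∂((surf (m + 1)).restrict F), y ∈ U := by
  obtain ⟨hFi, hFK⟩ := T.mem_intFacesOf.1 hF
  obtain ⟨-, x₀, hp⟩ := T.intFace_planar F hFi
  have hsub : F ⊆ hyperplane (faceNormal K F) x₀ := by
    rw [T.hyperplane_faceNormal hK hF]; exact hp.subset
  set n := faceNormal K F with hn
  -- Pairs of a typical point of `F` and an admissible radius; `U` is the union of the corresponding
  -- balls.
  let G : Set (Pt (m + 1) × ℝ) := {q | 0 < q.2 ∧ q.1 ∈ F ∧ IsOutwardNormal K q.1 n ∧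
    ∀ y ∈ Metric.ball q.1 q.2, y ∈ frontier K → y ∈ F}
  have hopen : IsOpen (⋃ q ∈ G, Metric.ball q.1 q.2) :=
    isOpen_biUnion fun q _ => Metric.isOpen_ball
  have hhalf : ∀ y ∈ ⋃ q ∈ G, Metric.ball q.1 q.2, y ∈ K ↔ inner ℝ (y - x₀) n < 0 := by
    intro y hy
    obtain ⟨q, ⟨h1, h2, h3, h4⟩, hyq⟩ := Set.mem_iUnion₂.1 hy
    exact inter_ball_eq_halfSpace (T.cell_open K hK) h1 (hsub h2)
      (fun y hy hyf => hsub (h4 y hy hyf)) h3 hyq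
  have hfr : ∀ y ∈ ⋃ q ∈ G, Metric.ball q.1 q.2, y ∈ frontier K ↔ y ∈ F := by
    intro y hy
    obtain ⟨q, ⟨h1, h2, h3, h4⟩, hyq⟩ := Set.mem_iUnion₂.1 hy
    exact ⟨h4 y hyq, fun h => hFK h⟩
  refine ⟨x₀, ⋃ q ∈ G, Metric.ball q.1 q.2, hopen, hsub, hhalf, hfr, fun y hy hyn => ?_, ?_⟩
  · rw [← hfr y hy, (T.cell_open K hK).frontier_eq]
    refine ⟨mem_closure_of_mem_hyperplane (T.norm_faceNormal hK hF) hopen hhalf hy hyn, ?_⟩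
    rw [hhalf y hy]
    have : inner ℝ (y - x₀) n = 0 := hyn
    rw [this]; exact lt_irrefl _
  · filter_upwards [T.ae_exists_ball hFi, T.isFaceNormal_faceNormal hK hF] with x hx hxn
    obtain ⟨hxF, δ, hδ, hball⟩ := hx
    exact Set.mem_biUnion (x := (x, δ)) ⟨hδ, hxF, hxn, hball K hK⟩ (Metric.mem_ball_self hδ)

/-- Integration by parts for a function that is cut off near an interior face. -/
theorem setIntegral_fderiv_of_eq_zero {K F U : Set (Pt (m + 1))} {x₀ n : Pt (m + 1)} (hn : ‖n‖ = 1)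
    (hK : IsOpen K) (hFn : F ⊆ hyperplane n x₀)
    (hU : ∀ y ∈ U, y ∈ K ↔ inner ℝ (y - x₀) n < 0)
    (hUF : ∀ y ∈ U, y ∈ hyperplane n x₀ → y ∈ F) {f : Pt (m + 1) → ℝ}
    (hf : ContDiff ℝ 1 f) (hc : HasCompactSupport f) (h0 : ∀ y ∉ U, f y = 0)
    (h0' : ∀ y ∉ U, fderiv ℝ f y = 0) (e : Pt (m + 1)) :
    ∫ x in K, fderiv ℝ f x e = inner ℝ e n * ∫ x in F, f x ∂(surf (m + 1)) := by
  obtain ⟨b, rfl⟩ := exists_basis_zero_eq hn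
  -- Inside `U` the hyperplane is contained in `F` and `K` is a half-space; outside `U` the
  -- integrands vanish. Both integrals thus extend to the half-space and its boundary.
  have h1 : ∫ x in F, f x ∂(surf (m + 1)) = ∫ x in hyperplane (b 0) x₀, f x ∂(surf (m + 1)) := by
    refine (setIntegral_eq_of_subset_of_forall_sdiff_eq_zero
      (isClosed_hyperplane _ _).measurableSet hFn fun x hx => h0 x fun hxU => hx.2 ?_).symm
    exact hUF x hxU hx.1
  rw [h1, ← integral_fderiv_halfSpace b hf hc]
  have hm : MeasurableSet {x : Pt (m + 1) | inner ℝ (x - x₀) (b 0) < 0} :=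
    (isOpen_lt (by fun_prop) continuous_const).measurableSet
  rw [← integral_indicator hK.measurableSet, ← integral_indicator hm]
  congr 1
  ext x
  by_cases hx : x ∈ U
  · by_cases hxK : x ∈ K
    · rw [Set.indicator_of_mem hxK,
        Set.indicator_of_mem (show x ∈ {x | inner ℝ (x - x₀) (b 0) < 0} from (hU x hx).1 hxK)]
    · rw [Set.indicator_of_notMem hxK, Set.indicator_of_notMem
        (show x ∉ {x | inner ℝ (x - x₀) (b 0) < 0} from fun h => hxK ((hU x hx).2 h))]
  · simp [Set.indicator, h0' x hx]

/-- Near each interior face `f` is multiplied by a cutoff, for which integration by parts is exact.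
The Gauss inequality is applied to what remains, and as the cutoffs tend to one, the remainder on
the frontier survives only on `∂Ω`. -/
theorem abs_gauss_error_le {C : ℝ}
    (hC : ∀ K : Set (Pt (m + 1)), IsOpen K → Bornology.IsBounded K →
      surf (m + 1) (frontier K) ≠ ⊤ → ∀ f : Pt (m + 1) → ℝ, ContDiff ℝ 1 f → HasCompactSupport f →
      ∀ e : Pt (m + 1), ‖e‖ ≤ 1 →
      |∫ x in K, fderiv ℝ f x e| ≤ C * ∫ x in frontier K, |f x| ∂(surf (m + 1)))
    {K : Set (Pt (m + 1))} (hK : K ∈ T.cells) (hb : Bornology.IsBounded K)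
    (hS : surf (m + 1) (frontier K) ≠ ⊤) {f : Pt (m + 1) → ℝ} (hf : ContDiff ℝ 1 f)
    (hc : HasCompactSupport f) {e : Pt (m + 1)} (he : ‖e‖ ≤ 1) :
    |(∫ x in K, fderiv ℝ f x e) - ∑ F : T.intFacesOf K, inner ℝ e (faceNormal K F) *
      ∫ x in F, f x ∂(surf (m + 1))| ≤
    C * ∫ x in frontier K ∩ frontier Ω, |f x| ∂(surf (m + 1)) := by
  classical
  have hKo := T.cell_open K hK
  choose x₀ U hUo hFn hUK hUf hUF hUae using fun F : T.intFacesOf K =>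
    T.exists_open_halfSpace hK F.2
  choose g hgs hgc hg01 using fun F => (hUo F).exists_contDiff_support_eq (n := 1)
  have hcpt : ∀ F : T.intFacesOf K, IsCompact F.1 := fun F =>
    T.isCompact_of_mem_intFaces (T.mem_intFacesOf.1 F.2).1
  have hFK : ∀ F : T.intFacesOf K, F.1 ⊆ frontier K := fun F => (T.mem_intFacesOf.1 F.2).2
  have hfrm : MeasurableSet (frontier K) := isClosed_frontier.measurableSet
  have hfrb : Bornology.IsBounded (frontier K) := hb.closure.subset frontier_subset_closure
  have hint : ∀ {h : Pt (m + 1) → ℝ}, Continuous h → IntegrableOn h (frontier K) (surf (m + 1)) :=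
    fun hh => integrableOn_of_continuous hfrm hfrb hS hh
  -- The cutoff vanishes off `U F`, and at each point of `U F` it equals one as soon as `k * g F x ≥
  -- 1`.
  let χ : T.intFacesOf K → ℕ → Pt (m + 1) → ℝ := fun F k x => Real.smoothTransition (k * g F x)
  have hg0 : ∀ F x, x ∉ U F → g F x = 0 := fun F x hx => by
    rw [← hgs F] at hx; exact Function.notMem_support.1 hx
  have hgpos : ∀ F x, x ∈ U F → 0 < g F x := fun F x hx => by
    have h1 : g F x ≠ 0 := by rw [← hgs F] at hx; exact hx
    exact lt_of_le_of_ne ((hg01 F ⟨x, rfl⟩).1) h1.symm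
  have hχc : ∀ F k, ContDiff ℝ 1 (χ F k) := fun F k =>
    (Real.smoothTransition.contDiff (n := 1)).comp (contDiff_const.mul ((hgc F).of_le (by simp)))
  have hχ0 : ∀ F k x, x ∉ U F → χ F k x = 0 := fun F k x hx => by
    simp only [χ, hg0 F x hx, mul_zero, Real.smoothTransition.zero]
  have hχnn : ∀ F k x, 0 ≤ χ F k x := fun F k x => Real.smoothTransition.nonneg _
  have hχle : ∀ F k x, χ F k x ≤ 1 := fun F k x => Real.smoothTransition.le_one _
  have hχlim : ∀ F x, x ∈ U F → Tendsto (fun k => χ F k x) atTop (𝓝 1) := fun F x hx => by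
    refine tendsto_const_nhds.congr' ?_
    obtain ⟨N, hN⟩ := exists_nat_ge (g F x)⁻¹
    filter_upwards [eventually_ge_atTop N] with k hk
    refine (Real.smoothTransition.one_of_one_le ?_).symm
    have h1 : (g F x)⁻¹ ≤ k := hN.trans (by exact_mod_cast hk)
    rwa [inv_le_iff_one_le_mul₀ (hgpos F x hx)] at h1
  have hχf : ∀ F k, ContDiff ℝ 1 fun x => χ F k x * f x := fun F k => (hχc F k).mul hf
  have hχfc : ∀ F k, HasCompactSupport fun x => χ F k x * f x := fun F k => hc.mul_left
  -- Off `U F` the cutoff attains its minimum zero, so its derivative vanishes there as well.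
  have hχd : ∀ F k y, y ∉ U F → fderiv ℝ (fun x => χ F k x * f x) y = 0 := by
    intro F k y hy
    have hmin : IsLocalMin (χ F k) y :=
      Eventually.of_forall fun x => by rw [hχ0 F k y hy]; exact hχnn F k x
    rw [fderiv_fun_mul ((hχc F k).differentiable one_ne_zero _)
      (hf.differentiable one_ne_zero _), hmin.fderiv_eq_zero, hχ0 F k y hy]
    simp
  have hface : ∀ F k, ∫ x in K, fderiv ℝ (fun x => χ F k x * f x) x e =
      inner ℝ e (faceNormal K F) * ∫ x in F, χ F k x * f x ∂(surf (m + 1)) := fun F k =>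
    setIntegral_fderiv_of_eq_zero (T.norm_faceNormal hK F.2) hKo (hFn F)
      (hUK F) (hUF F) (hχf F k) (hχfc F k) (fun y hy => by simp [hχ0 F k y hy]) (hχd F k) e
  have hdint : ∀ {h : Pt (m + 1) → ℝ}, ContDiff ℝ 1 h →
      IntegrableOn (fun x => fderiv ℝ h x e) K := fun hh =>
    integrableOn_of_continuous hKo.measurableSet hb hb.measure_lt_top.ne
      ((hh.continuous_fderiv one_ne_zero).clm_apply continuous_const)
  have hstep : ∀ k : ℕ, |(∫ x in K, fderiv ℝ f x e) - ∑ F : T.intFacesOf K,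
      inner ℝ e (faceNormal K F) * ∫ x in F, χ F k x * f x ∂(surf (m + 1))| ≤
      C * ∫ x in frontier K, |(1 - ∑ F, χ F k x) * f x| ∂(surf (m + 1)) := by
    intro k
    have hr : ContDiff ℝ 1 fun x => (1 - ∑ F, χ F k x) * f x :=
      (contDiff_const.sub (ContDiff.sum fun F _ => hχc F k)).mul hf
    have hrc : HasCompactSupport fun x => (1 - ∑ F, χ F k x) * f x := hc.mul_left
    have hfd : ∀ x, fderiv ℝ (fun x => (1 - ∑ F, χ F k x) * f x) x e =
        fderiv ℝ f x e - ∑ F, fderiv ℝ (fun x => χ F k x * f x) x e := by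
      intro x
      have h1 : HasFDerivAt (fun x => f x - ∑ F, χ F k x * f x)
          (fderiv ℝ f x - ∑ F, fderiv ℝ (fun x => χ F k x * f x) x) x :=
        ((hf.differentiable one_ne_zero x).hasFDerivAt).sub
          (HasFDerivAt.fun_sum fun F _ => ((hχf F k).differentiable one_ne_zero x).hasFDerivAt)
      have h2 : (fun x => (1 - ∑ F, χ F k x) * f x) = fun x => f x - ∑ F, χ F k x * f x := by
        funext x; rw [sub_mul, one_mul, Finset.sum_mul]
      rw [h2, h1.fderiv]
      simp
    have := hC K hKo hb hS _ hr hrc e he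
    simp only [hfd] at this
    rw [integral_sub (hdint hf) (integrable_finsetSum _ fun F _ => hdint (hχf F k)),
      integral_finsetSum _ fun F _ => hdint (hχf F k)] at this
    simpa only [hface] using this
  have hlim1 : Tendsto (fun k : ℕ => |(∫ x in K, fderiv ℝ f x e) - ∑ F : T.intFacesOf K,
      inner ℝ e (faceNormal K F) * ∫ x in F, χ F k x * f x ∂(surf (m + 1))|) atTop
      (𝓝 |(∫ x in K, fderiv ℝ f x e) - ∑ F : T.intFacesOf K,
      inner ℝ e (faceNormal K F) * ∫ x in F, f x ∂(surf (m + 1))|) := by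
    refine (tendsto_const_nhds.sub (tendsto_finsetSum _ fun F _ => Tendsto.const_mul _ ?_)).abs
    refine tendsto_integral_of_dominated_convergence (fun x => |f x|)
      (fun k => ((hχf F k).continuous).aestronglyMeasurable)
      ((hint hf.continuous.abs).mono_set (hFK F)) (fun k => Eventually.of_forall fun x => ?_) ?_
    · rw [Real.norm_eq_abs, abs_mul, abs_of_nonneg (hχnn F k x)]
      exact mul_le_of_le_one_left (abs_nonneg _) (hχle F k x)
    · filter_upwards [hUae F] with x hx
      simpa using (hχlim F x hx).mul_const (f x)
  -- Almost every frontier point off `∂Ω` lies on exactly one interior face, whose cutoff tends to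
  -- one while the others vanish; almost everywhere on `∂Ω` all cutoffs vanish.
  have hlim2 : Tendsto (fun k : ℕ => ∫ x in frontier K, |(1 - ∑ F, χ F k x) * f x| ∂(surf (m + 1)))
      atTop (𝓝 (∫ x in frontier K, (frontier Ω).indicator (fun x => |f x|) x ∂(surf (m + 1)))) := by
    have A1 : ∀ᵐ y ∂((surf (m + 1)).restrict (frontier K)), ∀ F : T.intFacesOf K,
        y ∈ F.1 → y ∈ U F := by
      rw [ae_all_iff]
      intro F
      have h1 := (ae_restrict_iff' (hcpt F).measurableSet).1 (hUae F)
      exact ae_restrict_of_ae h1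
    have A2 : ∀ᵐ y ∂((surf (m + 1)).restrict (frontier K)), ∀ F : T.intFacesOf K,
        y ∈ F.1 → y ∉ frontier Ω := by
      rw [ae_all_iff]
      intro F
      refine ae_restrict_of_ae ?_
      rw [ae_iff]
      refine measure_mono_null ?_ (T.intFace_null F (T.mem_intFacesOf.1 F.2).1)
      intro y hy
      simp only [Set.mem_ofPred_eq] at hy
      push Not at hy
      exact hy
    have A3 : ∀ᵐ y ∂((surf (m + 1)).restrict (frontier K)), ∀ F F' : T.intFacesOf K, F ≠ F' →
        y ∈ F.1 → y ∉ F'.1 := by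
      rw [ae_all_iff]
      intro F
      rw [ae_all_iff]
      intro F'
      by_cases hFF : F = F'
      · exact Eventually.of_forall fun y h => absurd hFF h
      refine ae_restrict_of_ae ?_
      rw [ae_iff]
      refine measure_mono_null ?_ (T.faces_nonoverlapping F (Or.inl (T.mem_intFacesOf.1 F.2).1) F'
        (Or.inl (T.mem_intFacesOf.1 F'.2).1) fun h => hFF (Subtype.ext h))
      intro y hy
      simp only [Set.mem_ofPred_eq] at hy
      push Not at hy
      exact hy.2
    refine tendsto_integral_of_dominated_convergence
      (fun x => (1 + Fintype.card (T.intFacesOf K)) * |f x|)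
      (fun k => ((continuous_const.sub (continuous_finsetSum _ fun F _ =>
        (hχc F k).continuous)).mul hf.continuous).abs.aestronglyMeasurable)
      ((hint hf.continuous.abs).const_mul _) (fun k => Eventually.of_forall fun x => ?_) ?_
    · rw [Real.norm_eq_abs, abs_abs, abs_mul]
      refine mul_le_mul_of_nonneg_right ?_ (abs_nonneg _)
      have h1 : ∑ F, χ F k x ≤ Fintype.card (T.intFacesOf K) := by
        refine (Finset.sum_le_sum fun F _ => hχle F k x).trans ?_
        simp
      have h2 : 0 ≤ ∑ F, χ F k x := Finset.sum_nonneg fun F _ => hχnn F k x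
      rw [abs_le]; constructor <;> linarith
    · filter_upwards [A1, A2, A3, ae_restrict_mem hfrm] with y h1 h2 h3 hy
      have hzero : ∀ F k, y ∉ F.1 → χ F k y = 0 := fun F k hyF =>
        hχ0 F k y fun hyU => hyF ((hUf F y hyU).1 hy)
      by_cases hyΩ : y ∈ frontier Ω
      · have h4 : ∀ F k, χ F k y = 0 := fun F k => hzero F k fun hyF => h2 F hyF hyΩ
        simp [hyΩ, h4]
      · obtain ⟨F, hyF⟩ : ∃ F : T.intFacesOf K, y ∈ F.1 := by
          have hy' := hy
          rw [T.frontier_eq K hK] at hy'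
          simp only [Set.mem_iUnion] at hy'
          obtain ⟨F, ⟨hF | hF, hFK'⟩, hyF⟩ := hy'
          · exact ⟨⟨F, T.mem_intFacesOf.2 ⟨hF, hFK'⟩⟩, hyF⟩
          · exact absurd ((T.bdryFace_subset F hF).1 hyF) hyΩ
        have h5 : ∀ k, ∑ F', χ F' k y = χ F k y := fun k =>
          Finset.sum_eq_single F (fun F' _ hne => hzero F' k (h3 F F' hne.symm hyF))
            (fun h => absurd (Finset.mem_univ F) h)
        simp only [h5, Set.indicator_of_notMem hyΩ]
        have h6 := (((hχlim F y (h1 F hyF)).const_sub 1).mul_const (f y)).abs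
        simpa using h6
  have hfin := le_of_tendsto_of_tendsto' hlim1 (hlim2.const_mul C) hstep
  rwa [setIntegral_indicator isClosed_frontier.measurableSet] at hfin

/-- The Gauss formula on a cell for polynomials, up to a term on the boundary of the domain. -/
theorem exists_gauss_error_bound {m : ℕ} (hm : 1 ≤ m) : ∃ C : ℝ, 0 ≤ C ∧
    ∀ (Ω : Set (Pt (m + 1))) (T : Mesh (m + 1) Ω) (K : Set (Pt (m + 1))), K ∈ T.cells →
    Bornology.IsBounded K → surf (m + 1) (frontier K) ≠ ⊤ →
    ∀ (p : MvPolynomial (Fin (m + 1)) ℝ) (e : Pt (m + 1)), ‖e‖ ≤ 1 →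
    |(∫ x in K, inner ℝ (grad p x) e) - ∑ F : T.intFacesOf K, inner ℝ e (faceNormal K F) *
      ∫ x in F, ev p x ∂(surf (m + 1))| ≤
    C * ∫ x in frontier K ∩ frontier Ω, |ev p x| ∂(surf (m + 1)) := by
  obtain ⟨C, hC0, hC⟩ := exists_gauss_bound hm
  refine ⟨C, hC0, fun Ω T K hK hb hS p e he => ?_⟩
  obtain ⟨r, hr⟩ := hb.subset_closedBall 0
  -- A bump equal to one near `closure K` makes the polynomial compactly supported without changing
  -- any of the integrals.
  let β : ContDiffBump (0 : Pt (m + 1)) := ⟨max r 0 + 1, max r 0 + 2, by positivity, by linarith⟩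
  have hin : ∀ x ∈ closure K, x ∈ Metric.ball (0 : Pt (m + 1)) β.rIn := by
    intro x hx
    have := closure_minimal hr Metric.isClosed_closedBall hx
    rw [mem_closedBall_zero_iff] at this
    rw [mem_ball_zero_iff]
    exact this.trans_lt (lt_of_le_of_lt (le_max_left r 0) (lt_add_one _))
  have hval : ∀ x ∈ closure K, β x * ev p x = ev p x := fun x hx => by
    rw [β.one_of_mem_closedBall (Metric.ball_subset_closedBall (hin x hx)), one_mul]
  have hder : ∀ x ∈ K, fderiv ℝ (fun x => β x * ev p x) x e = inner ℝ (grad p x) e := by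
    intro x hx
    have : (fun x => β x * ev p x) =ᶠ[𝓝 x] ev p := by
      filter_upwards [Metric.isOpen_ball.mem_nhds (hin x (subset_closure hx))] with y hy
      rw [β.one_of_mem_closedBall (Metric.ball_subset_closedBall hy), one_mul]
    rw [this.fderiv_eq, fderiv_ev_apply]
  have hmain := T.abs_gauss_error_le hC hK hb hS (f := fun x => β x * ev p x)
    (β.contDiff.mul (contDiff_ev p)) β.hasCompactSupport.mul_right he
  rw [setIntegral_congr_fun (T.cell_open K hK).measurableSet hder] at hmain
  have h1 : ∀ F : T.intFacesOf K, ∫ x in F.1, β x * ev p x ∂(surf (m + 1)) =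
      ∫ x in F.1, ev p x ∂(surf (m + 1)) := fun F =>
    setIntegral_congr_fun
      (T.isCompact_of_mem_intFaces (T.mem_intFacesOf.1 F.2).1).measurableSet
      fun x hx => hval x (frontier_subset_closure ((T.mem_intFacesOf.1 F.2).2 hx))
  have h2 : ∫ x in frontier K ∩ frontier Ω, |β x * ev p x| ∂(surf (m + 1)) =
      ∫ x in frontier K ∩ frontier Ω, |ev p x| ∂(surf (m + 1)) :=
    setIntegral_congr_fun (isClosed_frontier.inter isClosed_frontier).measurableSet
      fun x hx => congrArg abs (hval x (frontier_subset_closure hx.1))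
  rw [h2] at hmain
  simpa only [h1] using hmain

end Mesh

end HHO

namespace HHO

/-! ### Discrete trace and inverse inequalities on a cell -/

/-- The polynomial `t ↦ ∫ (f - t g)²` is nonnegative, so its discriminant is nonpositive. -/
theorem sq_integral_mul_le {α : Type*} [MeasurableSpace α] {μ : Measure α} {f g : α → ℝ}
    (hf : Integrable (fun x => f x ^ 2) μ) (hg : Integrable (fun x => g x ^ 2) μ)
    (hfg : Integrable (fun x => f x * g x) μ) :
    (∫ x, f x * g x ∂μ) ^ 2 ≤ (∫ x, f x ^ 2 ∂μ) * ∫ x, g x ^ 2 ∂μ := by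
  have h : ∀ t : ℝ, 0 ≤ (∫ x, g x ^ 2 ∂μ) * (t * t) + (-2 * ∫ x, f x * g x ∂μ) * t +
      ∫ x, f x ^ 2 ∂μ := by
    intro t
    have h1 : 0 ≤ ∫ x, (f x - t * g x) ^ 2 ∂μ := integral_nonneg fun x => sq_nonneg _
    have h2 : ∀ x, (f x - t * g x) ^ 2 = f x ^ 2 - 2 * t * (f x * g x) + t * t * g x ^ 2 :=
      fun x => by ring
    simp only [h2] at h1
    have hi : Integrable (fun x => f x ^ 2 - 2 * t * (f x * g x)) μ := hf.sub (hfg.const_mul _)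
    rw [integral_add hi (hg.const_mul _), integral_sub hf (hfg.const_mul _), integral_const_mul,
      integral_const_mul] at h1
    linarith
  have := discrim_le_zero h
  rw [discrim] at this
  nlinarith

theorem sq_setIntegral_le {d : ℕ} {μ : Measure (Pt d)} {F : Set (Pt d)} (hF : MeasurableSet F)
    (hb : Bornology.IsBounded F) (hμ : μ F ≠ ⊤) {g a : Pt d → ℝ} (hg : Continuous g)
    (ha : Continuous a) {X : ℝ} (hX : ∀ x ∈ F, g x ^ 2 ≤ X * a x ^ 2) :
    (∫ x in F, g x ∂μ) ^ 2 ≤ X * (μ F).toReal * ∫ x in F, a x ^ 2 ∂μ := by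
  have hi : ∀ {f : Pt d → ℝ}, Continuous f → IntegrableOn f F μ := fun hf =>
    integrableOn_of_continuous hF hb hμ hf
  have h1 := sq_integral_mul_le (μ := μ.restrict F) (f := g) (g := fun _ => 1) (hi (hg.pow 2))
    (hi (by fun_prop)) (hi (by fun_prop))
  have h2 : ∫ x in F, g x ^ 2 ∂μ ≤ X * ∫ x in F, a x ^ 2 ∂μ := by
    rw [← integral_const_mul]
    exact setIntegral_mono_on (hi (hg.pow 2)) (hi (by fun_prop)) hF hX
  simp only [mul_one, one_pow, integral_const, smul_eq_mul, Measure.real,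
    Measure.restrict_apply_univ] at h1
  calc (∫ x in F, g x ∂μ) ^ 2 ≤ (∫ x in F, g x ^ 2 ∂μ) * (μ F).toReal := h1
    _ ≤ (X * ∫ x in F, a x ^ 2 ∂μ) * (μ F).toReal :=
        mul_le_mul_of_nonneg_right h2 ENNReal.toReal_nonneg
    _ = _ := by ring

variable {m : ℕ} {Ω : Set (Pt (m + 1))}

/-- Discrete trace and inverse inequalities on a cell `K` of size `h`, for polynomials of degree at
most `l`, and a Green formula up to a term on the boundary of the domain. -/
structure CellBounds (T : Mesh (m + 1) Ω) (K : Set (Pt (m + 1))) (l : ℕ) (C h : ℝ)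
    (c : Pt (m + 1)) : Prop where
  mem_cells : K ∈ T.cells
  isBounded : Bornology.IsBounded K
  pos : 0 < h
  one_le : 1 ≤ C
  closure_subset : closure K ⊆ Metric.closedBall c h
  surf_le : surf (m + 1) (frontier K) ≤ ENNReal.ofReal (C * h ^ m)
  sup_le : ∀ p ∈ Poly (m + 1) l, ∀ x ∈ Metric.closedBall c h,
    ev p x ^ 2 ≤ C * h⁻¹ ^ (m + 1) * ∫ x in K, ev p x ^ 2
  sup_grad_le : ∀ p ∈ Poly (m + 1) l, ∀ x ∈ Metric.closedBall c h,
    ‖grad p x‖ ^ 2 ≤ C * h⁻¹ ^ (m + 3) * ∫ x in K, ev p x ^ 2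
  face_inverse : ∀ p ∈ Poly (m + 1) l, ∀ F ∈ T.intFacesOf K,
    ∫ x in F, ‖dt (faceNormal K F) p x‖ ^ 2 ∂(surf (m + 1)) ≤
      C * h⁻¹ ^ 2 * ∫ x in F, ev p x ^ 2 ∂(surf (m + 1))
  green : ∀ (v w : MvPolynomial (Fin (m + 1)) ℝ) (X : ℝ), 0 ≤ X →
    (∀ x ∈ frontier K ∩ frontier Ω, ‖grad w x‖ ^ 2 ≤ X) →
    ((∫ x in K, inner ℝ (grad v x) (grad w x)) + (∫ x in K, ev v x * ev (lap w) x) -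
      ∑ F : T.intFacesOf K, ∫ x in F, ev v x * dn (faceNormal K F) w x ∂(surf (m + 1))) ^ 2 ≤
    C * X * h ^ m * ∫ x in frontier K ∩ frontier Ω, ev v x ^ 2 ∂(surf (m + 1))

theorem sq_le_of_sq_sq_le {a b : ℝ} (hb : 0 ≤ b) (h : (a ^ 2) ^ 2 ≤ b * a ^ 2) :
    a ^ 2 ≤ b := by
  rcases eq_or_lt_of_le (sq_nonneg a) with h0 | hpos
  · rw [← h0]; exact hb
  · rw [sq (a ^ 2)] at h
    exact le_of_mul_le_mul_right h hpos

theorem continuous_dn (n : Pt (m + 1)) (p : MvPolynomial (Fin (m + 1)) ℝ) : Continuous (dn n p) :=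
  (continuous_grad p).inner continuous_const

theorem continuous_dt (n : Pt (m + 1)) (p : MvPolynomial (Fin (m + 1)) ℝ) : Continuous (dt n p) :=
  (continuous_grad p).sub ((continuous_dn n p).smul continuous_const)

theorem inner_dt_normal {n : Pt (m + 1)} (hn : ‖n‖ = 1) (p : MvPolynomial (Fin (m + 1)) ℝ)
    (x : Pt (m + 1)) : inner ℝ (dt n p x) n = 0 := by
  simp [dt, inner_sub_left, inner_smul_left, hn, dn]

theorem inner_grad_dt {n : Pt (m + 1)} (hn : ‖n‖ = 1) (p : MvPolynomial (Fin (m + 1)) ℝ)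
    (x : Pt (m + 1)) : inner ℝ (grad p x) (dt n p x) = ‖dt n p x‖ ^ 2 := by
  have h : grad p x = dt n p x + dn n p x • n := by simp [dt]
  conv_lhs => rw [h]
  rw [inner_add_left, inner_smul_left, real_inner_comm (dt n p x) n, inner_dt_normal hn,
    real_inner_self_eq_norm_sq]
  simp

theorem dn_eq_sum (n : Pt (m + 1)) (p : MvPolynomial (Fin (m + 1)) ℝ) (x : Pt (m + 1)) :
    dn n p x = ∑ i, n i * ev (MvPolynomial.pderiv i p) x := by
  simp [dn, PiLp.inner_apply]

theorem inner_grad_eq_sum (v w : MvPolynomial (Fin (m + 1)) ℝ) (x : Pt (m + 1)) :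
    inner ℝ (grad v x) (grad w x) =
      ∑ i, ev (MvPolynomial.pderiv i v) x * ev (MvPolynomial.pderiv i w) x := by
  simp [PiLp.inner_apply, mul_comm]

theorem norm_grad_sq (w : MvPolynomial (Fin (m + 1)) ℝ) (x : Pt (m + 1)) :
    ‖grad w x‖ ^ 2 = ∑ i, ev (MvPolynomial.pderiv i w) x ^ 2 := by
  rw [EuclideanSpace.norm_sq_eq]; simp

/-- Norm equivalence between two concentric balls of comparable radii. As the larger one will
contain the closure of the cell, these pointwise bounds also serve as trace inequalities, whatever
the regularity of the boundary. -/
theorem exists_sup_bounds (m l : ℕ) {ρ : ℝ} (hρ : 0 < ρ) : ∃ C : ℝ, 0 ≤ C ∧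
    ∀ (K : Set (Pt (m + 1))) (c : Pt (m + 1)) (h : ℝ), IsOpen K → Bornology.IsBounded K → 0 < h →
      Metric.ball c (ρ * h) ⊆ K → ∀ p ∈ Poly (m + 1) l, ∀ x ∈ Metric.closedBall c h,
      ev p x ^ 2 ≤ C * h⁻¹ ^ (m + 1) * ∫ x in K, ev p x ^ 2 ∧
      ‖grad p x‖ ^ 2 ≤ C * h⁻¹ ^ (m + 3) * ∫ x in K, ev p x ^ 2 := by
  obtain ⟨C, hC0, hC⟩ := exists_ball_bound (m + 1) l hρ
  refine ⟨C, hC0, fun K c h hK hb hh hball p hp x hx => ?_⟩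
  have hy : x - c ∈ Metric.closedBall (0 : Pt (m + 1)) h := by
    rw [mem_closedBall_zero_iff]; exact mem_closedBall_iff_norm.1 hx
  obtain ⟨h1, h2⟩ := hC (m + 1) p hp LinearIsometry.id c h hh (x - c) hy
  simp only [LinearIsometry.id_apply, add_sub_cancel] at h1 h2
  have hle : ∫ z in Metric.ball (0 : Pt (m + 1)) (ρ * h), ev p (c + z) ^ 2 ≤
      ∫ x in K, ev p x ^ 2 := by
    have e1 := (measurePreserving_add_left volume c).setIntegral_preimage_emb
      (MeasurableEquiv.addLeft c).measurableEmbedding (fun x => ev p x ^ 2)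
      (Metric.ball c (ρ * h))
    have e2 : (fun x => c + x) ⁻¹' Metric.ball c (ρ * h) = Metric.ball 0 (ρ * h) := by
      ext z; simp
    rw [e2] at e1
    rw [e1]
    exact setIntegral_mono_set (integrableOn_of_continuous hK.measurableSet hb
      hb.measure_lt_top.ne ((continuous_ev p).pow 2))
      (Eventually.of_forall fun x => sq_nonneg _) hball.eventuallyLE
  constructor
  · refine h1.trans ?_
    rw [mul_assoc]
    gcongr
  -- The directional bound is tested with the direction `∇p` itself; one factor `‖∇p‖²` then
  -- cancels.
  · have h3 := h2 (grad p x)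
    rw [real_inner_self_eq_norm_sq] at h3
    refine (sq_le_of_sq_sq_le (b := C * (h⁻¹ ^ (m + 1 + 2) *
      ∫ z in Metric.ball (0 : Pt (m + 1)) (ρ * h), ev p (c + z) ^ 2)) ?_ ?_).trans ?_
    · have : 0 ≤ ∫ z in Metric.ball (0 : Pt (m + 1)) (ρ * h), ev p (c + z) ^ 2 :=
        integral_nonneg fun _ => sq_nonneg _
      positivity
    · refine h3.trans (le_of_eq (by ring))
    · rw [← mul_assoc]
      exact mul_le_mul_of_nonneg_left hle (by positivity)

/-- The tangential gradient is bounded pointwise on `F` by the `L²` norm over the disc; integrating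
over a face of surface at most `A h^m` turns `h⁻¹ ^ (m + 2)` into `h⁻¹ ^ 2`. -/
theorem exists_face_inverse (m l : ℕ) {ρ : ℝ} (hρ : 0 < ρ) : ∃ C : ℝ, 0 ≤ C ∧
    ∀ (F : Set (Pt (m + 1))) (n x : Pt (m + 1)) (h A : ℝ), ‖n‖ = 1 → 0 < h → 0 ≤ A →
      F ⊆ hyperplane n x → IsCompact F → hyperplane n x ∩ Metric.closedBall x (ρ * h) ⊆ F →
      F ⊆ Metric.closedBall x h → surf (m + 1) F ≤ ENNReal.ofReal (A * h ^ m) →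
      ∀ p ∈ Poly (m + 1) l, ∫ x in F, ‖dt n p x‖ ^ 2 ∂(surf (m + 1)) ≤
        C * A * h⁻¹ ^ 2 * ∫ x in F, ev p x ^ 2 ∂(surf (m + 1)) := by
  obtain ⟨C, hC0, hC⟩ := exists_ball_bound m l hρ
  refine ⟨C, hC0, fun F n x h A hn hh hA hFn hFc hdisc hFh hFs p hp => ?_⟩
  obtain ⟨b, rfl⟩ := exists_basis_zero_eq hn
  have hFt : surf (m + 1) F ≠ ⊤ := (hFs.trans_lt ENNReal.ofReal_lt_top).ne
  have hcont := (isometry_planeMap b x).continuous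
  set I := ∫ x in F, ev p x ^ 2 ∂(surf (m + 1)) with hI
  have hI0 : 0 ≤ I := integral_nonneg fun _ => sq_nonneg _
  have hle : ∫ z in Metric.ball (0 : Pt m) (ρ * h), ev p (x + planeMap b z) ^ 2 ≤ I := by
    rw [hI, setIntegral_surf b hFn]
    have hpre : Metric.ball (0 : Pt m) (ρ * h) ⊆ (fun z => x + planeMap b z) ⁻¹' F := by
      intro z hz
      refine hdisc ⟨?_, ?_⟩
      · rw [← range_planeMap]; exact ⟨z, rfl⟩
      · rw [mem_closedBall_iff_norm, add_sub_cancel_left, LinearIsometry.norm_map]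
        exact (mem_ball_zero_iff.1 hz).le
    refine setIntegral_mono_set ?_ (Eventually.of_forall fun x => sq_nonneg _) hpre.eventuallyLE
    have hb : Bornology.IsBounded ((fun z => x + planeMap b z) ⁻¹' F) :=
      (isometry_planeMap b x).antilipschitz.isBounded_preimage hFc.isBounded
    exact integrableOn_of_continuous (hFc.isClosed.preimage hcont).measurableSet hb
      hb.measure_lt_top.ne (((continuous_ev p).comp hcont).pow 2)
  have hsup : ∀ y ∈ F, ‖dt (b 0) p y‖ ^ 2 ≤ C * h⁻¹ ^ (m + 2) * I := by
    intro y hy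
    obtain ⟨z, rfl⟩ : y ∈ Set.range fun z => x + planeMap b z := by
      rw [range_planeMap]; exact hFn hy
    have hz : z ∈ Metric.closedBall (0 : Pt m) h := by
      have := hFh hy
      rw [mem_closedBall_iff_norm, add_sub_cancel_left, LinearIsometry.norm_map] at this
      rwa [mem_closedBall_zero_iff]
    obtain ⟨u, hu⟩ := exists_planeMap_eq b (inner_dt_normal hn p (x + planeMap b z))
    have h1 := (hC (m + 1) p hp (planeMap b) x h hh z hz).2 u
    rw [hu, inner_grad_dt hn, ← LinearIsometry.norm_map (planeMap b) u, hu] at h1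
    refine sq_le_of_sq_sq_le (by positivity) (h1.trans ?_)
    rw [mul_right_comm, ← mul_assoc]
    gcongr
  calc ∫ y in F, ‖dt (b 0) p y‖ ^ 2 ∂(surf (m + 1))
      ≤ ∫ y in F, C * h⁻¹ ^ (m + 2) * I ∂(surf (m + 1)) :=
        setIntegral_mono_on (integrableOn_of_continuous hFc.measurableSet hFc.isBounded hFt
          ((continuous_dt _ p).norm.pow 2)) (integrableOn_const hFt) hFc.measurableSet hsup
    _ = (surf (m + 1) F).toReal * (C * h⁻¹ ^ (m + 2) * I) := by simp [Measure.real]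
    _ ≤ (A * h ^ m) * (C * h⁻¹ ^ (m + 2) * I) :=
        mul_le_mul_of_nonneg_right (ENNReal.toReal_le_of_le_ofReal (by positivity) hFs)
          (by positivity)
    _ = C * A * h⁻¹ ^ 2 * I := by
        have : h ^ m * h⁻¹ ^ m = 1 := by rw [← mul_pow, mul_inv_cancel₀ hh.ne', one_pow]
        calc A * h ^ m * (C * h⁻¹ ^ (m + 2) * I) =
            C * A * h⁻¹ ^ 2 * I * (h ^ m * h⁻¹ ^ m) := by ring
          _ = _ := by rw [this, mul_one]

/-- The Gauss formula is applied to `v ∂ᵢw` in the direction `eᵢ` and summed over `i`, followed by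
Cauchy–Schwarz on `∂K ∩ ∂Ω`. The sum of `m + 1` errors, once squared, gives `(m + 1)²`. -/
theorem green_error_le {T : Mesh (m + 1) Ω} {K : Set (Pt (m + 1))} {C s : ℝ}
    (hK : K ∈ T.cells) (hb : Bornology.IsBounded K) (hs0 : 0 ≤ s)
    (hs : surf (m + 1) (frontier K) ≤ ENNReal.ofReal s)
    (hC : ∀ (p : MvPolynomial (Fin (m + 1)) ℝ) (e : Pt (m + 1)), ‖e‖ ≤ 1 →
      |(∫ x in K, inner ℝ (grad p x) e) - ∑ F : T.intFacesOf K, inner ℝ e (faceNormal K F) *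
        ∫ x in F, ev p x ∂(surf (m + 1))| ≤
      C * ∫ x in frontier K ∩ frontier Ω, |ev p x| ∂(surf (m + 1)))
    (v w : MvPolynomial (Fin (m + 1)) ℝ) {X : ℝ} (hX0 : 0 ≤ X)
    (hX : ∀ x ∈ frontier K ∩ frontier Ω, ‖grad w x‖ ^ 2 ≤ X) :
    ((∫ x in K, inner ℝ (grad v x) (grad w x)) + (∫ x in K, ev v x * ev (lap w) x) -
      ∑ F : T.intFacesOf K, ∫ x in F, ev v x * dn (faceNormal K F) w x ∂(surf (m + 1))) ^ 2 ≤
    ((m + 1) ^ 2 * C ^ 2) * X * s *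
      ∫ x in frontier K ∩ frontier Ω, ev v x ^ 2 ∂(surf (m + 1)) := by
  have hKi : ∀ {f : Pt (m + 1) → ℝ}, Continuous f → IntegrableOn f K := fun hf =>
    integrableOn_of_continuous (T.cell_open K hK).measurableSet hb hb.measure_lt_top.ne hf
  have hfrt : surf (m + 1) (frontier K) ≠ ⊤ := (hs.trans_lt ENNReal.ofReal_lt_top).ne
  have hfrb : Bornology.IsBounded (frontier K) := hb.closure.subset frontier_subset_closure
  have hFi : ∀ (F : T.intFacesOf K) {f : Pt (m + 1) → ℝ}, Continuous f →
      IntegrableOn f F (surf (m + 1)) := fun F f hf => by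
    have hFK := (T.mem_intFacesOf.1 F.2).2
    exact integrableOn_of_continuous
      (T.isCompact_of_mem_intFaces (T.mem_intFacesOf.1 F.2).1).measurableSet
      (hfrb.subset hFK) (measure_ne_top_of_subset hFK hfrt) hf
  set p : Fin (m + 1) → MvPolynomial (Fin (m + 1)) ℝ := fun i => v * MvPolynomial.pderiv i w with hp
  set E : Fin (m + 1) → ℝ := fun i =>
    (∫ x in K, inner ℝ (grad (p i) x) (EuclideanSpace.single i 1)) -
    ∑ F : T.intFacesOf K, inner ℝ (EuclideanSpace.single i 1) (faceNormal K F) *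
      ∫ x in F, ev (p i) x ∂(surf (m + 1)) with hE
  set B := ∫ x in frontier K ∩ frontier Ω, ev v x ^ 2 ∂(surf (m + 1)) with hB
  have hB0 : 0 ≤ B := integral_nonneg fun _ => sq_nonneg _
  have hEi : ∀ i, E i ^ 2 ≤ C ^ 2 * (X * s * B) := by
    intro i
    have h1 := hC (p i) (EuclideanSpace.single i 1) (by simp)
    have hsub : frontier K ∩ frontier Ω ⊆ frontier K := Set.inter_subset_left
    have hm : MeasurableSet (frontier K ∩ frontier Ω) :=
      (isClosed_frontier.inter isClosed_frontier).measurableSet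
    have h2 := sq_setIntegral_le hm (hfrb.subset hsub) (measure_ne_top_of_subset hsub hfrt)
      (g := fun x => |ev (p i) x|) (a := ev v) (continuous_ev _).abs (continuous_ev _) (X := X)
      (fun x hx => by
        rw [sq_abs, hp, ev_mul, mul_pow, mul_comm]
        refine mul_le_mul_of_nonneg_right (le_trans ?_ (hX x hx)) (sq_nonneg _)
        rw [norm_grad_sq]
        exact Finset.single_le_sum (f := fun i => ev (MvPolynomial.pderiv i w) x ^ 2)
          (fun _ _ => sq_nonneg _) (Finset.mem_univ i))
    have h3 : (surf (m + 1) (frontier K ∩ frontier Ω)).toReal ≤ s :=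
      ENNReal.toReal_le_of_le_ofReal hs0 ((measure_mono hsub).trans hs)
    calc E i ^ 2 = |E i| ^ 2 := (sq_abs _).symm
      _ ≤ (C * ∫ x in frontier K ∩ frontier Ω, |ev (p i) x| ∂(surf (m + 1))) ^ 2 :=
          pow_le_pow_left₀ (abs_nonneg _) h1 2
      _ = C ^ 2 * (∫ x in frontier K ∩ frontier Ω, |ev (p i) x| ∂(surf (m + 1))) ^ 2 := by ring
      _ ≤ C ^ 2 * (X * s * B) := by
          refine mul_le_mul_of_nonneg_left (h2.trans ?_) (sq_nonneg _)
          gcongr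
  have hsum : (∫ x in K, inner ℝ (grad v x) (grad w x)) + (∫ x in K, ev v x * ev (lap w) x) -
      ∑ F : T.intFacesOf K, ∫ x in F, ev v x * dn (faceNormal K F) w x ∂(surf (m + 1)) =
      ∑ i, E i := by
    have h1 : (∫ x in K, inner ℝ (grad v x) (grad w x)) + (∫ x in K, ev v x * ev (lap w) x) =
        ∑ i, ∫ x in K, inner ℝ (grad (p i) x) (EuclideanSpace.single i 1) := by
      have i1 : IntegrableOn (fun x => (inner ℝ (grad v x) (grad w x) : ℝ)) K :=
        hKi ((continuous_grad v).inner (continuous_grad w))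
      have i2 : IntegrableOn (fun x => ev v x * ev (lap w) x) K :=
        hKi ((continuous_ev v).mul (continuous_ev _))
      have i3 : ∀ i, IntegrableOn
          (fun x => (inner ℝ (grad (p i) x) (EuclideanSpace.single i 1) : ℝ)) K := fun i =>
        hKi ((continuous_grad (p i)).inner continuous_const)
      rw [← integral_add i1 i2, ← integral_finsetSum _ fun i _ => i3 i]
      congr 1
      ext x
      rw [inner_grad_eq_sum, lap, ev_sum, Finset.mul_sum, ← Finset.sum_add_distrib]
      refine Finset.sum_congr rfl fun i _ => ?_
      rw [real_inner_comm, EuclideanSpace.inner_single_left, grad_apply]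
      simp [hp, Derivation.leibniz]
      ring
    have h2 : ∀ F : T.intFacesOf K, ∫ x in F, ev v x * dn (faceNormal K F) w x ∂(surf (m + 1)) =
        ∑ i, inner ℝ (EuclideanSpace.single i 1) (faceNormal K F) *
          ∫ x in F, ev (p i) x ∂(surf (m + 1)) := by
      intro F
      simp only [← integral_const_mul]
      have i1 : ∀ i, IntegrableOn (fun x => (inner ℝ (EuclideanSpace.single i 1)
          (faceNormal K F) : ℝ) * ev (p i) x) F (surf (m + 1)) := fun i =>
        hFi F (continuous_const.mul (continuous_ev _))
      rw [← integral_finsetSum _ fun i _ => i1 i]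
      congr 1
      ext x
      rw [dn_eq_sum, Finset.mul_sum]
      refine Finset.sum_congr rfl fun i _ => ?_
      rw [EuclideanSpace.inner_single_left]
      simp [hp]
      ring
    rw [h1, Finset.sum_congr rfl fun F _ => h2 F, Finset.sum_comm, ← Finset.sum_sub_distrib]
  rw [hsum]
  calc (∑ i, E i) ^ 2 ≤ (Finset.univ : Finset (Fin (m + 1))).card * ∑ i, E i ^ 2 :=
        sq_sum_le_card_mul_sum_sq
    _ ≤ (m + 1) * ∑ i : Fin (m + 1), C ^ 2 * (X * s * B) := by
        simp only [Finset.card_univ, Fintype.card_fin, Nat.cast_add, Nat.cast_one]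
        exact mul_le_mul_of_nonneg_left (Finset.sum_le_sum fun i _ => hEi i) (by positivity)
    _ = _ := by simp; ring

theorem exists_cellBounds {m : ℕ} (hm : 1 ≤ m) (l : ℕ) {ϱ : ℝ} (hϱ : 0 < ϱ) :
    ∃ C : ℝ, 0 ≤ C ∧ ∀ (Ω : Set (Pt (m + 1))), Bornology.IsBounded Ω →
      ∀ T : Mesh (m + 1) Ω, T.ShapeRegular ϱ → ∀ K ∈ T.cells,
        ∃ c ∈ K, CellBounds T K l C (Metric.diam K) c := by
  set ρ := min ϱ (ϱ * ϱ) with hρ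
  have hρ0 : 0 < ρ := lt_min hϱ (mul_pos hϱ hϱ)
  obtain ⟨C₁, h10, hC₁⟩ := exists_surf_frontier_le m hρ0
  obtain ⟨C₂, h20, hC₂⟩ := exists_sup_bounds m l hρ0
  obtain ⟨C₃, h30, hC₃⟩ := exists_face_inverse m l hρ0
  obtain ⟨C₄, h40, hC₄⟩ := Mesh.exists_gauss_error_bound hm
  set D := ((m : ℝ) + 1) ^ 2 * C₄ ^ 2 with hD
  have hD0 : 0 ≤ D := by positivity
  -- Each summand serves one of the bounds; the leading `1` ensures `1 ≤ C`, so that powers of `C`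
  -- can be compared.
  refine ⟨1 + C₁ + C₂ + C₃ * C₁ + D * C₁, by positivity, fun Ω hΩ T hT K hK => ?_⟩
  have hb := T.isBounded_cell hΩ hK
  have hd := T.diam_cell_pos hΩ hK
  set h := Metric.diam K with hh
  obtain ⟨hdec, hdisc⟩ := Mesh.ShapeRegular.isStarDecomposable_and_disc hϱ hT hΩ hK
  obtain ⟨c, hc⟩ := hdec.exists_ball (T.cell_nonempty K hK)
  have hcK : c ∈ K := hc (Metric.mem_ball_self (by positivity))
  have hs := hC₁ K h (T.cell_open K hK) hd (T.subset_closedBall_diam hΩ hK) hdec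
  have hP : 0 ≤ C₃ * C₁ ∧ 0 ≤ D * C₁ := ⟨by positivity, by positivity⟩
  refine ⟨c, hcK, hK, hb, hd, by linarith, ?_, ?_, ?_, ?_, ?_, ?_⟩
  · exact closure_minimal (T.subset_closedBall_diam hΩ hK c hcK) Metric.isClosed_closedBall
  · refine hs.trans (ENNReal.ofReal_le_ofReal (mul_le_mul_of_nonneg_right ?_ (by positivity)))
    linarith
  · intro p hp x hx
    refine (hC₂ K c h (T.cell_open K hK) hb hd hc p hp x hx).1.trans ?_
    have : 0 ≤ ∫ x in K, ev p x ^ 2 := integral_nonneg fun _ => sq_nonneg _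
    gcongr
    linarith
  · intro p hp x hx
    refine (hC₂ K c h (T.cell_open K hK) hb hd hc p hp x hx).2.trans ?_
    have : 0 ≤ ∫ x in K, ev p x ^ 2 := integral_nonneg fun _ => sq_nonneg _
    gcongr
    linarith
  · intro p hp F hF
    obtain ⟨hFi, hFK⟩ := T.mem_intFacesOf.1 hF
    obtain ⟨x, hx⟩ := hdisc F hF
    have hxF : x ∈ F := hx ⟨by simp [hyperplane], Metric.mem_closedBall_self (by positivity)⟩
    obtain ⟨-, x₀, hpatch⟩ := T.intFace_planar F hFi
    have hFn : F ⊆ hyperplane (faceNormal K F) x := by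
      rw [T.hyperplane_faceNormal hK hF, hyperplane_eq_of_mem (hpatch.subset hxF)]
      exact hpatch.subset
    refine (hC₃ F (faceNormal K F) x h C₁ (T.norm_faceNormal hK hF) hd h10 hFn
      (T.isCompact_of_mem_intFaces hFi) hx ?_ ((measure_mono hFK).trans hs) p hp).trans ?_
    · intro y hy
      rw [Metric.mem_closedBall, hh, ← Metric.diam_closure]
      exact Metric.dist_le_diam_of_mem hb.closure (frontier_subset_closure (hFK hy))
        (frontier_subset_closure (hFK hxF))
    · have : 0 ≤ ∫ x in F, ev p x ^ 2 ∂(surf (m + 1)) := integral_nonneg fun _ => sq_nonneg _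
      gcongr
      linarith
  · intro v w X hX0 hX
    refine (green_error_le hK hb (by positivity) hs
      (hC₄ Ω T K hK hb (hs.trans_lt ENNReal.ofReal_lt_top).ne) v w hX0 hX).trans ?_
    have hB : 0 ≤ ∫ x in frontier K ∩ frontier Ω, ev v x ^ 2 ∂(surf (m + 1)) :=
      integral_nonneg fun _ => sq_nonneg _
    refine mul_le_mul_of_nonneg_right ?_ hB
    calc D * X * (C₁ * h ^ m) = (D * C₁) * (X * h ^ m) := by ring
      _ ≤ (1 + C₁ + C₂ + C₃ * C₁ + D * C₁) * (X * h ^ m) := by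
          refine mul_le_mul_of_nonneg_right ?_ (by positivity)
          linarith
      _ = _ := by ring

end HHO

namespace HHO

/-! ### Second derivatives of polynomials -/

/-- The commutator of two derivations is a derivation, and this one kills the variables. -/
theorem pderiv_comm {d : ℕ} (i j : Fin d) (p : MvPolynomial (Fin d) ℝ) :
    MvPolynomial.pderiv i (MvPolynomial.pderiv j p) =
      MvPolynomial.pderiv j (MvPolynomial.pderiv i p) := by
  have h : ⁅(MvPolynomial.pderiv i : Derivation ℝ (MvPolynomial (Fin d) ℝ) _),
      (MvPolynomial.pderiv j : Derivation ℝ (MvPolynomial (Fin d) ℝ) _)⁆ = 0 := by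
    refine MvPolynomial.derivation_ext fun k => ?_
    simp only [Derivation.commutator_apply, MvPolynomial.pderiv_X, Derivation.coe_zero,
      Pi.zero_apply]
    rcases eq_or_ne k j with rfl | hj <;> rcases eq_or_ne k i with rfl | hi <;>
      simp [*]
  have := congrArg (fun D => D p) h
  simpa [Derivation.commutator_apply, sub_eq_zero] using this

variable {m : ℕ}

theorem lap_pderiv (j : Fin (m + 1)) (w : MvPolynomial (Fin (m + 1)) ℝ) :
    lap (MvPolynomial.pderiv j w) = MvPolynomial.pderiv j (lap w) := by
  simp only [lap, map_sum]
  exact Finset.sum_congr rfl fun i _ => by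
    rw [pderiv_comm i j w, pderiv_comm i j (MvPolynomial.pderiv i w)]

/-- `|∇²w|²`. -/
def hessSq (w : MvPolynomial (Fin (m + 1)) ℝ) (x : Pt (m + 1)) : ℝ :=
  ∑ i, ∑ j, ev (MvPolynomial.pderiv i (MvPolynomial.pderiv j w)) x ^ 2

theorem hessSq_nonneg (w : MvPolynomial (Fin (m + 1)) ℝ) (x : Pt (m + 1)) : 0 ≤ hessSq w x :=
  Finset.sum_nonneg fun _ _ => Finset.sum_nonneg fun _ _ => sq_nonneg _

theorem sum_norm_grad_pderiv_sq (w : MvPolynomial (Fin (m + 1)) ℝ) (x : Pt (m + 1)) :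
    ∑ j, ‖grad (MvPolynomial.pderiv j w) x‖ ^ 2 = hessSq w x := by
  simp only [norm_grad_sq, hessSq]
  exact Finset.sum_comm

theorem hessMul_apply (n : Pt (m + 1)) (w : MvPolynomial (Fin (m + 1)) ℝ) (x : Pt (m + 1))
    (i : Fin (m + 1)) : hessMul n w x i = dn n (MvPolynomial.pderiv i w) x := by
  rw [dn_eq_sum]
  simp only [hessMul, hess, Matrix.mulVec, dotProduct, Matrix.of_apply]
  exact Finset.sum_congr rfl fun j _ => by rw [pderiv_comm, mul_comm]

theorem dn_sq_le {n : Pt (m + 1)} (hn : ‖n‖ = 1) (w : MvPolynomial (Fin (m + 1)) ℝ)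
    (x : Pt (m + 1)) : dn n w x ^ 2 ≤ ‖grad w x‖ ^ 2 := by
  have h := abs_real_inner_le_norm (grad w x) n
  rw [hn, mul_one] at h
  exact sq_le_sq.2 (h.trans (le_abs_self _))

theorem norm_hessMul_sq_le {n : Pt (m + 1)} (hn : ‖n‖ = 1) (w : MvPolynomial (Fin (m + 1)) ℝ)
    (x : Pt (m + 1)) : ‖hessMul n w x‖ ^ 2 ≤ hessSq w x := by
  rw [EuclideanSpace.norm_sq_eq, ← sum_norm_grad_pderiv_sq]
  refine Finset.sum_le_sum fun i _ => ?_
  rw [Real.norm_eq_abs, sq_abs, hessMul_apply]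
  exact dn_sq_le hn _ _

theorem norm_hessMul_sq_eq {n : Pt (m + 1)} (hn : ‖n‖ = 1) (w : MvPolynomial (Fin (m + 1)) ℝ)
    (x : Pt (m + 1)) : ‖hessMul n w x‖ ^ 2 = ‖dnt n w x‖ ^ 2 + dnn n w x ^ 2 := by
  rw [dnt, norm_sub_sq_real, inner_smul_right, norm_smul, hn, dnn]
  simp
  ring

theorem dnn_sq_le {n : Pt (m + 1)} (hn : ‖n‖ = 1) (w : MvPolynomial (Fin (m + 1)) ℝ)
    (x : Pt (m + 1)) : dnn n w x ^ 2 ≤ hessSq w x := by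
  nlinarith [norm_hessMul_sq_eq hn w x, norm_hessMul_sq_le hn w x, sq_nonneg ‖dnt n w x‖]

theorem norm_dnt_sq_le {n : Pt (m + 1)} (hn : ‖n‖ = 1) (w : MvPolynomial (Fin (m + 1)) ℝ)
    (x : Pt (m + 1)) : ‖dnt n w x‖ ^ 2 ≤ hessSq w x := by
  nlinarith [norm_hessMul_sq_eq hn w x, norm_hessMul_sq_le hn w x, sq_nonneg (dnn n w x)]

/-- Both sides are `∇v ⬝ ∇²w n`, split along `n` and its orthogonal complement. The two summands
match the terms of the reconstruction in `γ_∂K` and in `∂ₜv_∂K`. -/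
theorem sum_pderiv_mul_dn_pderiv {n : Pt (m + 1)} (hn : ‖n‖ = 1)
    (v w : MvPolynomial (Fin (m + 1)) ℝ) (x : Pt (m + 1)) :
    ∑ j, ev (MvPolynomial.pderiv j v) x * dn n (MvPolynomial.pderiv j w) x =
      dn n v x * dnn n w x + inner ℝ (dt n v x) (dnt n w x) := by
  have h : ∑ j, ev (MvPolynomial.pderiv j v) x * dn n (MvPolynomial.pderiv j w) x =
      inner ℝ (grad v x) (hessMul n w x) := by
    simp [PiLp.inner_apply, hessMul_apply, mul_comm]
  have h1 : inner ℝ n (hessMul n w x) = dnn n w x := by rw [real_inner_comm, dnn]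
  have h2 : inner ℝ (dt n v x) n = 0 := inner_dt_normal hn v x
  rw [h, dnt, inner_sub_right, inner_smul_right, h2, dt, inner_sub_left, inner_smul_left, h1]
  simp

theorem continuous_hessMul (n : Pt (m + 1)) (w : MvPolynomial (Fin (m + 1)) ℝ) :
    Continuous (hessMul n w) := by
  refine (PiLp.continuous_toLp 2 _).comp (continuous_pi fun i => ?_)
  change Continuous fun x => hessMul n w x i
  simp only [hessMul_apply]
  exact continuous_dn _ _

theorem continuous_dnn (n : Pt (m + 1)) (w : MvPolynomial (Fin (m + 1)) ℝ) :
    Continuous (dnn n w) :=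
  (continuous_hessMul n w).inner continuous_const

theorem continuous_dnt (n : Pt (m + 1)) (w : MvPolynomial (Fin (m + 1)) ℝ) :
    Continuous (dnt n w) :=
  (continuous_hessMul n w).sub ((continuous_dnn n w).smul continuous_const)

/-- `∂ₙₙw` as a polynomial. -/
def dnnPoly (n : Pt (m + 1)) (w : MvPolynomial (Fin (m + 1)) ℝ) : MvPolynomial (Fin (m + 1)) ℝ :=
  ∑ i, ∑ j, (n i * n j) • MvPolynomial.pderiv i (MvPolynomial.pderiv j w)

theorem ev_dnnPoly (n : Pt (m + 1)) (w : MvPolynomial (Fin (m + 1)) ℝ) (x : Pt (m + 1)) :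
    ev (dnnPoly n w) x = dnn n w x := by
  simp only [dnnPoly, ev_sum, ev_smul, dnn, PiLp.inner_apply, hessMul_apply, dn_eq_sum]
  refine Finset.sum_congr rfl fun i _ => ?_
  simp only [RCLike.inner_apply, conj_trivial, Finset.mul_sum]
  exact Finset.sum_congr rfl fun j _ => by rw [pderiv_comm]; ring

/-- Two derivatives lower the degree to `k`, so `∂ₙₙw` is a test function for the projection onto
`ℙ^k(F)`. This is why stabilizing only the projected normal jump is enough. -/
theorem dnnPoly_mem {k : ℕ} (n : Pt (m + 1)) {w : MvPolynomial (Fin (m + 1)) ℝ}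
    (hw : w ∈ Poly (m + 1) (k + 2)) : dnnPoly n w ∈ Poly (m + 1) k :=
  Submodule.sum_mem _ fun i _ => Submodule.sum_mem _ fun j _ =>
    Submodule.smul_mem _ _ (pderiv_mem_poly (pderiv_mem_poly hw j) i)

theorem innerEps_self (ε : ℝ) (K : Set (Pt (m + 1))) (w : MvPolynomial (Fin (m + 1)) ℝ) :
    innerEps ε K w w = ε * (∫ x in K, hessSq w x) + ∫ x in K, ‖grad w x‖ ^ 2 := by
  simp only [innerEps, hessSq, real_inner_self_eq_norm_sq, hess, Matrix.of_apply, sq]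

/-! ### Consequences of the cell bounds -/

namespace CellBounds

variable {Ω : Set (Pt (m + 1))} {T : Mesh (m + 1) Ω} {K : Set (Pt (m + 1))} {l : ℕ} {C h : ℝ}
  {c : Pt (m + 1)}

theorem nonneg (b : CellBounds T K l C h c) : 0 ≤ C := zero_le_one.trans b.one_le

theorem integrableOn_cell (b : CellBounds T K l C h c)
    {f : Pt (m + 1) → ℝ} (hf : Continuous f) : IntegrableOn f K :=
  integrableOn_of_continuous (T.cell_open K b.mem_cells).measurableSet b.isBounded
    b.isBounded.measure_lt_top.ne hf

theorem surf_ne_top (b : CellBounds T K l C h c)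
    {s : Set (Pt (m + 1))} (hs : s ⊆ frontier K) : surf (m + 1) s ≠ ⊤ :=
  measure_ne_top_of_subset hs (b.surf_le.trans_lt ENNReal.ofReal_lt_top).ne

theorem isBounded_of_subset (b : CellBounds T K l C h c)
    {s : Set (Pt (m + 1))} (hs : s ⊆ frontier K) :
    Bornology.IsBounded s :=
  b.isBounded.closure.subset (hs.trans frontier_subset_closure)

theorem integrableOn_bdry (b : CellBounds T K l C h c) {f : Pt (m + 1) → ℝ} (hf : Continuous f) :
    IntegrableOn f (frontier K ∩ frontier Ω) (surf (m + 1)) :=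
  integrableOn_of_continuous (isClosed_frontier.inter isClosed_frontier).measurableSet
    (b.isBounded_of_subset Set.inter_subset_left) (b.surf_ne_top Set.inter_subset_left) hf

theorem integrableOn_face (b : CellBounds T K l C h c)
    (F : T.intFacesOf K) {f : Pt (m + 1) → ℝ} (hf : Continuous f) :
    IntegrableOn f F (surf (m + 1)) :=
  have hF := T.mem_intFacesOf.1 F.2
  integrableOn_of_continuous (T.isCompact_of_mem_intFaces hF.1).measurableSet
    (b.isBounded_of_subset hF.2) (b.surf_ne_top hF.2) hf

theorem frontier_subset (b : CellBounds T K l C h c) : frontier K ⊆ Metric.closedBall c h :=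
  frontier_subset_closure.trans b.closure_subset

theorem face_subset (b : CellBounds T K l C h c)
    (F : T.intFacesOf K) : (F : Set (Pt (m + 1))) ⊆ Metric.closedBall c h :=
  (T.mem_intFacesOf.1 F.2).2.trans b.frontier_subset

/-- Faces overlap in null sets only, so their surfaces add up to at most that of the frontier. -/
theorem sum_surf_le (b : CellBounds T K l C h c)
    : ∑ F : T.intFacesOf K, (surf (m + 1) F).toReal ≤ C * h ^ m := by
  have hC := b.nonneg
  have hpos := b.pos
  rw [← ENNReal.toReal_sum fun F _ => b.surf_ne_top (T.mem_intFacesOf.1 F.2).2]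
  refine ENNReal.toReal_le_of_le_ofReal (by positivity) (le_trans ?_ b.surf_le)
  rw [Finset.sum_coe_sort (T.intFacesOf K) fun F => surf (m + 1) F,
    ← measure_biUnion_finset₀]
  · exact measure_mono (Set.iUnion₂_subset fun F hF => (T.mem_intFacesOf.1 hF).2)
  · intro F hF F' hF' hne
    exact T.faces_nonoverlapping F (Or.inl (T.mem_intFacesOf.1 hF).1) F'
      (Or.inl (T.mem_intFacesOf.1 hF').1) hne
  · exact fun F hF =>
      (T.isCompact_of_mem_intFaces (T.mem_intFacesOf.1 hF).1).measurableSet.nullMeasurableSet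

/-- Cauchy–Schwarz on each face and then over the faces; the total surface enters rather than the
number of faces. -/
theorem sq_sum_faces_le (b : CellBounds T K l C h c)
    {g a : T.intFacesOf K → Pt (m + 1) → ℝ} (hg : ∀ F, Continuous (g F))
    (ha : ∀ F, Continuous (a F)) {X : ℝ} (hX0 : 0 ≤ X)
    (hX : ∀ F : T.intFacesOf K, ∀ x ∈ (F : Set (Pt (m + 1))), g F x ^ 2 ≤ X * a F x ^ 2) :
    (∑ F : T.intFacesOf K, ∫ x in F, g F x ∂(surf (m + 1))) ^ 2 ≤
      C * X * h ^ m * ∑ F : T.intFacesOf K, ∫ x in F, a F x ^ 2 ∂(surf (m + 1)) := by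
  have hA : ∀ F : T.intFacesOf K, 0 ≤ ∫ x in F, a F x ^ 2 ∂(surf (m + 1)) := fun F =>
    integral_nonneg fun _ => sq_nonneg _
  have hF : ∀ F : T.intFacesOf K, (∫ x in F, g F x ∂(surf (m + 1))) ^ 2 ≤
      (X * (surf (m + 1) F).toReal) * ∫ x in F, a F x ^ 2 ∂(surf (m + 1)) := fun F =>
    have h := T.mem_intFacesOf.1 F.2
    sq_setIntegral_le (T.isCompact_of_mem_intFaces h.1).measurableSet (b.isBounded_of_subset h.2)
      (b.surf_ne_top h.2) (hg F) (ha F) (hX F)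
  refine (Finset.sum_sq_le_sum_mul_sum_of_sq_le_mul _ (fun F _ => by positivity)
    (fun F _ => hA F) fun F _ => hF F).trans ?_
  refine mul_le_mul_of_nonneg_right ?_ (Finset.sum_nonneg fun F _ => hA F)
  rw [← Finset.mul_sum]
  calc X * ∑ F : T.intFacesOf K, (surf (m + 1) F).toReal ≤ X * (C * h ^ m) :=
        mul_le_mul_of_nonneg_left b.sum_surf_le hX0
    _ = _ := by ring

theorem integral_sum_sq (b : CellBounds T K l C h c)
    {ι : Type*} [Fintype ι] (p : ι → MvPolynomial (Fin (m + 1)) ℝ) :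
    ∫ x in K, ∑ i, ev (p i) x ^ 2 = ∑ i, ∫ x in K, ev (p i) x ^ 2 :=
  integral_finsetSum _ fun _ _ => b.integrableOn_cell ((continuous_ev _).pow 2)

theorem norm_grad_sq_le (b : CellBounds T K l C h c) {w : MvPolynomial (Fin (m + 1)) ℝ}
    (hw : w ∈ Poly (m + 1) l) {x : Pt (m + 1)} (hx : x ∈ Metric.closedBall c h) :
    ‖grad w x‖ ^ 2 ≤ C * h⁻¹ ^ (m + 1) * ∫ x in K, ‖grad w x‖ ^ 2 := by
  simp only [norm_grad_sq]
  rw [b.integral_sum_sq, Finset.mul_sum]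
  exact Finset.sum_le_sum fun i _ =>
    b.sup_le _ (poly_mono (Nat.sub_le _ _) (pderiv_mem_poly hw i)) x hx

theorem integral_hessSq (b : CellBounds T K l C h c) (w : MvPolynomial (Fin (m + 1)) ℝ) :
    ∫ x in K, hessSq w x =
      ∑ j, ∫ x in K, ‖grad (MvPolynomial.pderiv j w) x‖ ^ 2 := by
  simp only [← sum_norm_grad_pderiv_sq]
  exact integral_finsetSum _ fun _ _ => b.integrableOn_cell ((continuous_grad _).norm.pow 2)

theorem hessSq_le (b : CellBounds T K l C h c) {w : MvPolynomial (Fin (m + 1)) ℝ}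
    (hw : w ∈ Poly (m + 1) l) {x : Pt (m + 1)} (hx : x ∈ Metric.closedBall c h) :
    hessSq w x ≤ C * h⁻¹ ^ (m + 1) * ∫ x in K, hessSq w x := by
  rw [b.integral_hessSq, ← sum_norm_grad_pderiv_sq, Finset.mul_sum]
  exact Finset.sum_le_sum fun i _ =>
    b.norm_grad_sq_le (poly_mono (Nat.sub_le _ _) (pderiv_mem_poly hw i)) hx

/-- `∇Δw` is the sum of the gradients of `∂ᵢ∂ᵢw`, and the inverse inequality for each of these costs
a factor `h⁻²`. -/
theorem norm_grad_lap_sq_le (b : CellBounds T K l C h c) {w : MvPolynomial (Fin (m + 1)) ℝ}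
    (hw : w ∈ Poly (m + 1) l) {x : Pt (m + 1)} (hx : x ∈ Metric.closedBall c h) :
    ‖grad (lap w) x‖ ^ 2 ≤ (m + 1) * C * h⁻¹ ^ (m + 3) * ∫ x in K, hessSq w x := by
  have hC := b.nonneg
  have hpos := b.pos
  have h1 : grad (lap w) x =
      ∑ i, grad (MvPolynomial.pderiv i (MvPolynomial.pderiv i w)) x := by
    ext j
    simp [lap, map_sum, ev_sum]
  have h2 : ∀ i, ‖grad (MvPolynomial.pderiv i (MvPolynomial.pderiv i w)) x‖ ^ 2 ≤
      C * h⁻¹ ^ (m + 3) * ∫ x in K, ‖grad (MvPolynomial.pderiv i w) x‖ ^ 2 := by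
    intro i
    refine (b.sup_grad_le _ (poly_mono ((Nat.sub_le _ _).trans (Nat.sub_le _ _))
      (pderiv_mem_poly (pderiv_mem_poly hw i) i)) x hx).trans ?_
    refine mul_le_mul_of_nonneg_left ?_ (by positivity)
    refine integral_mono (b.integrableOn_cell ((continuous_ev _).pow 2))
      (b.integrableOn_cell ((continuous_grad _).norm.pow 2)) fun y => ?_
    simp only [norm_grad_sq]
    exact Finset.single_le_sum
      (f := fun j => ev (MvPolynomial.pderiv j (MvPolynomial.pderiv i w)) y ^ 2)
      (fun _ _ => sq_nonneg _) (Finset.mem_univ i)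
  calc ‖grad (lap w) x‖ ^ 2
      ≤ (∑ i, ‖grad (MvPolynomial.pderiv i (MvPolynomial.pderiv i w)) x‖) ^ 2 := by
        rw [h1]; exact pow_le_pow_left₀ (norm_nonneg _) (norm_sum_le _ _) 2
    _ ≤ (Finset.univ : Finset (Fin (m + 1))).card *
          ∑ i, ‖grad (MvPolynomial.pderiv i (MvPolynomial.pderiv i w)) x‖ ^ 2 :=
        sq_sum_le_card_mul_sum_sq
    _ ≤ (m + 1) * ∑ i, C * h⁻¹ ^ (m + 3) *
          ∫ x in K, ‖grad (MvPolynomial.pderiv i w) x‖ ^ 2 := by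
        simp only [Finset.card_univ, Fintype.card_fin, Nat.cast_add, Nat.cast_one]
        exact mul_le_mul_of_nonneg_left (Finset.sum_le_sum fun i _ => h2 i) (by positivity)
    _ = _ := by rw [← Finset.mul_sum, b.integral_hessSq]; ring

end CellBounds

end HHO

namespace HHO

/-! ### The projection onto polynomials on a face -/

/-- On polynomials in all `d` variables the `L²(F)` form is only semidefinite, since some may vanish
on `F`. By Cauchy–Schwarz the functional to be represented vanishes on null vectors, which suffices
for existence. -/
theorem isFaceProj_faceProj {d : ℕ} {F : Set (Pt d)} {g : Pt d → ℝ}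
    (hi : ∀ f : Pt d → ℝ, Continuous f → Integrable f ((surf d).restrict F)) (hg : Continuous g)
    (k : ℕ) : IsFaceProj k F g (faceProj k F g) := by
  refine Classical.epsilon_spec (p := IsFaceProj k F g) ?_
  let l : Poly d k →ₗ[ℝ] ℝ :=
    { toFun := fun q => ∫ x in F, g x * ev q x ∂(surf d)
      map_add' := fun p q => by
        simp only [Submodule.coe_add, ev_add, mul_add]
        exact integral_add (hi _ (hg.mul (continuous_ev _))) (hi _ (hg.mul (continuous_ev _)))
      map_smul' := fun a q => by
        simp only [Submodule.coe_smul, ev_smul, mul_left_comm _ a, integral_const_mul,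
          smul_eq_mul, RingHom.id_apply] }
  refine exists_represents (evForm ((surf d).restrict F) hi k) (fun p q => ?_) l fun q hq => ?_
  · simp only [evForm_apply, mul_comm]
  · rw [evForm_apply] at hq
    change ∫ x in F, g x * ev q x ∂(surf d) = 0
    have h := sq_integral_mul_le (hi _ (hg.pow 2)) (hi _ ((continuous_ev q.1).pow 2))
      (hi _ (hg.mul (continuous_ev q.1)))
    simp only [← sq] at hq
    rw [hq, mul_zero] at h
    exact pow_eq_zero_iff two_ne_zero |>.1 (le_antisymm h (sq_nonneg _))

theorem integral_faceProj_mul {d : ℕ} {F : Set (Pt d)} {g : Pt d → ℝ}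
    (hi : ∀ f : Pt d → ℝ, Continuous f → Integrable f ((surf d).restrict F)) (hg : Continuous g)
    (k : ℕ) (q : Poly d k) :
    ∫ x in F, ev (faceProj k F g) x * ev q x ∂(surf d) = ∫ x in F, g x * ev q x ∂(surf d) :=
  isFaceProj_faceProj hi hg k q

theorem integral_faceProj_mul_self {d : ℕ} {F : Set (Pt d)} {g : Pt d → ℝ}
    (hi : ∀ f : Pt d → ℝ, Continuous f → Integrable f ((surf d).restrict F)) (hg : Continuous g)
    (k : ℕ) :
    ∫ x in F, ev (faceProj k F g) x * g x ∂(surf d) =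
      ∫ x in F, ev (faceProj k F g) x ^ 2 ∂(surf d) := by
  simp only [sq, integral_faceProj_mul hi hg k (faceProj k F g)]
  simp only [mul_comm]

/-- Pythagoras. With `q = 0` it splits off the unprojected part of the jump; with arbitrary `q` it
yields the best approximation property. -/
theorem integral_sq_sub_eq {d : ℕ} {F : Set (Pt d)} {g : Pt d → ℝ}
    (hi : ∀ f : Pt d → ℝ, Continuous f → Integrable f ((surf d).restrict F)) (hg : Continuous g)
    (k : ℕ) (q : Poly d k) :
    ∫ x in F, (g x - ev q x) ^ 2 ∂(surf d) =
      (∫ x in F, (g x - ev (faceProj k F g) x) ^ 2 ∂(surf d)) +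
      ∫ x in F, ev (faceProj k F g - q : Poly d k) x ^ 2 ∂(surf d) := by
  set P := faceProj k F g with hP
  have h0 : ∫ x in F, (g x - ev P x) * ev (P - q : Poly d k) x ∂(surf d) = 0 := by
    simp only [sub_mul]
    rw [integral_sub (hi (fun x => g x * ev (P - q : Poly d k) x) (hg.mul (continuous_ev _)))
      (hi (fun x => ev P x * ev (P - q : Poly d k) x) ((continuous_ev P.1).mul (continuous_ev _))),
      sub_eq_zero]
    exact (integral_faceProj_mul hi hg k (P - q)).symm
  have h1 : ∀ x, (g x - ev q x) ^ 2 = ((g x - ev P x) ^ 2 + ev (P - q : Poly d k) x ^ 2) +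
      2 * ((g x - ev P x) * ev (P - q : Poly d k) x) := fun x => by
    rw [Submodule.coe_sub, ev_sub]; ring
  have c1 : Continuous fun x => (g x - ev P x) := hg.sub (continuous_ev _)
  have c2 : Continuous (ev (P - q : Poly d k).1) := continuous_ev _
  simp only [h1]
  rw [integral_add (hi (fun x => (g x - ev P x) ^ 2 + ev (P - q : Poly d k) x ^ 2)
      ((c1.pow 2).add (c2.pow 2))) 
      (hi (fun x => 2 * ((g x - ev P x) * ev (P - q : Poly d k) x))
        (continuous_const.mul (c1.mul c2))),
    integral_add (hi (fun x => (g x - ev P x) ^ 2) (c1.pow 2))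
      (hi (fun x => ev (P - q : Poly d k) x ^ 2) (c2.pow 2)), integral_const_mul, h0]
  ring

theorem integral_sq_sub_faceProj_le {d : ℕ} {F : Set (Pt d)} {g : Pt d → ℝ}
    (hi : ∀ f : Pt d → ℝ, Continuous f → Integrable f ((surf d).restrict F)) (hg : Continuous g)
    (k : ℕ) (q : Poly d k) :
    ∫ x in F, (g x - ev (faceProj k F g) x) ^ 2 ∂(surf d) ≤
      ∫ x in F, (g x - ev q x) ^ 2 ∂(surf d) := by
  rw [integral_sq_sub_eq hi hg k q]
  exact le_add_of_nonneg_right (integral_nonneg fun _ => sq_nonneg _)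

/-! ### Consistency of the reconstruction up to the stabilization -/

variable {m : ℕ} {Ω : Set (Pt (m + 1))} {T : Mesh (m + 1) Ω} {K : Set (Pt (m + 1))}

/-- The error in the Green formula due to the boundary of the domain. -/
def Mesh.greenError (T : Mesh (m + 1) Ω) (K : Set (Pt (m + 1)))
    (v w : MvPolynomial (Fin (m + 1)) ℝ) : ℝ :=
  (∫ x in K, inner ℝ (grad v x) (grad w x)) + (∫ x in K, ev v x * ev (lap w) x) -
    ∑ F : T.intFacesOf K, ∫ x in F, ev v x * dn (faceNormal K F) w x ∂(surf (m + 1))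

variable {k : ℕ}

/-- The normal component `γ_∂K - ∂ₙv_K` of the jump. -/
def Mesh.jumpNormal (v : T.LocalSpace K k) (F : T.intFacesOf K)
    (x : Pt (m + 1)) : ℝ :=
  ev (v.2.2 F) x - dn (faceNormal K F) v.1 x

theorem Mesh.continuous_jumpNormal (v : T.LocalSpace K k) (F : T.intFacesOf K) :
    Continuous (Mesh.jumpNormal v F) :=
  (continuous_ev _).sub (continuous_dn _ _)

namespace CellBounds

variable {C h : ℝ} {c : Pt (m + 1)}

/-- Green's formula for the pairs `(∂ⱼv, ∂ⱼw)`, summed over `j`. Together with Green's formula for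
`(v, Δw)`, it performs the double integration by parts of the fourth-order term. -/
theorem sum_greenError_pderiv (b : CellBounds T K (k + 2) C h c)
    (v w : MvPolynomial (Fin (m + 1)) ℝ) :
    ∑ j, T.greenError K (MvPolynomial.pderiv j v) (MvPolynomial.pderiv j w) =
      (∫ x in K, ∑ i, ∑ j, hess v x i j * hess w x i j) +
      (∫ x in K, inner ℝ (grad v x) (grad (lap w) x)) -
      ∑ F : T.intFacesOf K, ∫ x in F, (dn (faceNormal K F) v x * dnn (faceNormal K F) w x +
        inner ℝ (dt (faceNormal K F) v x) (dnt (faceNormal K F) w x)) ∂(surf (m + 1)) := by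
  have e1 : ∀ x, ∑ i, ∑ j, hess v x i j * hess w x i j =
      ∑ j, inner ℝ (grad (MvPolynomial.pderiv j v) x) (grad (MvPolynomial.pderiv j w) x) := by
    intro x
    simp only [inner_grad_eq_sum, hess, Matrix.of_apply]
    exact Finset.sum_comm
  have h1 : ∫ x in K, ∑ i, ∑ j, hess v x i j * hess w x i j =
      ∑ j, ∫ x in K, inner ℝ (grad (MvPolynomial.pderiv j v) x)
        (grad (MvPolynomial.pderiv j w) x) := by
    simp only [e1]
    exact integral_finsetSum _ fun j _ =>
      b.integrableOn_cell ((continuous_grad _).inner (continuous_grad _))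
  have e2 : ∀ x, inner ℝ (grad v x) (grad (lap w) x) =
      ∑ j, ev (MvPolynomial.pderiv j v) x * ev (lap (MvPolynomial.pderiv j w)) x := by
    intro x
    simp only [inner_grad_eq_sum, lap_pderiv]
  have h2 : ∫ x in K, inner ℝ (grad v x) (grad (lap w) x) =
      ∑ j, ∫ x in K, ev (MvPolynomial.pderiv j v) x * ev (lap (MvPolynomial.pderiv j w)) x := by
    simp only [e2]
    exact integral_finsetSum _ fun j _ =>
      b.integrableOn_cell ((continuous_ev _).mul (continuous_ev _))
  have h3 : ∀ F : T.intFacesOf K, ∫ x in F, (dn (faceNormal K F) v x * dnn (faceNormal K F) w x +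
        inner ℝ (dt (faceNormal K F) v x) (dnt (faceNormal K F) w x)) ∂(surf (m + 1)) =
      ∑ j, ∫ x in F, ev (MvPolynomial.pderiv j v) x *
        dn (faceNormal K F) (MvPolynomial.pderiv j w) x ∂(surf (m + 1)) := by
    intro F
    simp only [← sum_pderiv_mul_dn_pderiv (T.norm_faceNormal b.mem_cells F.2)]
    exact integral_finsetSum _ fun j _ =>
      b.integrableOn_face F ((continuous_ev _).mul (continuous_dn _ _))
  rw [h1, h2, Finset.sum_congr rfl fun F _ => h3 F, Finset.sum_comm]
  simp only [Mesh.greenError, Finset.sum_sub_distrib, Finset.sum_add_distrib]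

/-- Integration by parts as an exact identity: each interior face term of the reconstruction
combines with the trace of `v_K` into a jump, and everything on `∂Ω` is hidden in the Green errors.
-/
theorem reconstructionRHS_sub_innerEps (b : CellBounds T K (k + 2) C h c) (ε : ℝ)
    (v : T.LocalSpace K k) (w : Poly (m + 1) (k + 2)) :
    T.reconstructionRHS ε v w - innerEps ε K v.1 w =
      -T.greenError K v.1 w + ε * T.greenError K v.1 (lap w) -
      ε * ∑ j, T.greenError K (MvPolynomial.pderiv j v.1.1) (MvPolynomial.pderiv j w.1) +
      (∑ F : T.intFacesOf K, ∫ x in F,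
        (ev (v.2.1 F) x - ev v.1 x) * dn (faceNormal K F) w x ∂(surf (m + 1))) -
      ε * (∑ F : T.intFacesOf K, ∫ x in F,
        (ev (v.2.1 F) x - ev v.1 x) * dn (faceNormal K F) (lap w) x ∂(surf (m + 1))) +
      ε * (∑ F : T.intFacesOf K, ∫ x in F, ev (faceProj k F (Mesh.jumpNormal v F)) x *
        dnn (faceNormal K F) w x ∂(surf (m + 1))) +
      ε * (∑ F : T.intFacesOf K, ∫ x in F, inner ℝ (dt (faceNormal K F) (v.2.1 F - v.1 :
        Poly (m + 1) (k + 2)) x) (dnt (faceNormal K F) w x) ∂(surf (m + 1))) := by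
  have t1 : ∀ (F : T.intFacesOf K) (p : MvPolynomial (Fin (m + 1)) ℝ), ∫ x in F,
      (ev (v.2.1 F) x - ev v.1 x) * dn (faceNormal K F) p x ∂(surf (m + 1)) =
      (∫ x in F, ev (v.2.1 F) x * dn (faceNormal K F) p x ∂(surf (m + 1))) -
      ∫ x in F, ev v.1 x * dn (faceNormal K F) p x ∂(surf (m + 1)) := fun F p => by
    simp only [sub_mul]
    exact integral_sub (b.integrableOn_face F ((continuous_ev _).mul (continuous_dn _ _)))
      (b.integrableOn_face F ((continuous_ev _).mul (continuous_dn _ _)))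
  have t3 : ∀ F : T.intFacesOf K, ∫ x in F, ev (faceProj k F (Mesh.jumpNormal v F)) x *
        dnn (faceNormal K F) w x ∂(surf (m + 1)) =
      (∫ x in F, ev (v.2.2 F) x * dnn (faceNormal K F) w x ∂(surf (m + 1))) -
      ∫ x in F, dn (faceNormal K F) v.1 x * dnn (faceNormal K F) w x ∂(surf (m + 1)) := fun F => by
    have := integral_faceProj_mul (fun f hf => b.integrableOn_face F hf)
      (Mesh.continuous_jumpNormal v F) k ⟨_, dnnPoly_mem (faceNormal K F) w.2⟩
    simp only [ev_dnnPoly] at this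
    simp only [this, Mesh.jumpNormal, sub_mul]
    exact integral_sub (b.integrableOn_face F ((continuous_ev _).mul (continuous_dnn _ _)))
      (b.integrableOn_face F ((continuous_dn _ _).mul (continuous_dnn _ _)))
  have t4 : ∀ F : T.intFacesOf K, ∫ x in F, inner ℝ (dt (faceNormal K F) (v.2.1 F - v.1 :
        Poly (m + 1) (k + 2)) x) (dnt (faceNormal K F) w x) ∂(surf (m + 1)) =
      (∫ x in F, inner ℝ (dt (faceNormal K F) (v.2.1 F) x)
        (dnt (faceNormal K F) w x) ∂(surf (m + 1))) -
      ∫ x in F, inner ℝ (dt (faceNormal K F) v.1 x)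
        (dnt (faceNormal K F) w x) ∂(surf (m + 1)) := fun F => by
    have : ∀ x, dt (faceNormal K F) (v.2.1 F - v.1 : Poly (m + 1) (k + 2)) x =
        dt (faceNormal K F) (v.2.1 F) x - dt (faceNormal K F) v.1 x := fun x => by
      simp only [dt, dn, Submodule.coe_sub, grad_sub, inner_sub_left, sub_smul]
      abel
    simp only [this, inner_sub_left]
    exact integral_sub (b.integrableOn_face F ((continuous_dt _ _).inner (continuous_dnt _ _)))
      (b.integrableOn_face F ((continuous_dt _ _).inner (continuous_dnt _ _)))
  have t5 : ∀ F : T.intFacesOf K, ∫ x in F, (dn (faceNormal K F) v.1 x *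
        dnn (faceNormal K F) w x + inner ℝ (dt (faceNormal K F) v.1 x)
          (dnt (faceNormal K F) w x)) ∂(surf (m + 1)) =
      (∫ x in F, dn (faceNormal K F) v.1 x * dnn (faceNormal K F) w x ∂(surf (m + 1))) +
      ∫ x in F, inner ℝ (dt (faceNormal K F) v.1 x)
        (dnt (faceNormal K F) w x) ∂(surf (m + 1)) := fun F =>
    integral_add (b.integrableOn_face F ((continuous_dn _ _).mul (continuous_dnn _ _)))
      (b.integrableOn_face F ((continuous_dt _ _).inner (continuous_dnt _ _)))
  have t6 : ∫ x in K, ev v.1 x * (ε * ev (lap (lap w)) x) =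
      ε * ∫ x in K, ev v.1 x * ev (lap (lap w)) x := by
    rw [← integral_const_mul]
    congr 1
    ext x
    ring
  rw [b.sum_greenError_pderiv]
  simp only [Mesh.reconstructionRHS, innerEps, Mesh.greenError, t1, t3, t4, t5, t6,
    Finset.sum_sub_distrib, Finset.sum_add_distrib]
  ring

end CellBounds

end HHO

/-! ### The consistency error is controlled by the stabilization -/

namespace HHO

theorem one_le_sigma {d : ℕ} (ε : ℝ) (K : Set (Pt d)) : 1 ≤ sigma ε K := le_max_left _ _

theorem le_sigma {d : ℕ} (ε : ℝ) (K : Set (Pt d)) :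
    ε * (Metric.diam K)⁻¹ ^ 2 ≤ sigma ε K := le_max_right _ _

theorem sq_sum_seven_le {R a₁ a₂ a₃ a₄ a₅ a₆ a₇ : ℝ} (h₁ : a₁ ^ 2 ≤ R) (h₂ : a₂ ^ 2 ≤ R)
    (h₃ : a₃ ^ 2 ≤ R) (h₄ : a₄ ^ 2 ≤ R) (h₅ : a₅ ^ 2 ≤ R) (h₆ : a₆ ^ 2 ≤ R) (h₇ : a₇ ^ 2 ≤ R) :
    (-a₁ + a₂ - a₃ + a₄ - a₅ + a₆ + a₇) ^ 2 ≤ 49 * R := by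
  have hR : 0 ≤ R := (sq_nonneg _).trans h₁
  have i₁ := abs_le.1 (Real.abs_le_sqrt h₁)
  have i₂ := abs_le.1 (Real.abs_le_sqrt h₂)
  have i₃ := abs_le.1 (Real.abs_le_sqrt h₃)
  have i₄ := abs_le.1 (Real.abs_le_sqrt h₄)
  have i₅ := abs_le.1 (Real.abs_le_sqrt h₅)
  have i₆ := abs_le.1 (Real.abs_le_sqrt h₆)
  have i₇ := abs_le.1 (Real.abs_le_sqrt h₇)
  have h : (-a₁ + a₂ - a₃ + a₄ - a₅ + a₆ + a₇) ^ 2 ≤ (7 * √R) ^ 2 :=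
    sq_le_sq' (by linarith) (by linarith)
  rw [mul_pow, Real.sq_sqrt hR] at h
  linarith

variable {m : ℕ} {Ω : Set (Pt (m + 1))} {T : Mesh (m + 1) Ω} {K : Set (Pt (m + 1))} {k : ℕ}

/-- `‖v_∂K - v_K‖²` on the interior faces. -/
def Mesh.jumpSq (v : T.LocalSpace K k) : ℝ :=
  ∑ F : T.intFacesOf K, ∫ x in F, (ev (v.2.1 F) x - ev v.1 x) ^ 2 ∂(surf (m + 1))

/-- `‖Π(γ_∂K - ∂ₙv_K)‖²` on the interior faces. -/
def Mesh.projJumpSq (v : T.LocalSpace K k) : ℝ :=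
  ∑ F : T.intFacesOf K, ∫ x in F, ev (faceProj k F (Mesh.jumpNormal v F)) x ^ 2 ∂(surf (m + 1))

/-- The stabilization `Sⁱ(v, v) + Sᵇ(v, v)`. -/
def Mesh.stab (ε : ℝ) (v : T.LocalSpace K k) : ℝ :=
  T.stabInt ε v v + T.stabBdry ε K v.1 v.1

theorem Mesh.jumpSq_nonneg (v : T.LocalSpace K k) : 0 ≤ Mesh.jumpSq v :=
  Finset.sum_nonneg fun _ _ => integral_nonneg fun _ => sq_nonneg _

theorem Mesh.projJumpSq_nonneg (v : T.LocalSpace K k) : 0 ≤ Mesh.projJumpSq v :=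
  Finset.sum_nonneg fun _ _ => integral_nonneg fun _ => sq_nonneg _

namespace CellBounds

variable {C h : ℝ} {c : Pt (m + 1)}

theorem stab_eq (b : CellBounds T K (k + 2) C h c) (ε : ℝ) (v : T.LocalSpace K k) :
    Mesh.stab ε v = sigma ε K * ((Metric.diam K)⁻¹ * Mesh.jumpSq v) +
      sigma ε K * Metric.diam K * Mesh.projJumpSq v +
      sigma ε K * ((Metric.diam K)⁻¹ *
        ∫ x in frontier K ∩ frontier Ω, ev v.1 x ^ 2 ∂(surf (m + 1))) +
      ε * ((Metric.diam K)⁻¹ *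
        ∫ x in frontier K ∩ frontier Ω, ‖grad v.1 x‖ ^ 2 ∂(surf (m + 1))) := by
  have h1 : ∀ F : T.intFacesOf K, ∫ x in F, ev (faceProj k F (Mesh.jumpNormal v F)) x *
      Mesh.jumpNormal v F x ∂(surf (m + 1)) =
      ∫ x in F, ev (faceProj k F (Mesh.jumpNormal v F)) x ^ 2 ∂(surf (m + 1)) := fun F =>
    integral_faceProj_mul_self (fun f hf => b.integrableOn_face F hf)
      (Mesh.continuous_jumpNormal v F) k
  have h2 : ∑ F : T.intFacesOf K, ∫ x in F,
      ev (faceProj k F fun y => ev (v.2.2 F) y - dn (faceNormal K F) v.1 y) x *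
        (ev (v.2.2 F) x - dn (faceNormal K F) v.1 x) ∂(surf (m + 1)) = Mesh.projJumpSq v :=
    Finset.sum_congr rfl fun F _ => h1 F
  rw [Mesh.stab, Mesh.stabInt, Mesh.stabBdry, h2]
  simp only [Mesh.jumpSq, sq, real_inner_self_eq_norm_mul_norm]
  ring

-- Each of the seven terms is a product of a stabilized quantity and a derivative of `w`. Terms
-- without `ε` use `σ ≥ 1` and `∇w`. Those with `ε` use `∇²w`: the powers of `h` are matched by `σ ≥
-- ε h⁻²`, or by the boundary penalty on `∇v_K` in the third term. The constant is `49 = 7²`.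
set_option maxHeartbeats 1000000 in
theorem sq_consistency_le (b : CellBounds T K (k + 2) C (Metric.diam K) c) {ε : ℝ} (hε : 0 ≤ ε)
    (v : T.LocalSpace K k) (w : Poly (m + 1) (k + 2)) :
    (T.reconstructionRHS ε v w - innerEps ε K v.1 w) ^ 2 ≤
      49 * ((m + 1) * C ^ 3) * (Mesh.stab ε v * innerEps ε K w w) := by
  have hC := b.nonneg
  have hpos := b.pos
  have hC1 := b.one_le
  have hstab := b.stab_eq ε v
  rw [innerEps_self]
  have hσ1 := one_le_sigma ε K
  have hσ2 := le_sigma ε K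
  have hX1 := fun x => b.norm_grad_sq_le w.2 (x := x)
  have hX2 := fun x => b.hessSq_le w.2 (x := x)
  have hX3 := fun x => b.norm_grad_lap_sq_le w.2 (x := x)
  have hfr := fun x (hx : x ∈ frontier K ∩ frontier Ω) => b.frontier_subset hx.1
  have hface := b.face_subset
  have hD := Mesh.jumpSq_nonneg v
  have hP := Mesh.projJumpSq_nonneg v
  have hG : 0 ≤ ∫ x in K, ‖grad w.1 x‖ ^ 2 := integral_nonneg fun _ => sq_nonneg _
  have hH : 0 ≤ ∫ x in K, hessSq w.1 x := integral_nonneg fun _ => hessSq_nonneg _ _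
  have hV : 0 ≤ ∫ x in frontier K ∩ frontier Ω, ev v.1 x ^ 2 ∂(surf (m + 1)) :=
    integral_nonneg fun _ => sq_nonneg _
  have hW : 0 ≤ ∫ x in frontier K ∩ frontier Ω, ‖grad v.1 x‖ ^ 2 ∂(surf (m + 1)) :=
    integral_nonneg fun _ => sq_nonneg _
  have hWsum : ∑ j, ∫ x in frontier K ∩ frontier Ω,
      ev (MvPolynomial.pderiv j v.1.1) x ^ 2 ∂(surf (m + 1)) =
      ∫ x in frontier K ∩ frontier Ω, ‖grad v.1 x‖ ^ 2 ∂(surf (m + 1)) := by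
    simp only [norm_grad_sq]
    exact (integral_finsetSum _ fun j _ => b.integrableOn_bdry ((continuous_ev _).pow 2)).symm
  set h := Metric.diam K with hh
  set σ := sigma ε K
  set S := Mesh.stab ε v
  set D := Mesh.jumpSq v with hDdef
  set P := Mesh.projJumpSq v with hPdef
  set G := ∫ x in K, ‖grad w.1 x‖ ^ 2
  set H := ∫ x in K, hessSq w.1 x
  set V := ∫ x in frontier K ∩ frontier Ω, ev v.1 x ^ 2 ∂(surf (m + 1)) with hVdef
  set W := ∫ x in frontier K ∩ frontier Ω, ‖grad v.1 x‖ ^ 2 ∂(surf (m + 1)) with hWdef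
  have hpow1 : h⁻¹ ^ (m + 1) * h ^ m = h⁻¹ := by
    rw [pow_succ', mul_assoc, ← mul_pow, inv_mul_cancel₀ hpos.ne', one_pow, mul_one]
  have hpow3 : h⁻¹ ^ (m + 3) * h ^ m = h⁻¹ ^ 3 := by
    rw [add_comm, pow_add, mul_assoc, ← mul_pow, inv_mul_cancel₀ hpos.ne', one_pow, mul_one]
  have hD0 : 0 ≤ h⁻¹ * D := by positivity
  have hV0 : 0 ≤ h⁻¹ * V := by positivity
  have hW0 : 0 ≤ h⁻¹ * W := by positivity
  have hP0 : 0 ≤ h * P := by positivity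
  have hσ0 : 0 ≤ σ := zero_le_one.trans hσ1
  have q1 := mul_nonneg hσ0 hD0
  have q2 : 0 ≤ σ * h * P := by positivity
  have q3 := mul_nonneg hσ0 hV0
  have q4 := mul_nonneg hε hW0
  have hSD : σ * (h⁻¹ * D) ≤ S := by linarith
  have hSV : σ * (h⁻¹ * V) ≤ S := by linarith
  have hSP : σ * h * P ≤ S := by linarith
  have hSW : ε * (h⁻¹ * W) ≤ S := by linarith
  have hSD1 : h⁻¹ * D ≤ S := (le_mul_of_one_le_left hD0 hσ1).trans hSD
  have hSV1 : h⁻¹ * V ≤ S := (le_mul_of_one_le_left hV0 hσ1).trans hSV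
  have hSD2 : ε * h⁻¹ ^ 2 * (h⁻¹ * D) ≤ S := (mul_le_mul_of_nonneg_right hσ2 hD0).trans hSD
  have hSV2 : ε * h⁻¹ ^ 2 * (h⁻¹ * V) ≤ S := (mul_le_mul_of_nonneg_right hσ2 hV0).trans hSV
  have hSP2 : ε * h⁻¹ ^ 2 * (h * P) ≤ S :=
    (mul_le_mul_of_nonneg_right hσ2 hP0).trans ((mul_assoc _ _ _).symm.le.trans hSP)
  have hS : 0 ≤ S := hD0.trans hSD1
  have hεH : 0 ≤ ε * H := by positivity
  have hm0 : (0 : ℝ) ≤ m := Nat.cast_nonneg m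
  have hC23 : C ^ 2 ≤ C ^ 3 := pow_le_pow_right₀ hC1 (by norm_num)
  have hA3 : C ^ 3 ≤ (m + 1) * C ^ 3 := le_mul_of_one_le_left (by positivity) (by linarith)
  have hA1 : C ^ 2 ≤ (m + 1) * C ^ 3 := hC23.trans hA3
  have hA2 : (m + 1) * C ^ 2 ≤ (m + 1) * C ^ 3 := mul_le_mul_of_nonneg_left hC23 (by positivity)
  -- The constants `C²`, `(m + 1)C²` and `C³` of the individual terms are all dominated by `(m +
  -- 1)C³`, since `1 ≤ C`.
  have key : ∀ {A S' N' : ℝ}, A ≤ (m + 1) * C ^ 3 → 0 ≤ S' → 0 ≤ N' → S' ≤ S →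
      N' ≤ ε * H + G → A * (S' * N') ≤ (m + 1) * C ^ 3 * (S * (ε * H + G)) := by
    intro A S' N' hA hS' hN' hSS hNN
    gcongr
  have hG1 : G ≤ ε * H + G := le_add_of_nonneg_left hεH
  have hH1 : ε * H ≤ ε * H + G := le_add_of_nonneg_right hG
  have hn : ∀ F : T.intFacesOf K, ‖faceNormal K F‖ = 1 := fun F =>
    T.norm_faceNormal b.mem_cells F.2
  rw [b.reconstructionRHS_sub_innerEps, mul_assoc]
  refine sq_sum_seven_le ?_ ?_ ?_ ?_ ?_ ?_ ?_
  · refine (b.green v.1 w (C * h⁻¹ ^ (m + 1) * G) (by positivity)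
      fun x hx => hX1 x (hfr x hx)).trans (le_of_eq_of_le ?_ (key hA1 hV0 hG hSV1 hG1))
    calc _ = C ^ 2 * G * V * (h⁻¹ ^ (m + 1) * h ^ m) := by ring
      _ = _ := by rw [hpow1]; ring
  · rw [mul_pow]
    refine (mul_le_mul_of_nonneg_left (b.green v.1 (lap w) ((m + 1) * C * h⁻¹ ^ (m + 3) * H)
      (by positivity) fun x hx => hX3 x (hfr x hx)) (sq_nonneg ε)).trans
      (le_of_eq_of_le ?_ (key hA2 (by positivity) hεH hSV2 hH1))
    calc _ = ε ^ 2 * ((m + 1) * C ^ 2) * H * V * (h⁻¹ ^ (m + 3) * h ^ m) := by ring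
      _ = _ := by rw [hpow3]; ring
  · rw [mul_pow]
    have hj : ∀ j, T.greenError K (MvPolynomial.pderiv j v.1.1) (MvPolynomial.pderiv j w.1) ^ 2 ≤
        C * (C * h⁻¹ ^ (m + 1) * H) * h ^ m * ∫ x in frontier K ∩ frontier Ω,
          ev (MvPolynomial.pderiv j v.1.1) x ^ 2 ∂(surf (m + 1)) := by
      intro j
      refine b.green _ _ (C * h⁻¹ ^ (m + 1) * H) (by positivity) fun x hx =>
        le_trans ?_ (hX2 x (hfr x hx))
      rw [← sum_norm_grad_pderiv_sq]
      exact Finset.single_le_sum (f := fun j => ‖grad (MvPolynomial.pderiv j w.1) x‖ ^ 2)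
        (fun _ _ => sq_nonneg _) (Finset.mem_univ j)
    have hsum := (sq_sum_le_card_mul_sum_sq (s := Finset.univ) (f := fun j =>
      T.greenError K (MvPolynomial.pderiv j v.1.1) (MvPolynomial.pderiv j w.1))).trans
      (mul_le_mul_of_nonneg_left (Finset.sum_le_sum fun j _ => hj j) (Nat.cast_nonneg _))
    rw [← Finset.mul_sum, hWsum] at hsum
    simp only [Finset.card_univ, Fintype.card_fin, Nat.cast_add, Nat.cast_one] at hsum
    refine (mul_le_mul_of_nonneg_left hsum (sq_nonneg ε)).trans
      (le_of_eq_of_le ?_ (key hA2 (mul_nonneg hε hW0) hεH hSW hH1))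
    calc _ = ε ^ 2 * ((m + 1) * C ^ 2) * H * W * (h⁻¹ ^ (m + 1) * h ^ m) := by ring
      _ = _ := by rw [hpow1]; ring
  · refine (b.sq_sum_faces_le (X := C * h⁻¹ ^ (m + 1) * G)
      (a := fun F x => ev (v.2.1 F) x - ev v.1 x)
      (fun F => ((continuous_ev _).sub (continuous_ev _)).mul (continuous_dn _ _))
      (fun F => (continuous_ev _).sub (continuous_ev _)) (by positivity) fun F x hx => ?_).trans
      (le_of_eq_of_le ?_ (key hA1 hD0 hG hSD1 hG1))
    · rw [Pi.mul_apply, mul_pow, mul_comm]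
      exact mul_le_mul_of_nonneg_right ((dn_sq_le (hn F) _ _).trans (hX1 x (hface F hx)))
        (sq_nonneg _)
    · rw [← Mesh.jumpSq, ← hDdef]
      calc _ = C ^ 2 * G * D * (h⁻¹ ^ (m + 1) * h ^ m) := by ring
        _ = _ := by rw [hpow1]; ring
  · rw [mul_pow]
    refine (mul_le_mul_of_nonneg_left (b.sq_sum_faces_le (X := (m + 1) * C * h⁻¹ ^ (m + 3) * H)
      (a := fun F x => ev (v.2.1 F) x - ev v.1 x)
      (fun F => ((continuous_ev _).sub (continuous_ev _)).mul (continuous_dn _ _))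
      (fun F => (continuous_ev _).sub (continuous_ev _)) (by positivity) fun F x hx => ?_)
      (sq_nonneg ε)).trans (le_of_eq_of_le ?_ (key hA2 (by positivity) hεH hSD2 hH1))
    · rw [Pi.mul_apply, mul_pow, mul_comm]
      exact mul_le_mul_of_nonneg_right ((dn_sq_le (hn F) _ _).trans (hX3 x (hface F hx)))
        (sq_nonneg _)
    · rw [← Mesh.jumpSq, ← hDdef]
      calc _ = ε ^ 2 * ((m + 1) * C ^ 2) * H * D * (h⁻¹ ^ (m + 3) * h ^ m) := by ring
        _ = _ := by rw [hpow3]; ring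
  · rw [mul_pow]
    refine (mul_le_mul_of_nonneg_left (b.sq_sum_faces_le (X := C * h⁻¹ ^ (m + 1) * H)
      (a := fun F x => ev (faceProj k F (Mesh.jumpNormal v F)) x)
      (fun F => (continuous_ev _).mul (continuous_dnn _ _))
      (fun F => continuous_ev _) (by positivity) fun F x hx => ?_)
      (sq_nonneg ε)).trans (le_of_eq_of_le ?_ (key hA1 (by positivity) hεH hSP2 hH1))
    · rw [Pi.mul_apply, mul_pow, mul_comm]
      exact mul_le_mul_of_nonneg_right ((dnn_sq_le (hn F) _ _).trans (hX2 x (hface F hx)))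
        (sq_nonneg _)
    · rw [← Mesh.projJumpSq, ← hPdef]
      calc _ = ε ^ 2 * C ^ 2 * H * P * (h⁻¹ ^ (m + 1) * h ^ m) := by ring
        _ = ε ^ 2 * C ^ 2 * H * P * h⁻¹ * (h⁻¹ * h) := by
          rw [hpow1, inv_mul_cancel₀ hpos.ne', mul_one]
        _ = _ := by ring
  · rw [mul_pow]
    -- The tangential derivative of the jump is traded for the jump itself by the inverse inequality
    -- on faces, at the price of a third factor `C`.
    have hdt : ∑ F : T.intFacesOf K, ∫ x in F, ‖dt (faceNormal K F) (v.2.1 F - v.1 :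
        Poly (m + 1) (k + 2)) x‖ ^ 2 ∂(surf (m + 1)) ≤ C * h⁻¹ ^ 2 * D := by
      rw [hDdef, Mesh.jumpSq, Finset.mul_sum]
      refine Finset.sum_le_sum fun F _ => ?_
      have := b.face_inverse _ (v.2.1 F - v.1 : Poly (m + 1) (k + 2)).2 F F.2
      simpa only [Submodule.coe_sub, ev_sub] using this
    refine (mul_le_mul_of_nonneg_left ((b.sq_sum_faces_le (X := C * h⁻¹ ^ (m + 1) * H)
      (a := fun F x => ‖dt (faceNormal K F) (v.2.1 F - v.1 : Poly (m + 1) (k + 2)) x‖)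
      (fun F => (continuous_dt _ _).inner (continuous_dnt _ _))
      (fun F => (continuous_dt _ _).norm) (by positivity) fun F x hx => ?_).trans
      (mul_le_mul_of_nonneg_left hdt (by positivity)))
      (sq_nonneg ε)).trans (le_of_eq_of_le ?_ (key hA3 (by positivity) hεH hSD2 hH1))
    · calc _ ≤ (‖dt (faceNormal K F) (v.2.1 F - v.1 : Poly (m + 1) (k + 2)) x‖ *
            ‖dnt (faceNormal K F) w x‖) ^ 2 :=
            sq_le_sq.2 ((abs_real_inner_le_norm _ _).trans (le_abs_self _))
        _ ≤ _ := by
          rw [mul_pow, mul_comm]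
          exact mul_le_mul_of_nonneg_right ((norm_dnt_sq_le (hn F) _ _).trans
            (hX2 x (hface F hx))) (sq_nonneg _)
    · calc _ = ε ^ 2 * C ^ 3 * H * D * h⁻¹ ^ 2 * (h⁻¹ ^ (m + 1) * h ^ m) := by ring
        _ = _ := by rw [hpow1]; ring

end CellBounds

end HHO

namespace HHO

/-! ### Linearity -/

section Linear

variable {M : Type*} [AddCommGroup M] [Module ℝ M]

theorem isLinearMap_add {f g : M → ℝ} (hf : IsLinearMap ℝ f) (hg : IsLinearMap ℝ g) :
    IsLinearMap ℝ fun p => f p + g p :=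
  (hf.mk' f + hg.mk' g).isLinear

theorem isLinearMap_sub {f g : M → ℝ} (hf : IsLinearMap ℝ f) (hg : IsLinearMap ℝ g) :
    IsLinearMap ℝ fun p => f p - g p :=
  (hf.mk' f - hg.mk' g).isLinear

theorem isLinearMap_const_mul {f : M → ℝ} (a : ℝ) (hf : IsLinearMap ℝ f) :
    IsLinearMap ℝ fun p => a * f p :=
  (a • hf.mk' f).isLinear

theorem isLinearMap_sum {ι : Type*} (s : Finset ι) {f : ι → M → ℝ}
    (hf : ∀ i, IsLinearMap ℝ (f i)) : IsLinearMap ℝ fun p => ∑ i ∈ s, f i p where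
  map_add p q := by simp only [(hf _).map_add, Finset.sum_add_distrib]
  map_smul a p := by simp only [(hf _).map_smul, Finset.smul_sum]

theorem isLinearMap_integral {α : Type*} [MeasurableSpace α] {μ : Measure α} {f : M → α → ℝ}
    (hi : ∀ p, Integrable (f p) μ) (hf : ∀ x, IsLinearMap ℝ fun p => f p x) :
    IsLinearMap ℝ fun p => ∫ x, f p x ∂μ where
  map_add p q := by
    simp only [(hf _).map_add]
    exact integral_add (hi p) (hi q)
  map_smul a p := by
    simp only [(hf _).map_smul]
    exact integral_smul a _

end Linear

variable {m : ℕ}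

theorem isLinearMap_ev (x : Pt (m + 1)) :
    IsLinearMap ℝ fun p : MvPolynomial (Fin (m + 1)) ℝ => ev p x :=
  ⟨fun p q => by simp, fun a p => by simp⟩

theorem lap_add (p q : MvPolynomial (Fin (m + 1)) ℝ) : lap (p + q) = lap p + lap q := by
  simp [lap, Finset.sum_add_distrib]

theorem lap_smul (a : ℝ) (p : MvPolynomial (Fin (m + 1)) ℝ) : lap (a • p) = a • lap p := by
  simp [lap, Finset.smul_sum]

theorem isLinearMap_dn (n x : Pt (m + 1)) :
    IsLinearMap ℝ fun p : MvPolynomial (Fin (m + 1)) ℝ => dn n p x :=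
  ⟨fun p q => by simp [dn, inner_add_left], fun a p => by simp [dn, inner_smul_left]⟩

theorem isLinearMap_comp_lap {f : MvPolynomial (Fin (m + 1)) ℝ → ℝ} (hf : IsLinearMap ℝ f) :
    IsLinearMap ℝ fun p => f (lap p) :=
  ⟨fun p q => by rw [lap_add, hf.map_add], fun a p => by rw [lap_smul, hf.map_smul]⟩

theorem hessMul_add (n x : Pt (m + 1)) (p q : MvPolynomial (Fin (m + 1)) ℝ) :
    hessMul n (p + q) x = hessMul n p x + hessMul n q x := by
  ext i
  simp only [PiLp.add_apply, hessMul_apply, map_add]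
  exact (isLinearMap_dn n x).map_add _ _

theorem hessMul_smul (n x : Pt (m + 1)) (a : ℝ) (p : MvPolynomial (Fin (m + 1)) ℝ) :
    hessMul n (a • p) x = a • hessMul n p x := by
  ext i
  rw [PiLp.smul_apply, hessMul_apply, hessMul_apply, Derivation.map_smul]
  exact (isLinearMap_dn n x).map_smul a (MvPolynomial.pderiv i p)

theorem isLinearMap_dnn (n x : Pt (m + 1)) :
    IsLinearMap ℝ fun p : MvPolynomial (Fin (m + 1)) ℝ => dnn n p x :=
  ⟨fun p q => by simp only [dnn, hessMul_add, inner_add_left],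
    fun a p => by simp only [dnn, hessMul_smul, real_inner_smul_left, smul_eq_mul]⟩

theorem isLinearMap_inner_dnt (n x u : Pt (m + 1)) :
    IsLinearMap ℝ fun p : MvPolynomial (Fin (m + 1)) ℝ => (inner ℝ u (dnt n p x) : ℝ) := by
  have h := isLinearMap_dnn n x
  refine ⟨fun p q => ?_, fun a p => ?_⟩
  · simp only [dnt, hessMul_add, h.map_add, inner_add_right, inner_sub_right,
      real_inner_smul_right]
    ring
  · simp only [dnt, hessMul_smul, h.map_smul, inner_sub_right, real_inner_smul_right, smul_eq_mul]
    ring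

theorem isLinearMap_hess (i j : Fin (m + 1)) (x : Pt (m + 1)) :
    IsLinearMap ℝ fun p : MvPolynomial (Fin (m + 1)) ℝ => hess p x i j :=
  ⟨fun p q => by simp [hess], fun a p => by simp [hess]⟩

theorem isLinearMap_inner_grad (x u : Pt (m + 1)) :
    IsLinearMap ℝ fun p : MvPolynomial (Fin (m + 1)) ℝ => (inner ℝ u (grad p x) : ℝ) :=
  ⟨fun p q => by simp [inner_add_right], fun a p => by simp [inner_smul_right]⟩

theorem innerEps_comm (ε : ℝ) (K : Set (Pt (m + 1))) (v w : MvPolynomial (Fin (m + 1)) ℝ) :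
    innerEps ε K v w = innerEps ε K w v := by
  simp only [innerEps, mul_comm (hess v _ _ _), real_inner_comm (grad v _)]

theorem innerEps_self_nonneg {ε : ℝ} (hε : 0 ≤ ε) (K : Set (Pt (m + 1)))
    (w : MvPolynomial (Fin (m + 1)) ℝ) : 0 ≤ innerEps ε K w w := by
  rw [innerEps_self]
  exact add_nonneg (mul_nonneg hε (integral_nonneg fun _ => hessSq_nonneg _ _))
    (integral_nonneg fun _ => sq_nonneg _)

variable {Ω : Set (Pt (m + 1))} {T : Mesh (m + 1) Ω} {K : Set (Pt (m + 1))} {k : ℕ}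

/-! ### Linearity of the discrete forms and solvability of the reconstruction problem -/

namespace CellBounds

variable {C h : ℝ} {c : Pt (m + 1)}

theorem isLinearMap_innerEps (b : CellBounds T K (k + 2) C h c) (ε : ℝ)
    (v : MvPolynomial (Fin (m + 1)) ℝ) : IsLinearMap ℝ (innerEps ε K v) := by
  unfold innerEps
  refine isLinearMap_add (isLinearMap_const_mul _ (isLinearMap_integral (fun p => ?_) fun x =>
    isLinearMap_sum _ fun i => isLinearMap_sum _ fun j =>
      isLinearMap_const_mul _ (isLinearMap_hess i j x)))
    (isLinearMap_integral (fun p => ?_) fun x => isLinearMap_inner_grad _ _)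
  · exact b.integrableOn_cell (continuous_finsetSum _ fun i _ => continuous_finsetSum _ fun j _ =>
      (continuous_ev _).mul (continuous_ev _))
  · exact b.integrableOn_cell ((continuous_grad _).inner (continuous_grad _))

theorem isLinearMap_reconstructionRHS (b : CellBounds T K (k + 2) C h c) (ε : ℝ)
    (v : T.LocalSpace K k) : IsLinearMap ℝ (T.reconstructionRHS ε v) := by
  unfold Mesh.reconstructionRHS
  refine isLinearMap_sub (isLinearMap_add (isLinearMap_sub
      (isLinearMap_integral (fun p => ?_) fun x => isLinearMap_const_mul _ (isLinearMap_const_mul _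
        (isLinearMap_comp_lap (isLinearMap_comp_lap (isLinearMap_ev x)))))
      (isLinearMap_integral (fun p => ?_) fun x =>
        isLinearMap_const_mul _ (isLinearMap_comp_lap (isLinearMap_ev x))))
      (isLinearMap_sum _ fun F => isLinearMap_integral (fun p => ?_) fun x =>
        isLinearMap_const_mul _ (isLinearMap_dn _ x)))
    (isLinearMap_const_mul ε (isLinearMap_sub (isLinearMap_sub
      (isLinearMap_sum _ fun F => isLinearMap_integral (fun p => ?_) fun x =>
        isLinearMap_const_mul _ (isLinearMap_comp_lap (isLinearMap_dn _ x)))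
      (isLinearMap_sum _ fun F => isLinearMap_integral (fun p => ?_) fun x =>
        isLinearMap_const_mul _ (isLinearMap_dnn _ x)))
      (isLinearMap_sum _ fun F => isLinearMap_integral (fun p => ?_) fun x =>
        isLinearMap_inner_dnt _ x _)))
  · exact b.integrableOn_cell ((continuous_ev _).mul (continuous_const.mul (continuous_ev _)))
  · exact b.integrableOn_cell ((continuous_ev _).mul (continuous_ev _))
  · exact b.integrableOn_face F ((continuous_ev _).mul (continuous_dn _ _))
  · exact b.integrableOn_face F ((continuous_ev _).mul (continuous_dn _ _))
  · exact b.integrableOn_face F ((continuous_ev _).mul (continuous_dnn _ _))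
  · exact b.integrableOn_face F ((continuous_dt _ _).inner (continuous_dnt _ _))

theorem isLinearMap_mean (b : CellBounds T K (k + 2) C h c) :
    IsLinearMap ℝ fun p : MvPolynomial (Fin (m + 1)) ℝ => ∫ x in K, ev p x :=
  isLinearMap_integral (fun p => b.integrableOn_cell (continuous_ev p)) isLinearMap_ev

/-- The partial derivatives vanish on the open set `K`, hence as polynomials, so `w` is constant on
all of space and no connectedness of `K` is needed; the zero mean then excludes nonzero constants.
-/
theorem eq_zero_of_innerEps_self (b : CellBounds T K (k + 2) C h c) {ε : ℝ} (hε : 0 ≤ ε)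
    {w : MvPolynomial (Fin (m + 1)) ℝ} (h0 : innerEps ε K w w = 0)
    (hm : ∫ x in K, ev w x = 0) : w = 0 := by
  have hKo := T.cell_open K b.mem_cells
  have hKn := T.cell_nonempty K b.mem_cells
  have hG : ∫ x in K, ‖grad w x‖ ^ 2 = 0 := by
    rw [innerEps_self] at h0
    have h1 : 0 ≤ ε * ∫ x in K, hessSq w x :=
      mul_nonneg hε (integral_nonneg fun _ => hessSq_nonneg _ _)
    have h2 : 0 ≤ ∫ x in K, ‖grad w x‖ ^ 2 := integral_nonneg fun _ => sq_nonneg _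
    linarith
  have hgrad := eqOn_zero_of_setIntegral_eq_zero hKo b.isBounded
    ((continuous_grad w).norm.pow 2) (fun x => sq_nonneg _) hG
  have hp : ∀ i, MvPolynomial.pderiv i w = 0 := fun i =>
    eq_zero_of_ev_eq_zero hKo hKn fun x hx => by
      have : grad w x = 0 := by simpa using hgrad x hx
      simpa using congrArg (fun u => u i) this
  have hconst : ∀ x, ev w x = ev w c := fun x => by
    refine is_const_of_fderiv_eq_zero (𝕜 := ℝ)
      (fun y => (hasFDerivAt_ev w y).differentiableAt) (fun y => ?_) x c
    have : grad w y = 0 := by ext i; simp [hp i, ev_zero]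
    rw [(hasFDerivAt_ev w y).fderiv, this, map_zero]
  simp only [hconst, setIntegral_const, smul_eq_mul] at hm
  have hvol : volume.real K ≠ 0 :=
    (ENNReal.toReal_pos (hKo.measure_pos volume hKn).ne' b.isBounded.measure_lt_top.ne).ne'
  have hz := (mul_eq_zero.1 hm).resolve_left hvol
  exact eq_zero_of_ev_eq_zero hKo hKn fun x _ => by rw [hconst, hz]

theorem reconstructionRHS_C (ε : ℝ) (v : T.LocalSpace K k) (a : ℝ) :
    T.reconstructionRHS ε v (MvPolynomial.C a) = 0 := by
  have h1 : lap (MvPolynomial.C a : MvPolynomial (Fin (m + 1)) ℝ) = 0 := by simp [lap]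
  have h2 : lap (0 : MvPolynomial (Fin (m + 1)) ℝ) = 0 := by simp [lap]
  have h3 : ∀ n x : Pt (m + 1), dn n (MvPolynomial.C a) x = 0 := by simp [dn_eq_sum]
  have h4 : ∀ n x : Pt (m + 1), dn n 0 x = 0 := by simp [dn_eq_sum]
  have h5 : ∀ n x : Pt (m + 1), hessMul n (MvPolynomial.C a) x = 0 := fun n x => by
    ext i; simp [hessMul_apply, h4]
  simp [Mesh.reconstructionRHS, h1, h2, h3, h4, dnn, dnt, h5]

theorem innerEps_C (ε : ℝ) (v : MvPolynomial (Fin (m + 1)) ℝ) (a : ℝ) :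
    innerEps ε K v (MvPolynomial.C a) = 0 := by
  simp [innerEps, hess, PiLp.inner_apply]

/-- Adding the product of the means makes the energy form definite on the whole polynomial space.
The problem with the mean constraint becomes a single representation problem. -/
theorem existsUnique_isReconstruction (b : CellBounds T K (k + 2) C h c) {ε : ℝ} (hε : 0 ≤ ε)
    (v : T.LocalSpace K k) : ∃! r, T.IsReconstruction ε v r := by
  have hI := b.isLinearMap_innerEps ε
  have hM := b.isLinearMap_mean
  let B : Poly (m + 1) (k + 2) →ₗ[ℝ] Poly (m + 1) (k + 2) →ₗ[ℝ] ℝ :=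
    LinearMap.mk₂ ℝ (fun p q => innerEps ε K p q + (∫ x in K, ev p x) * ∫ x in K, ev q x)
      (fun p p' q => by
        simp only [innerEps_comm ε K _ q.1, Submodule.coe_add, (hI _).map_add, hM.map_add]; ring)
      (fun a p q => by
        simp only [innerEps_comm ε K _ q.1, Submodule.coe_smul, (hI _).map_smul, hM.map_smul,
          smul_eq_mul]; ring)
      (fun p q q' => by simp only [Submodule.coe_add, (hI _).map_add, hM.map_add]; ring)
      (fun a p q => by
        simp only [Submodule.coe_smul, (hI _).map_smul, hM.map_smul, smul_eq_mul]; ring)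
  have hB : ∀ p q, B p q = innerEps ε K p q + (∫ x in K, ev p x) * ∫ x in K, ev q x :=
    fun _ _ => rfl
  let l : Poly (m + 1) (k + 2) →ₗ[ℝ] ℝ :=
    ((isLinearMap_add (b.isLinearMap_reconstructionRHS ε v)
      (isLinearMap_const_mul (∫ x in K, ev v.1 x) hM)).mk' _).comp (Submodule.subtype _)
  have hl : ∀ p, l p = T.reconstructionRHS ε v p + (∫ x in K, ev v.1 x) * ∫ x in K, ev p x :=
    fun _ => rfl
  have hpos : ∀ p, B p p = 0 → p = 0 := by
    intro p hp
    rw [hB] at hp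
    have h1 := innerEps_self_nonneg hε K p.1
    have h2 := mul_self_nonneg (∫ x in K, ev p.1 x)
    exact Subtype.ext (b.eq_zero_of_innerEps_self hε (by linarith)
      (mul_self_eq_zero.1 (by linarith)))
  obtain ⟨r, hr⟩ := exists_represents B
    (fun p q => by rw [hB, hB, innerEps_comm, mul_comm]) l fun p hp => by rw [hpos p hp, map_zero]
  have hvol : ∫ x in K, ev (MvPolynomial.C 1 : MvPolynomial (Fin (m + 1)) ℝ) x ≠ 0 := by
    simp only [ev_C, setIntegral_const, smul_eq_mul, mul_one]
    exact (ENNReal.toReal_pos ((T.cell_open K b.mem_cells).measure_pos volume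
      (T.cell_nonempty K b.mem_cells)).ne' b.isBounded.measure_lt_top.ne).ne'
  have hrec : T.IsReconstruction ε v r := by
    refine ⟨fun w hw => ?_, ?_⟩
    · have := hr w
      rwa [hB, hl, hw, mul_zero, mul_zero, add_zero, add_zero] at this
    -- Tested with the constant one, both the energy and the right-hand side of the reconstruction
    -- vanish, leaving the equality of the means.
    · have := hr ⟨_, C_mem_poly _ 1⟩
      rw [hB, hl, innerEps_C, reconstructionRHS_C, zero_add, zero_add] at this
      exact mul_right_cancel₀ hvol this
  refine ⟨r, hrec, fun r' hr' => ?_⟩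
  · have hmean : ∫ x in K, ev (r' - r : Poly (m + 1) (k + 2)).1 x = 0 := by
      rw [Submodule.coe_sub, hM.map_sub, hr'.2, hrec.2, sub_self]
    refine sub_eq_zero.1 (Subtype.ext (b.eq_zero_of_innerEps_self hε ?_ hmean))
    have h1 := hr'.1 _ hmean
    have h2 := hrec.1 _ hmean
    rw [innerEps_comm] at h1 h2
    conv_lhs => rw [show ((r' - r : Poly (m + 1) (k + 2)) : MvPolynomial (Fin (m + 1)) ℝ) =
      r'.1 - r.1 from rfl]
    rw [(hI _).map_sub]
    exact sub_eq_zero.2 (h1.trans h2.symm)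

end CellBounds

end HHO

namespace HHO

/-! ### Local stability and boundedness -/

variable {m : ℕ} {Ω : Set (Pt (m + 1))} {T : Mesh (m + 1) Ω} {K : Set (Pt (m + 1))} {k : ℕ}

/-- `‖(1 - Π)(γ_∂K - ∂ₙv_K)‖²` on the interior faces. -/
def Mesh.projErrorSq (v : T.LocalSpace K k) : ℝ :=
  ∑ F : T.intFacesOf K, ∫ x in F,
    (Mesh.jumpNormal v F x - ev (faceProj k F (Mesh.jumpNormal v F)) x) ^ 2 ∂(surf (m + 1))

theorem sq_ev_sub_le {p : MvPolynomial (Fin (m + 1)) ℝ} {c x : Pt (m + 1)} {h X : ℝ} (hX : 0 ≤ X)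
    (hp : ∀ y ∈ Metric.closedBall c h, ‖grad p y‖ ^ 2 ≤ X) (hx : x ∈ Metric.closedBall c h) :
    (ev p x - ev p c) ^ 2 ≤ h ^ 2 * X := by
  have hh : 0 ≤ h := Metric.nonneg_of_mem_closedBall hx
  have h1 := (convex_closedBall c h).norm_image_sub_le_of_norm_fderiv_le (𝕜 := ℝ) (f := ev p)
    (C := √X) (fun y _ => (hasFDerivAt_ev p y).differentiableAt) (fun y hy => by
      rw [(hasFDerivAt_ev p y).fderiv, innerSL_apply_norm]
      exact Real.le_sqrt_of_sq_le (hp y hy)) (Metric.mem_closedBall_self hh) hx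
  have h2 : ‖ev p x - ev p c‖ ≤ √X * h :=
    h1.trans (mul_le_mul_of_nonneg_left (mem_closedBall_iff_norm.1 hx) (Real.sqrt_nonneg _))
  calc (ev p x - ev p c) ^ 2 = ‖ev p x - ev p c‖ ^ 2 := by rw [Real.norm_eq_abs, sq_abs]
    _ ≤ (√X * h) ^ 2 := pow_le_pow_left₀ (norm_nonneg _) h2 2
    _ = _ := by rw [mul_pow, Real.sq_sqrt hX]; ring

namespace CellBounds

variable {C h : ℝ} {c : Pt (m + 1)}

/-- By best approximation, the projection may be replaced by any competitor `q F` of degree `k`,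
chosen separately on each face. -/
theorem projErrorSq_le (b : CellBounds T K (k + 2) C h c) (v : T.LocalSpace K k) {X : ℝ}
    (hX0 : 0 ≤ X) (q : T.intFacesOf K → Poly (m + 1) k)
    (hX : ∀ F : T.intFacesOf K, ∀ x ∈ (F : Set (Pt (m + 1))),
      (Mesh.jumpNormal v F x - ev (q F) x) ^ 2 ≤ X) :
    Mesh.projErrorSq v ≤ X * (C * h ^ m) := by
  have hF : ∀ F : T.intFacesOf K, ∫ x in F, (Mesh.jumpNormal v F x -
      ev (faceProj k F (Mesh.jumpNormal v F)) x) ^ 2 ∂(surf (m + 1)) ≤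
      X * (surf (m + 1) F).toReal := fun F => by
    have hF := T.mem_intFacesOf.1 F.2
    have hc := Mesh.continuous_jumpNormal v F
    refine (integral_sq_sub_faceProj_le (fun f hf => b.integrableOn_face F hf) hc k (q F)).trans ?_
    refine (setIntegral_mono_on (b.integrableOn_face F ((hc.sub (continuous_ev _)).pow 2))
      (integrableOn_const (b.surf_ne_top hF.2))
      (T.isCompact_of_mem_intFaces hF.1).measurableSet (hX F)).trans (le_of_eq ?_)
    rw [setIntegral_const, smul_eq_mul, mul_comm, Measure.real]
  calc Mesh.projErrorSq v ≤ ∑ F : T.intFacesOf K, X * (surf (m + 1) F).toReal :=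
        Finset.sum_le_sum fun F _ => hF F
    _ = X * ∑ F : T.intFacesOf K, (surf (m + 1) F).toReal := (Finset.mul_sum _ _ _).symm
    _ ≤ _ := mul_le_mul_of_nonneg_left b.sum_surf_le hX0

theorem norm_grad_sub_sq_le (b : CellBounds T K (k + 2) C h c)
    {v : MvPolynomial (Fin (m + 1)) ℝ} (hv : v ∈ Poly (m + 1) (k + 2)) {x : Pt (m + 1)}
    (hx : x ∈ Metric.closedBall c h) :
    ‖grad v x - grad v c‖ ^ 2 ≤ h ^ 2 * (C * h⁻¹ ^ (m + 1) * ∫ x in K, hessSq v x) := by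
  have hC := b.nonneg
  have hpos := b.pos
  rw [EuclideanSpace.norm_sq_eq, b.integral_hessSq, Finset.mul_sum, Finset.mul_sum]
  refine Finset.sum_le_sum fun i _ => ?_
  rw [Real.norm_eq_abs, sq_abs, PiLp.sub_apply, grad_apply, grad_apply]
  have : 0 ≤ ∫ x in K, ‖grad (MvPolynomial.pderiv i v) x‖ ^ 2 :=
    integral_nonneg fun _ => sq_nonneg _
  exact sq_ev_sub_le (by positivity) (fun y hy => b.norm_grad_sq_le
    (poly_mono (Nat.sub_le _ _) (pderiv_mem_poly hv i)) hy) hx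

/-- If `σ = 1`, the competitor `γ` leaves `∂ₙv_K`, which is bounded by `∇v_K` with a trace
inequality. If `σ = ε h⁻²`, the competitor is `γ` minus the constant `∂ₙv_K(c)`; the oscillation
that remains gains a factor `h` and is bounded by `∇²v_K`. -/
theorem sigma_mul_projErrorSq_le (b : CellBounds T K (k + 2) C (Metric.diam K) c) {ε : ℝ}
    (hε : 0 ≤ ε) (v : T.LocalSpace K k) :
    sigma ε K * Metric.diam K * Mesh.projErrorSq v ≤ C ^ 2 * innerEps ε K v.1 v.1 := by
  have hC := b.nonneg
  have hpos := b.pos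
  have hn : ∀ F : T.intFacesOf K, ‖faceNormal K F‖ = 1 := fun F =>
    T.norm_faceNormal b.mem_cells F.2
  have hG : 0 ≤ ∫ x in K, ‖grad v.1.1 x‖ ^ 2 := integral_nonneg fun _ => sq_nonneg _
  have hH : 0 ≤ ∫ x in K, hessSq v.1.1 x := integral_nonneg fun _ => hessSq_nonneg _ _
  have hpow1 : (Metric.diam K)⁻¹ ^ (m + 1) * Metric.diam K ^ m = (Metric.diam K)⁻¹ := by
    rw [pow_succ', mul_assoc, ← mul_pow, inv_mul_cancel₀ hpos.ne', one_pow, mul_one]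
  have hinv := inv_mul_cancel₀ hpos.ne'
  rw [innerEps_self]
  rcases max_choice 1 (ε * (Metric.diam K)⁻¹ ^ 2) with h1 | h1
  · rw [sigma, h1, one_mul]
    have := b.projErrorSq_le v (X := C * (Metric.diam K)⁻¹ ^ (m + 1) *
      ∫ x in K, ‖grad v.1.1 x‖ ^ 2) (by positivity) v.2.2 fun F x hx => by
        rw [Mesh.jumpNormal, sub_sub_cancel_left, neg_sq]
        exact (dn_sq_le (hn F) _ _).trans (b.norm_grad_sq_le v.1.2 (b.face_subset F hx))
    refine (mul_le_mul_of_nonneg_left this hpos.le).trans ?_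
    calc _ = C ^ 2 * (∫ x in K, ‖grad v.1.1 x‖ ^ 2) * Metric.diam K *
          ((Metric.diam K)⁻¹ ^ (m + 1) * Metric.diam K ^ m) := by ring
      _ = C ^ 2 * (∫ x in K, ‖grad v.1.1 x‖ ^ 2) * ((Metric.diam K)⁻¹ * Metric.diam K) := by
        rw [hpow1]; ring
      _ = C ^ 2 * ∫ x in K, ‖grad v.1.1 x‖ ^ 2 := by rw [hinv, mul_one]
      _ ≤ _ := mul_le_mul_of_nonneg_left (le_add_of_nonneg_left (by positivity)) (by positivity)
  · rw [sigma, h1]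
    have := b.projErrorSq_le v (X := Metric.diam K ^ 2 * (C * (Metric.diam K)⁻¹ ^ (m + 1) *
      ∫ x in K, hessSq v.1.1 x)) (by positivity)
      (fun F => v.2.2 F - ⟨_, C_mem_poly k (dn (faceNormal K F) v.1 c)⟩) fun F x hx => by
        have e : Mesh.jumpNormal v F x - ev (v.2.2 F -
            ⟨_, C_mem_poly k (dn (faceNormal K F) v.1 c)⟩ : Poly (m + 1) k) x =
            -inner ℝ (grad v.1 x - grad v.1 c) (faceNormal K F) := by
          simp only [Mesh.jumpNormal, Submodule.coe_sub, ev_sub, ev_C, dn, inner_sub_left]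
          ring
        rw [e, neg_sq]
        refine le_trans ?_ (b.norm_grad_sub_sq_le v.1.2 (b.face_subset F hx))
        have := abs_real_inner_le_norm (grad v.1 x - grad v.1 c) (faceNormal K F)
        rw [hn F, mul_one] at this
        exact sq_le_sq.2 (this.trans (le_abs_self _))
    refine (mul_le_mul_of_nonneg_left this (by positivity)).trans ?_
    calc _ = C ^ 2 * ε * (∫ x in K, hessSq v.1.1 x) * ((Metric.diam K)⁻¹ * Metric.diam K) ^ 2 *
          Metric.diam K * ((Metric.diam K)⁻¹ ^ (m + 1) * Metric.diam K ^ m) := by ring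
      _ = C ^ 2 * ε * (∫ x in K, hessSq v.1.1 x) * ((Metric.diam K)⁻¹ * Metric.diam K) ^ 3 := by
        rw [hpow1]; ring
      _ = C ^ 2 * (ε * ∫ x in K, hessSq v.1.1 x) := by rw [hinv]; ring
      _ ≤ _ := mul_le_mul_of_nonneg_left (le_add_of_nonneg_right hG) (by positivity)

/-- Pythagoras for the normal jump: the seminorm exceeds the energy of `v_K` and the stabilization
by the projection error alone. -/
theorem localSeminormSq_eq (b : CellBounds T K (k + 2) C (Metric.diam K) c) (ε : ℝ)
    (v : T.LocalSpace K k) :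
    T.localSeminormSq ε v = innerEps ε K v.1 v.1 + Mesh.stab ε v +
      sigma ε K * Metric.diam K * Mesh.projErrorSq v := by
  have h1 : ∀ F : T.intFacesOf K, ∫ x in F, Mesh.jumpNormal v F x ^ 2 ∂(surf (m + 1)) =
      (∫ x in F, (Mesh.jumpNormal v F x - ev (faceProj k F (Mesh.jumpNormal v F)) x) ^ 2
        ∂(surf (m + 1))) +
      ∫ x in F, ev (faceProj k F (Mesh.jumpNormal v F)) x ^ 2 ∂(surf (m + 1)) := fun F => by
    have h := integral_sq_sub_eq (fun f hf => b.integrableOn_face F hf)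
      (Mesh.continuous_jumpNormal v F) k 0
    simpa only [ZeroMemClass.coe_zero, ev_zero, sub_zero] using h
  have h2 : ∑ F : T.intFacesOf K, ∫ x in F,
      (ev (v.2.2 F) x - dn (faceNormal K F) v.1 x) ^ 2 ∂(surf (m + 1)) =
      Mesh.projErrorSq v + Mesh.projJumpSq v := by
    rw [Mesh.projErrorSq, Mesh.projJumpSq, ← Finset.sum_add_distrib]
    exact Finset.sum_congr rfl fun F _ => h1 F
  rw [Mesh.localSeminormSq, b.stab_eq, h2, Mesh.jumpSq]
  ring

theorem isReconstruction_reconstruction (b : CellBounds T K (k + 2) C h c) {ε : ℝ} (hε : 0 ≤ ε)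
    (v : T.LocalSpace K k) : T.IsReconstruction ε v (T.reconstruction ε v) :=
  Classical.epsilon_spec (b.existsUnique_isReconstruction hε v).exists

theorem stab_nonneg (b : CellBounds T K (k + 2) C (Metric.diam K) c) {ε : ℝ} (hε : 0 ≤ ε)
    (v : T.LocalSpace K k) : 0 ≤ Mesh.stab ε v := by
  rw [b.stab_eq]
  have hσ := zero_le_one.trans (one_le_sigma ε K)
  have h1 := Mesh.jumpSq_nonneg v
  have h2 := Mesh.projJumpSq_nonneg v
  have h3 : 0 ≤ ∫ x in frontier K ∩ frontier Ω, ev v.1 x ^ 2 ∂(surf (m + 1)) :=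
    integral_nonneg fun _ => sq_nonneg _
  have h4 : 0 ≤ ∫ x in frontier K ∩ frontier Ω, ‖grad v.1 x‖ ^ 2 ∂(surf (m + 1)) :=
    integral_nonneg fun _ => sq_nonneg _
  have := b.pos
  positivity

/-- `r - v_K` has zero mean, hence is an admissible test function, and for it the energy is the
consistency error. One power of the energy then cancels in `sq_consistency_le`. -/
theorem innerEps_sub_self_le (b : CellBounds T K (k + 2) C (Metric.diam K) c) {ε : ℝ}
    (hε : 0 ≤ ε) {v : T.LocalSpace K k} {r : Poly (m + 1) (k + 2)}
    (hr : T.IsReconstruction ε v r) :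
    innerEps ε K (r - v.1 : Poly (m + 1) (k + 2)) (r - v.1 : Poly (m + 1) (k + 2)) ≤
      49 * ((m + 1) * C ^ 3) * Mesh.stab ε v := by
  have hI := b.isLinearMap_innerEps ε
  have hC := b.nonneg
  have hS := b.stab_nonneg hε v
  have hmean : ∫ x in K, ev (r - v.1 : Poly (m + 1) (k + 2)).1 x = 0 := by
    rw [Submodule.coe_sub, b.isLinearMap_mean.map_sub, hr.2, sub_self]
  have h1 : innerEps ε K (r - v.1 : Poly (m + 1) (k + 2)) (r - v.1 : Poly (m + 1) (k + 2)) =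
      T.reconstructionRHS ε v (r - v.1 : Poly (m + 1) (k + 2)) -
        innerEps ε K v.1 (r - v.1 : Poly (m + 1) (k + 2)) := by
    rw [← hr.1 _ hmean, innerEps_comm ε K r.1, innerEps_comm ε K v.1.1, ← (hI _).map_sub]
    rfl
  have h2 := b.sq_consistency_le hε v (r - v.1)
  rw [← h1] at h2
  have h0 := innerEps_self_nonneg hε K (r - v.1 : Poly (m + 1) (k + 2)).1
  rcases eq_or_lt_of_le h0 with h0 | h0
  · rw [← h0]; positivity
  · rw [sq, ← mul_assoc] at h2
    exact le_of_mul_le_mul_right h2 h0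

/-- The constant `α⁻¹` of the stability estimate. -/
def stabilityConst (m : ℕ) (C : ℝ) : ℝ := (1 + C ^ 2) * (3 + 2 * (49 * ((m + 1) * C ^ 3)))

/-- The energies of `r` and `v_K` bound each other up to a multiple of the stabilization, because
that of `r - v_K` is such a multiple. The projection error costs at most `C²` times the energy of
`v_K`, whence the factor `1 + C ^ 2`. -/
theorem local_stability (b : CellBounds T K (k + 2) C (Metric.diam K) c) {ε : ℝ} (hε : 0 ≤ ε)
    (v : T.LocalSpace K k) :
    T.localSeminormSq ε v ≤ stabilityConst m C *
      (innerEps ε K (T.reconstruction ε v) (T.reconstruction ε v) + T.stabInt ε v v +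
        T.stabBdry ε K v.1 v.1) ∧
    innerEps ε K (T.reconstruction ε v) (T.reconstruction ε v) + T.stabInt ε v v +
      T.stabBdry ε K v.1 v.1 ≤ stabilityConst m C * T.localSeminormSq ε v := by
  have hC := b.nonneg
  rw [add_assoc, ← Mesh.stab, b.localSeminormSq_eq]
  have hr := b.isReconstruction_reconstruction hε v
  set r := T.reconstruction ε v
  have hD := b.innerEps_sub_self_le hε hr
  have hQ := b.sigma_mul_projErrorSq_le hε v
  have hQ0 : 0 ≤ sigma ε K * Metric.diam K * Mesh.projErrorSq v := by
    have := zero_le_one.trans (one_le_sigma ε K)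
    have := b.pos
    have : 0 ≤ Mesh.projErrorSq v :=
      Finset.sum_nonneg fun _ _ => integral_nonneg fun _ => sq_nonneg _
    positivity
  have hS := b.stab_nonneg hε v
  have hN := innerEps_self_nonneg hε K v.1.1
  have hR := innerEps_self_nonneg hε K r.1
  have hI := b.isLinearMap_innerEps ε
  have e0 : ∀ (a : ℝ) (p q : MvPolynomial (Fin (m + 1)) ℝ),
      innerEps ε K (a • p - q) (a • p - q) =
        a ^ 2 * innerEps ε K p p - 2 * a * innerEps ε K p q + innerEps ε K q q := fun a p q => by
    have l : ∀ u, innerEps ε K (a • p - q) u =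
        a * innerEps ε K p u - innerEps ε K q u := fun u => by
      rw [innerEps_comm, (hI u).map_sub, (hI u).map_smul, innerEps_comm ε K u p,
        innerEps_comm ε K u q, smul_eq_mul]
    rw [l, (hI p).map_sub, (hI p).map_smul, (hI q).map_sub, (hI q).map_smul, innerEps_comm ε K q p,
      smul_eq_mul, smul_eq_mul]
    ring
  have e1 : innerEps ε K (r - v.1 : Poly (m + 1) (k + 2)) (r - v.1 : Poly (m + 1) (k + 2)) =
      innerEps ε K r r - 2 * innerEps ε K r v.1 + innerEps ε K v.1 v.1 := by
    have := e0 1 r v.1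
    rw [Submodule.coe_sub]
    simpa only [one_smul, one_pow, one_mul, mul_one] using this
  -- Nonnegativity of the energy of `2p - q` is the triangle inequality `|q|² ≤ 2|p|² + 2|p - q|²`.
  have e2 : ∀ p q : MvPolynomial (Fin (m + 1)) ℝ, 0 ≤ 4 * innerEps ε K p p -
      4 * innerEps ε K p q + innerEps ε K q q := fun p q => by
    have h0 := innerEps_self_nonneg hε K ((2 : ℝ) • p - q)
    rw [e0] at h0
    linarith
  have e3 := e2 r v.1
  have e4 := e2 v.1 r
  rw [innerEps_comm ε K v.1.1 r.1] at e4
  rw [e1] at hD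
  set N := innerEps ε K v.1 v.1
  set R := innerEps ε K r r
  set S := Mesh.stab ε v
  set Q := sigma ε K * Metric.diam K * Mesh.projErrorSq v
  set M₁ := 49 * ((m + 1) * C ^ 3) with hM
  have hM0 : 0 ≤ M₁ := by positivity
  have hM2 : 0 ≤ C ^ 2 := by positivity
  have f1 : N ≤ 2 * R + 2 * (M₁ * S) := by linarith
  have f2 : R ≤ 2 * N + 2 * (M₁ * S) := by linarith
  have hM1S : 0 ≤ M₁ * S := by positivity
  rw [stabilityConst, ← hM]
  constructor
  · calc N + S + Q ≤ (1 + C ^ 2) * N + S := by linarith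
      _ ≤ (1 + C ^ 2) * (2 * R + 2 * (M₁ * S)) + (1 + C ^ 2) * S := by
        have h1 := mul_le_mul_of_nonneg_left f1 (by positivity : 0 ≤ 1 + C ^ 2)
        have h2 := mul_nonneg hM2 hS
        linarith
      _ = (1 + C ^ 2) * (2 * R + (2 * M₁ + 1) * S) := by ring
      _ ≤ (1 + C ^ 2) * ((3 + 2 * M₁) * (R + S)) := by
        refine mul_le_mul_of_nonneg_left ?_ (by positivity)
        have := mul_nonneg hM0 hR
        linarith
      _ = _ := by ring
  · calc R + S ≤ (3 + 2 * M₁) * (N + S + Q) := by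
          have h1 := mul_nonneg hM0 hN
          have h2 := mul_nonneg hM0 hQ0
          linarith
      _ ≤ (1 + C ^ 2) * ((3 + 2 * M₁) * (N + S + Q)) :=
        le_mul_of_one_le_left (by positivity) (by linarith)
      _ = _ := by ring

end CellBounds

end HHO

end

theorem lemma4p1 (d : ℕ) (hd : d = 2 ∨ d = 3) (k : ℕ) (ϱ : ℝ) (hϱ : 0 < ϱ) :
    ∃ α : ℝ, 0 < α ∧
      ∀ (Ω : Set (EuclideanSpace ℝ (Fin d))), IsOpen Ω → Bornology.IsBounded Ω →
      ∀ T : HHO.Mesh d Ω, T.ShapeRegular ϱ →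
      ∀ ε : ℝ, 0 ≤ ε →
        (∀ K ∈ T.cells, ∀ v : T.LocalSpace K k,
          (∃! r, T.IsReconstruction ε v r) ∧
          α * T.localSeminormSq ε v ≤
            HHO.innerEps ε K (T.reconstruction ε v) (T.reconstruction ε v) +
              T.stabInt ε v v + T.stabBdry ε K v.1 v.1 ∧
          HHO.innerEps ε K (T.reconstruction ε v) (T.reconstruction ε v) +
              T.stabInt ε v v + T.stabBdry ε K v.1 v.1 ≤
            α⁻¹ * T.localSeminormSq ε v) ∧
        ∀ v : T.GlobalSpace k, α * T.globalNormSq ε v ≤ T.globalForm ε v v := by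
  -- Surfaces have dimension `m = d - 1`. The condition `1 ≤ m` is what the sweep estimate needs for
  -- sets of zero diameter.
  obtain ⟨m, hm, rfl⟩ : ∃ m, 1 ≤ m ∧ d = m + 1 := by
    rcases hd with rfl | rfl
    · exact ⟨1, le_rfl, rfl⟩
    · exact ⟨2, by norm_num, rfl⟩
  obtain ⟨C, hC, hcell⟩ := HHO.exists_cellBounds hm (k + 2) hϱ
  have hpos : 0 < HHO.CellBounds.stabilityConst m C := by
    unfold HHO.CellBounds.stabilityConst; positivity
  refine ⟨(HHO.CellBounds.stabilityConst m C)⁻¹, inv_pos.2 hpos, fun Ω _ hΩ T hT ε hε => ?_⟩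
  have hlocal : ∀ K ∈ T.cells, ∀ v : T.LocalSpace K k,
      (HHO.CellBounds.stabilityConst m C)⁻¹ * T.localSeminormSq ε v ≤
        HHO.innerEps ε K (T.reconstruction ε v) (T.reconstruction ε v) +
          T.stabInt ε v v + T.stabBdry ε K v.1 v.1 := fun K hK v => by
    obtain ⟨c, -, b⟩ := hcell Ω hΩ T hT K hK
    exact (inv_mul_le_iff₀ hpos).2 (b.local_stability hε v).1
  refine ⟨fun K hK v => ?_, fun v => ?_⟩
  · obtain ⟨c, -, b⟩ := hcell Ω hΩ T hT K hK
    refine ⟨b.existsUnique_isReconstruction hε v, hlocal K hK v, ?_⟩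
    rw [inv_inv]
    exact (b.local_stability hε v).2
  · rw [HHO.Mesh.globalNormSq, HHO.Mesh.globalForm, Finset.mul_sum]
    exact Finset.sum_le_sum fun K _ => hlocal K.1 K.2 (T.restrict v K)
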